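/- Let $\beta=\frac{\sqrt{17}-3}{2}$, $h(s)=(s(1-s))^{\beta/2}$ for $s\in[0,1]$, and $K_1=\frac{\Gamma(2\beta+2)\,\Gamma(\beta+2)}{2\,\Gamma(\beta+1)^3\,\Gamma(\beta/2+1)^2}$. Insert $n$ independent uniform random points of the unit square $[0,1]^2$ successively into an empty two-dimensional point quadtree, in which each node stores a point and has four subtrees, one for each quadrant determined by that point. For $s\in[0,1]$ let $C_n(s)$ be the cost of the partial match query at $s$, i.e. the number of nodes visited when reporting the points with first coordinate $s$: at a node storing $(x,y)$ the search continues in the two subtrees to the left of $x$ if $s<x$, and in the two subtrees to the right of $x$ if $s\ge x$. Let $Z=(Z(s))_{s\in[0,1]}$ be the limit process of these costs, i.e. the random continuous function such that, as $n\to\infty$, $$\left(\frac{C_n(s)}{K_1 n^{\beta}}\right)_{s\in[0,1]}\xrightarrow{\;d\;}(Z(s))_{s\in[0,1]}$$ in the space $\mathcal D[0,1]$ of càdlàg functions with the Skorokhod topology. Then there exists a random variable $\Psi\ge 0$ such that, for all $s\in[0,1]$, $$Z(s)\stackrel{d}{=}h(s)\,\Psi .$$ The distribution of $\Psi$ is the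 unique probability distribution on $\mathbb R$ with $\mathbb E[\Psi]=1$ and $\mathbb E[\Psi^2]<\infty$ that solves the fixed-point equation $$\Psi\stackrel{d}{=}U^{\beta/2}V^{\beta}\,\Psi+U^{\beta/2}(1-V)^{\beta}\,\Psi',$$ where $U,V$ are independent and uniform on $[0,1]$, $\Psi'$ is an independent copy of $\Psi$, and $(\Psi,\Psi')$ is independent of $(U,V)$. -/

import Mathlib

open MeasureTheory ProbabilityTheory Filter Topology Set

namespace PartialMatch

noncomputable section

/-! ### The space `D[0,1]` with the Skorokhod topology -/

/-- Càdlàg functions on `[0,1]`: right-continuous, with left limits (at `0` the left limit and at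
`1` the right-continuity are void conditions). -/
def IsCadlag (f : unitInterval → ℝ) : Prop :=
  (∀ t, ContinuousWithinAt f (Ici t) t) ∧ ∀ t, ∃ l, Tendsto f (𝓝[<] t) (𝓝 l)

theorem IsCadlag.const (c : ℝ) : IsCadlag (fun _ => c) :=
  ⟨fun _ => continuousWithinAt_const, fun _ => ⟨c, tendsto_const_nhds⟩⟩

theorem IsCadlag.add {f g : unitInterval → ℝ} (hf : IsCadlag f) (hg : IsCadlag g) :
    IsCadlag (fun t => f t + g t) := by
  refine ⟨fun t => (hf.1 t).add (hg.1 t), fun t => ?_⟩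
  obtain ⟨a, ha⟩ := hf.2 t
  obtain ⟨b, hb⟩ := hg.2 t
  exact ⟨a + b, ha.add hb⟩

theorem IsCadlag.div_const {f : unitInterval → ℝ} (hf : IsCadlag f) (c : ℝ) :
    IsCadlag (fun t => f t / c) := by
  refine ⟨fun t => (hf.1 t).div_const c, fun t => ?_⟩
  obtain ⟨a, ha⟩ := hf.2 t
  exact ⟨a / c, ha.div_const c⟩

theorem IsCadlag.ite {f g : unitInterval → ℝ} (hf : IsCadlag f) (hg : IsCadlag g) (a : ℝ) :
    IsCadlag (fun t => if (t : ℝ) < a then f t else g t) := by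
  refine ⟨fun t => ?_, fun t => ?_⟩
  · by_cases h : (t : ℝ) < a
    · have hev : ∀ᶠ x : unitInterval in 𝓝[Ici t] t, (x : ℝ) < a :=
        (continuous_subtype_val.continuousAt.eventually_lt continuousAt_const h).filter_mono
          nhdsWithin_le_nhds
      refine (hf.1 t).congr_of_eventuallyEq ?_ (if_pos h)
      filter_upwards [hev] with x hx
      exact if_pos hx
    · refine (hg.1 t).congr (fun x hx => if_neg ?_) (if_neg h)
      have hx' : (t : ℝ) ≤ x := hx
      exact fun hlt => h (hx'.trans_lt hlt)
  · by_cases h : (t : ℝ) ≤ a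
    · obtain ⟨l, hl⟩ := hf.2 t
      refine ⟨l, hl.congr' ?_⟩
      filter_upwards [self_mem_nhdsWithin] with x hx
      have hx' : (x : ℝ) < t := hx
      exact (if_pos (hx'.trans_le h)).symm
    · obtain ⟨l, hl⟩ := hg.2 t
      refine ⟨l, hl.congr' ?_⟩
      have hev : ∀ᶠ x : unitInterval in 𝓝[<] t, a < (x : ℝ) :=
        (continuousAt_const.eventually_lt continuous_subtype_val.continuousAt
          (not_le.mp h)).filter_mono nhdsWithin_le_nhds
      filter_upwards [hev] with x hx
      exact (if_neg (not_lt.mpr hx.le)).symm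

/-- The space `D[0,1]` of real càdlàg functions on `[0,1]`. -/
structure SkorokhodSpace where
  toFun : unitInterval → ℝ
  isCadlag : IsCadlag toFun

instance : CoeFun SkorokhodSpace (fun _ => unitInterval → ℝ) := ⟨SkorokhodSpace.toFun⟩

/-- `g` is `ε`-close to `f` up to an `ε`-small increasing bijective change of time. -/
def SkorokhodClose (ε : ℝ) (f g : SkorokhodSpace) : Prop :=
  ∃ lam : unitInterval ≃o unitInterval,
    ∀ t : unitInterval, |(lam t : ℝ) - t| < ε ∧ |g (lam t) - f t| < ε

/-- The Skorokhod (J1) topology: a set is open if with every `f` it contains, for some `ε > 0`, all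
the functions that are `ε`-close to `f`. -/
instance : TopologicalSpace SkorokhodSpace where
  IsOpen A := ∀ f ∈ A, ∃ ε > 0, ∀ g, SkorokhodClose ε f g → g ∈ A
  isOpen_univ := fun _ _ => ⟨1, one_pos, fun _ _ => mem_univ _⟩
  isOpen_inter := by
    rintro A B hA hB f ⟨hfA, hfB⟩
    obtain ⟨a, ha, hA⟩ := hA f hfA
    obtain ⟨b, hb, hB⟩ := hB f hfB
    refine ⟨min a b, lt_min ha hb, ?_⟩
    rintro g ⟨lam, h⟩
    exact ⟨hA g ⟨lam, fun t => ⟨(h t).1.trans_le (min_le_left _ _),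
        (h t).2.trans_le (min_le_left _ _)⟩⟩,
      hB g ⟨lam, fun t => ⟨(h t).1.trans_le (min_le_right _ _),
        (h t).2.trans_le (min_le_right _ _)⟩⟩⟩
  isOpen_sUnion := by
    rintro S hS f ⟨A, hA, hfA⟩
    obtain ⟨ε, hε, h⟩ := hS A hA f hfA
    exact ⟨ε, hε, fun g hg => ⟨A, hA, h g hg⟩⟩

instance : MeasurableSpace SkorokhodSpace := borel SkorokhodSpace

instance : BorelSpace SkorokhodSpace := ⟨rfl⟩

/-! ### Quadtrees and partial match queries -/

/-- Point quadtrees: each node stores a point of the plane and has four subtrees, for the four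
quadrants (south-west, north-west, south-east, north-east) that the point determines. -/
inductive QuadTree where
  | nil : QuadTree
  | node (p : ℝ × ℝ) (sw nw se ne : QuadTree) : QuadTree

/-- Insertion of the point `q`. -/
def QuadTree.insert (q : ℝ × ℝ) : QuadTree → QuadTree
  | .nil => .node q .nil .nil .nil .nil
  | .node p sw nw se ne =>
    if q.1 < p.1 then
      if q.2 < p.2 then .node p (sw.insert q) nw se ne else .node p sw (nw.insert q) se ne
    else
      if q.2 < p.2 then .node p sw nw (se.insert q) ne else .node p sw nw se (ne.insert q)

/-- The quadtree obtained by inserting the first `n` points `p 0, …, p (n-1)` in this order. -/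
def quadtree (p : ℕ → ℝ × ℝ) : ℕ → QuadTree
  | 0 => .nil
  | n + 1 => (quadtree p n).insert (p n)

/-- The cost of a partial match query at `s`: the number of nodes visited in order to report the
points with first coordinate `s`. -/
def QuadTree.cost (s : ℝ) : QuadTree → ℕ
  | .nil => 0
  | .node p sw nw se ne =>
    1 + if s < p.1 then sw.cost s + nw.cost s else se.cost s + ne.cost s

theorem QuadTree.isCadlag_cost (T : QuadTree) :
    IsCadlag (fun s : unitInterval => (T.cost s : ℝ)) := by
  induction T with
  | nil => simpa [QuadTree.cost] using IsCadlag.const 0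
  | node p sw nw se ne h1 h2 h3 h4 =>
    have h := (IsCadlag.const 1).add ((h1.add h2).ite (h3.add h4) p.1)
    simpa only [QuadTree.cost, Nat.cast_add, Nat.cast_ite, Nat.cast_one] using h

/-- The exponent `β = (√17 - 3) / 2`. -/
def β : ℝ := (√17 - 3) / 2

/-- The constant `K₁ = Γ(2β+2) Γ(β+2) / (2 Γ(β+1)³ Γ(β/2+1)²)`. -/
def K₁ : ℝ :=
  Real.Gamma (2 * β + 2) * Real.Gamma (β + 2) /
    (2 * Real.Gamma (β + 1) ^ 3 * Real.Gamma (β / 2 + 1) ^ 2)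

/-- The function `h(s) = (s(1-s))^(β/2)`. -/
def h (s : ℝ) : ℝ := (s * (1 - s)) ^ (β / 2)

/-- The rescaled cost process `s ↦ Cₙ(s) / (K₁ n^β)`, as an element of `D[0,1]`. -/
def rescaledCost (p : ℕ → ℝ × ℝ) (n : ℕ) : SkorokhodSpace where
  toFun s := ((quadtree p n).cost s : ℝ) / (K₁ * (n : ℝ) ^ β)
  isCadlag := (QuadTree.isCadlag_cost _).div_const _

/-! ### The one-dimensional fixed-point equation -/

/-- The law of `U^(β/2) V^β Ψ + U^(β/2) (1-V)^β Ψ'` where `U`, `V` are uniform on `[0,1]`, `Ψ` and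
`Ψ'` have law `ψ`, and `U`, `V`, `Ψ`, `Ψ'` are independent. -/
def fixedPointMap (ψ : Measure ℝ) : Measure ℝ :=
  (((volume.restrict (Icc (0 : ℝ) 1)).prod (volume.restrict (Icc (0 : ℝ) 1))).prod
    (ψ.prod ψ)).map
      (fun x : (ℝ × ℝ) × (ℝ × ℝ) =>
        x.1.1 ^ (β / 2) * x.1.2 ^ β * x.2.1 + x.1.1 ^ (β / 2) * (1 - x.1.2) ^ β * x.2.2)

/-- `ψ` is a probability law with mean `1` and finite second moment that solves the fixed-point
equation `Ψ =ᵈ U^(β/2) V^β Ψ + U^(β/2) (1-V)^β Ψ'`. -/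
structure IsSolution (ψ : Measure ℝ) : Prop where
  isProbabilityMeasure : IsProbabilityMeasure ψ
  fixed : fixedPointMap ψ = ψ
  memLp_two : MemLp (fun x : ℝ => x) 2 ψ
  mean_eq_one : ∫ x, x ∂ψ = 1

end

end PartialMatch

/-!
The proof goes through Laplace transforms of one-dimensional marginals; no process-valued fixed-point
equation is needed.

**The law of `Ψ`.** On laws with mean `1` and finite variance, the distance
`sup |φ₁(t) - φ₂(t)| / t²` between characteristic functions is contracted by the fixed-point map, with
factor `E[U^β V^(2β)] + E[U^β (1-V)^(2β)] = 2 / ((β+1)(2β+1)) < 1`. This gives uniqueness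
(`IsSolution.unique`), and existence of a nonnegative solution (`exists_isSolution`) as the limit of
the iterates from the Dirac mass at `1`.

**The functional equation of the limit.** Given the first point `(x, y)`, the query at `s` visits the
two subtrees on the side of the vertical line through `x` on which `s` lies. Given their sizes these
are independent quadtrees of uniform points, both queried at the relative position `s'` of `s` in that
side (`listExp_sum_parts`), and the sizes concentrate at `n w y` and `n w (1-y)`, where `w` is the
width of the side. Hence, if the Laplace transforms of `Cₙ(s) / (K₁ n^β)` converge to `A s t`, then
(`LapConverges.limLap_fixed`)
`A s t = ∫ A s' ((w y)^β t) · A s' ((w (1-y))^β t) dx dy`.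

**The mean of the limit.** For a query that is itself uniform, the mean cost satisfies the scalar
recursion of a hypergeometric equation; it equals `homSol n - 1`, and Gauss's summation theorem yields
its exact asymptotics `meanConst · n^β` (`tendsto_homSol`), where `meanConst / K₁ = ∫ h`
(`meanConst_div_K₁`). The second moment, averaged over the query, is of order `n^(2β)`
(`exists_lintegral_sqCost_le`); the point is to bound the average of the square of the mean cost, and
this is done relative to `n^β h(s)`, the profile that is invariant under the mean recursion. So no mass
is lost in the limit. The mean `m` of the limit has `∫ m = ∫ h`, and by the functional equation
it is invariant under the operator `meanOp`, whose invariant functions are the multiples of `h`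
(`ae_eq_h_of_harmonic`): the minimum of two invariant functions is invariant because `meanOp` preserves
integrals, and a nonzero invariant function is positive almost everywhere. Hence `m = h`.

**Identification.** The Laplace transforms of `h(s) Ψ` satisfy the same functional equation with the
same mean (`IsSolution.isLaplaceSolution`): if `x` is uniform, `w^β h(s')` has the law of
`h(s) U^(β/2)`. Two families with a common mean differ by `O(t²)` on average over `s`, and on such
differences the functional equation is a contraction (`IsLaplaceSolution.ae_eq`). So both families
agree for almost every `s`, and for every `s` by continuity of the paths of `Z` and of `h`.

**Marginals.** Evaluation at `s` is continuous, for the Skorokhod topology, at continuous functions.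
Convergence of the marginals follows by approximating it from below by functions that are Lipschitz
for the Skorokhod topology (`tendsto_integral_eval`). Finally a law on the half-line is
determined by its Laplace transform (`ext_of_lapLaw`).
-/

namespace PartialMatch

/-! ### The exponent `β` -/

theorem β_sq : β ^ 2 = 2 - 3 * β := by
  have h17 : (√17 : ℝ) ^ 2 = 17 := Real.sq_sqrt (by norm_num)
  unfold β
  nlinarith

theorem half_lt_β : 1 / 2 < β := by
  have : (4 : ℝ) < √17 := Real.lt_sqrt_of_sq_lt (by norm_num)
  unfold β
  linarith

theorem β_lt : β < 3 / 5 := by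
  have : √17 < (21 / 5 : ℝ) := (Real.sqrt_lt' (by norm_num)).2 (by norm_num)
  unfold β
  linarith

theorem β_pos : 0 < β := by linarith [half_lt_β]

/-- The equation of `β`: the mean recursion for a uniform query leaves the growth `n ^ β` invariant. -/
theorem β_add_one_mul : (β + 1) * (β + 2) = 4 := by linear_combination β_sq

/-! ### Rising factorials -/

/-- The ratio `(a+1)(a+2)⋯(a+n) / n!`, a version of `n ^ a / Γ(a+1)` for which sums are explicit. -/
noncomputable def risingRatio (a : ℝ) (n : ℕ) : ℝ :=
  ∏ j ∈ Finset.range n, ((j + 1 + a) / (j + 1))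

@[simp] theorem risingRatio_zero (a : ℝ) : risingRatio a 0 = 1 := by simp [risingRatio]

theorem risingRatio_succ (a : ℝ) (n : ℕ) :
    risingRatio a (n + 1) = risingRatio a n * ((n + 1 + a) / (n + 1)) := by
  rw [risingRatio, Finset.prod_range_succ, risingRatio]

theorem risingRatio_pos {a : ℝ} (ha : 0 < a) (n : ℕ) : 0 < risingRatio a n :=
  Finset.prod_pos fun j _ => by positivity

theorem risingRatio_mono {a : ℝ} (ha : 0 < a) : Monotone (risingRatio a) := by
  refine monotone_nat_of_le_succ fun n => ?_
  rw [risingRatio_succ]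
  refine le_mul_of_one_le_right (risingRatio_pos ha n).le ?_
  rw [one_le_div (by positivity)]
  linarith

theorem risingRatio_eq_Gamma {a : ℝ} (ha : 0 < a) (n : ℕ) :
    Real.Gamma (n + 1 + a) = Real.Gamma (1 + a) * n.factorial * risingRatio a n := by
  induction n with
  | zero => simp
  | succ n ih =>
    have : ((n + 1 : ℕ) : ℝ) + 1 + a = (n + 1 + a) + 1 := by push_cast; ring
    rw [this, Real.Gamma_add_one (by positivity), ih, risingRatio_succ, Nat.factorial_succ]
    push_cast
    field_simp

theorem tendsto_risingRatio_div_rpow {a : ℝ} (ha : 0 < a) :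
    Tendsto (fun n : ℕ => risingRatio a n / (n : ℝ) ^ a) atTop (𝓝 (Real.Gamma (a + 1))⁻¹) := by
  have h1 := ((Real.GammaSeq_tendsto_Gamma a).const_mul a).inv₀
    (mul_ne_zero ha.ne' (Real.Gamma_pos_of_pos ha).ne')
  rw [← Real.Gamma_add_one ha.ne'] at h1
  refine h1.congr' ?_
  filter_upwards [eventually_gt_atTop 0] with n hn
  have hn' : (0 : ℝ) < n := by exact_mod_cast hn
  have key : ∀ n : ℕ, ∏ j ∈ Finset.range (n + 1), (a + j) = a * n.factorial * risingRatio a n := by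
    intro n
    induction n with
    | zero => simp
    | succ n ih =>
      rw [Finset.prod_range_succ, ih, risingRatio_succ, Nat.factorial_succ]
      push_cast
      field_simp
      ring
  have h2 : (n : ℝ) ^ a ≠ 0 := (Real.rpow_pos_of_pos hn' a).ne'
  have h3 : (n.factorial : ℝ) ≠ 0 := by positivity
  have h4 := (risingRatio_pos ha n).ne'
  rw [Real.GammaSeq, key]
  field_simp

theorem exists_risingRatio_le {a : ℝ} (ha : 0 < a) :
    ∃ C > 0, ∀ n : ℕ, 0 < n → risingRatio a n ≤ C * (n : ℝ) ^ a := by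
  obtain ⟨C, hC⟩ := (tendsto_risingRatio_div_rpow ha).bddAbove_range
  refine ⟨max C 1, by positivity, fun n hn => ?_⟩
  have hn' : (0 : ℝ) < n := by exact_mod_cast hn
  have := (hC ⟨n, rfl⟩).trans (le_max_left C 1)
  rwa [div_le_iff₀ (Real.rpow_pos_of_pos hn' a)] at this

theorem exists_rpow_le_risingRatio {a : ℝ} (ha : 0 < a) :
    ∃ C > 0, ∀ n : ℕ, (n : ℝ) ^ a ≤ C * risingRatio a n := by
  have h1 := (tendsto_risingRatio_div_rpow ha).inv₀
    (inv_ne_zero (Real.Gamma_pos_of_pos (by linarith)).ne')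
  obtain ⟨C, hC⟩ := h1.bddAbove_range
  refine ⟨max C 1, by positivity, fun n => ?_⟩
  have := (hC ⟨n, rfl⟩).trans (le_max_left C 1)
  simp only [inv_div] at this
  rwa [div_le_iff₀ (risingRatio_pos ha n)] at this

theorem sum_risingRatio {a : ℝ} (ha : 0 < a) (n : ℕ) :
    ∑ k ∈ Finset.range n, risingRatio a k = n / (a + 1) * risingRatio a n := by
  induction n with
  | zero => simp
  | succ n ih =>
    rw [Finset.sum_range_succ, ih, risingRatio_succ]
    push_cast
    field_simp
    ring

theorem sum_sub_mul_risingRatio {a : ℝ} (ha : 0 < a) (n : ℕ) :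
    ∑ k ∈ Finset.range n, ((n : ℝ) - k) * risingRatio a k =
      n * (n + a + 1) / ((a + 1) * (a + 2)) * risingRatio a n := by
  induction n with
  | zero => simp
  | succ n ih =>
    have : ∀ k ∈ Finset.range (n + 1), (((n + 1 : ℕ) : ℝ) - k) * risingRatio a k =
        ((n : ℝ) - k) * risingRatio a k + risingRatio a k := fun k _ => by push_cast; ring
    rw [Finset.sum_congr rfl this, Finset.sum_add_distrib, sum_risingRatio ha,
      Finset.sum_range_succ, ih, risingRatio_succ]
    push_cast
    field_simp
    ring

/-- In other words `√(n + 1) ≤ risingRatio (1 / 2) n`. -/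
theorem sq_risingRatio_half (n : ℕ) : (n : ℝ) + 1 ≤ risingRatio (1 / 2) n ^ 2 := by
  induction n with
  | zero => simp
  | succ n ih =>
    rw [risingRatio_succ, mul_pow]
    have h0 : (0 : ℝ) < n + 1 := by positivity
    refine le_trans ?_ (mul_le_mul_of_nonneg_right ih (by positivity))
    rw [div_pow, mul_div_assoc', le_div_iff₀ (by positivity)]
    push_cast
    nlinarith

/-! ### Gauss's summation of a hypergeometric series at `1` -/

/-- The terms `(-β)ⱼ (-1-β)ⱼ / ((c)ⱼ j!)` of the hypergeometric series `₂F₁(-β, -1-β; c; 1)`. -/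
noncomputable def hyperTerm (c : ℝ) (j : ℕ) : ℝ :=
  ∏ i ∈ Finset.range j, ((i - β) * (i - 1 - β) / ((c + i) * (i + 1)))

@[simp] theorem hyperTerm_zero (c : ℝ) : hyperTerm c 0 = 1 := by simp [hyperTerm]

theorem hyperTerm_succ (c : ℝ) (j : ℕ) :
    hyperTerm c (j + 1) = hyperTerm c j * ((j - β) * (j - 1 - β) / ((c + j) * (j + 1))) := by
  rw [hyperTerm, Finset.prod_range_succ, hyperTerm]

theorem abs_hyperTerm_le {c : ℝ} (hc : 2 ≤ c) (j : ℕ) :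
    |hyperTerm c (j + 2)| ≤ 1 / ((j + 1) * (j + 2) * (j + 3)) := by
  have hb := half_lt_β
  have hb' := β_lt
  induction j with
  | zero =>
    rw [hyperTerm_succ, hyperTerm_succ, hyperTerm_zero]
    have : (1 : ℝ) * (((0 : ℕ) - β) * ((0 : ℕ) - 1 - β) / ((c + (0 : ℕ)) * ((0 : ℕ) + 1))) *
        (((0 + 1 : ℕ) - β) * ((0 + 1 : ℕ) - 1 - β) / ((c + (0 + 1 : ℕ)) * ((0 + 1 : ℕ) + 1))) =
        - (β ^ 2 * (1 - β ^ 2) / (c * (c + 1) * 2)) := by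
      push_cast
      field_simp
      ring
    rw [this, abs_neg, abs_of_nonneg (div_nonneg (mul_nonneg (sq_nonneg β) (by nlinarith)) (by positivity))]
    rw [div_le_div_iff₀ (by positivity) (by norm_num)]
    push_cast
    nlinarith [sq_nonneg β, sq_nonneg (β ^ 2 - 1 / 2)]
  | succ j ih =>
    have e : j + 1 + 2 = (j + 2) + 1 := by ring
    rw [e, hyperTerm_succ, abs_mul]
    have h1 : |(((j + 2 : ℕ) : ℝ) - β) * ((j + 2 : ℕ) - 1 - β) / ((c + (j + 2 : ℕ)) * ((j + 2 : ℕ) + 1))|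
        ≤ (j + 1) / (j + 4) := by
      push_cast
      have ha : (0 : ℝ) ≤ (j + 2 - β) * (j + 2 - 1 - β) := by
        apply mul_nonneg <;> nlinarith [(Nat.cast_nonneg j : (0 : ℝ) ≤ j)]
      rw [abs_of_nonneg (div_nonneg ha (by positivity)),
        div_le_div_iff₀ (by positivity) (by positivity)]
      have hj : (0 : ℝ) ≤ j := Nat.cast_nonneg j
      have h2 : ((j : ℝ) + 2 - β) * (j + 2 - 1 - β) ≤ (j + 1) * (j + 2 + 1) := by nlinarith
      calc _ ≤ ((j : ℝ) + 1) * (j + 2 + 1) * (j + 4) :=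
            mul_le_mul_of_nonneg_right h2 (by positivity)
        _ = (j + 1) * ((j + 4) * (j + 2 + 1)) := by ring
        _ ≤ _ := by
          refine mul_le_mul_of_nonneg_left ?_ (by positivity)
          refine mul_le_mul_of_nonneg_right ?_ (by positivity)
          linarith
    refine (mul_le_mul ih h1 (abs_nonneg _) (by positivity)).trans (le_of_eq ?_)
    push_cast
    field_simp
    ring

theorem summable_hyperTerm_bound :
    Summable fun j : ℕ => (1 : ℝ) / ((j + 1) * (j + 2) * (j + 3)) := by
  have h2 : Summable fun j : ℕ => (1 : ℝ) / ((j + 1 : ℕ) : ℝ) ^ 2 :=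
    (summable_nat_add_iff 1).2 (Real.summable_one_div_nat_pow.2 (by norm_num))
  refine h2.of_nonneg_of_le (fun j => by positivity) fun j => ?_
  apply one_div_le_one_div_of_le (by positivity)
  push_cast
  have hj : (0 : ℝ) ≤ j := Nat.cast_nonneg j
  nlinarith [mul_nonneg hj hj, mul_nonneg (mul_nonneg hj hj) hj]

theorem summable_hyperTerm {c : ℝ} (hc : 2 ≤ c) : Summable (hyperTerm c) :=
  (summable_nat_add_iff 2).1 (summable_hyperTerm_bound.of_norm_bounded (abs_hyperTerm_le hc))

/-- The contiguous relation between the values at `1` for the parameters `c` and `c + 1`; the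
difference of the two sides telescopes, term by term. -/
theorem tsum_hyperTerm_contiguous {c : ℝ} (hc : 2 ≤ c) :
    c * (c + 2 * β + 1) * ∑' j, hyperTerm c j =
      (c + β) * (c + β + 1) * ∑' j, hyperTerm (c + 1) j := by
  have hb := β_pos
  have hshift : ∀ j, hyperTerm (c + 1) j = hyperTerm c j * (c / (c + j)) := by
    intro j
    induction j with
    | zero => simp [div_self (by linarith : c ≠ 0)]
    | succ j ih =>
      rw [hyperTerm_succ, hyperTerm_succ, ih]
      have h1 : c + j ≠ 0 := by positivity
      have h2 : c + 1 + j ≠ 0 := by positivity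
      push_cast
      field_simp
      ring
  have htel : ∀ j : ℕ, c * (c + 2 * β + 1) * hyperTerm c j -
      (c + β) * (c + β + 1) * hyperTerm (c + 1) j =
      c * j * hyperTerm c j - c * (j + 1 : ℕ) * hyperTerm c (j + 1) := by
    intro j
    rw [hshift, hyperTerm_succ]
    have h1 : c + j ≠ 0 := by positivity
    push_cast
    field_simp
    ring
  have hlim : Tendsto (fun j : ℕ => c * j * hyperTerm c j) atTop (𝓝 0) := by
    rw [← tendsto_add_atTop_iff_nat 2]
    have h0 : Tendsto (fun j : ℕ => c * (1 / ((j : ℝ) + 1))) atTop (𝓝 0) := by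
      simpa using tendsto_one_div_add_atTop_nhds_zero_nat.const_mul c
    refine squeeze_zero_norm (fun j => ?_) h0
    rw [Real.norm_eq_abs, abs_mul, abs_mul, abs_of_pos (by linarith : 0 < c), Nat.abs_cast, mul_assoc]
    refine mul_le_mul_of_nonneg_left ?_ (by linarith)
    refine (mul_le_mul_of_nonneg_left (abs_hyperTerm_le hc j) (by positivity)).trans ?_
    push_cast
    rw [mul_one_div, div_le_div_iff₀ (by positivity) (by positivity)]
    have hj : (0 : ℝ) ≤ j := Nat.cast_nonneg j
    nlinarith [mul_nonneg hj hj, mul_nonneg (mul_nonneg hj hj) hj]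
  have hsum : HasSum (fun j : ℕ => c * (c + 2 * β + 1) * hyperTerm c j -
      (c + β) * (c + β + 1) * hyperTerm (c + 1) j) (c * (c + 2 * β + 1) * ∑' j, hyperTerm c j -
      (c + β) * (c + β + 1) * ∑' j, hyperTerm (c + 1) j) :=
    ((summable_hyperTerm hc).hasSum.mul_left _).sub
      ((summable_hyperTerm (by linarith)).hasSum.mul_left _)
  have h1 := hsum.tendsto_sum_nat
  simp only [htel, Finset.sum_range_sub'] at h1
  have h2 : Tendsto (fun n : ℕ => c * (0 : ℕ) * hyperTerm c 0 - c * n * hyperTerm c n) atTop (𝓝 0) := by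
    simpa using hlim.neg
  linarith [tendsto_nhds_unique h1 h2]

theorem tendsto_tsum_hyperTerm :
    Tendsto (fun n : ℕ => ∑' j, hyperTerm (n + 2) j) atTop (𝓝 1) := by
  have hpt : ∀ j, Tendsto (fun n : ℕ => hyperTerm (n + 2) j) atTop (𝓝 (if j = 0 then 1 else 0)) := by
    intro j
    induction j with
    | zero => simp
    | succ j ih =>
      simp only [hyperTerm_succ]
      have h1 : Tendsto (fun n : ℕ => (((j : ℝ) - β) * (j - 1 - β) / (((n : ℝ) + 2 + j) * (j + 1))))
          atTop (𝓝 0) := by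
        refine tendsto_const_nhds.div_atTop ?_
        refine Tendsto.atTop_mul_const (by positivity) ?_
        exact tendsto_atTop_add_const_right _ _
          (tendsto_atTop_add_const_right _ _ tendsto_natCast_atTop_atTop)
      simpa using ih.mul h1
  have h := tendsto_tsum_of_dominated_convergence
    (bound := fun j => if j < 2 then 1 else 1 / (((j - 2 : ℕ) + 1 : ℝ) * ((j - 2 : ℕ) + 2) * ((j - 2 : ℕ) + 3)))
    (f := fun (n : ℕ) j => hyperTerm (n + 2) j) (𝓕 := atTop) ?_ hpt ?_
  · simpa using h
  · rw [← summable_nat_add_iff 2]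
    simpa using summable_hyperTerm_bound
  · refine Eventually.of_forall fun n j => ?_
    match j with
    | 0 => simp
    | 1 =>
      have hb := half_lt_β
      have hb' := β_lt
      rw [hyperTerm_succ, hyperTerm_zero]
      simp only [Nat.cast_zero, zero_sub, one_mul, add_zero, zero_add, mul_one]
      have hn : (0 : ℝ) ≤ n := Nat.cast_nonneg n
      rw [Real.norm_eq_abs, abs_of_nonneg (div_nonneg (by nlinarith) (by positivity))]
      simp only [Nat.one_lt_ofNat, if_true]
      rw [div_le_one (by positivity)]
      nlinarith
    | j + 2 =>
      have := abs_hyperTerm_le (c := n + 2) (by linarith [(Nat.cast_nonneg n : (0 : ℝ) ≤ n)]) j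
      simpa using this

/-- Gauss's summation theorem for `₂F₁(-β, -1-β; 2; 1)`. -/
theorem tsum_hyperTerm_two :
    ∑' j, hyperTerm 2 j =
      Real.Gamma (2 * β + 3) / (Real.Gamma (β + 2) * Real.Gamma (β + 3)) := by
  have hb := β_pos
  -- By the contiguous relation `R` is constant, and its limit is `1`.
  set R : ℕ → ℝ := fun n => (∑' j, hyperTerm (n + 2) j) *
    (Real.Gamma (n + 1 + (β + 1)) * Real.Gamma (n + 1 + (β + 2)) /
      (Real.Gamma (n + 1 + 1) * Real.Gamma (n + 1 + (2 * β + 2)))) with hR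
  have hstep : ∀ n, R (n + 1) = R n := by
    intro n
    have hn : (0 : ℝ) ≤ n := Nat.cast_nonneg n
    have h1 := tsum_hyperTerm_contiguous (c := n + 2) (by linarith)
    simp only [hR]
    have e1 : (((n + 1 : ℕ) : ℝ) + 1 + (β + 1)) = (n + 1 + (β + 1)) + 1 := by push_cast; ring
    have e2 : (((n + 1 : ℕ) : ℝ) + 1 + (β + 2)) = (n + 1 + (β + 2)) + 1 := by push_cast; ring
    have e3 : (((n + 1 : ℕ) : ℝ) + 1 + 1) = (n + 1 + 1) + 1 := by push_cast; ring
    have e4 : (((n + 1 : ℕ) : ℝ) + 1 + (2 * β + 2)) = (n + 1 + (2 * β + 2)) + 1 := by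
      push_cast; ring
    have e5 : (((n + 1 : ℕ) : ℝ) + 2) = n + 2 + 1 := by push_cast; ring
    rw [e1, e2, e3, e4, e5,
      Real.Gamma_add_one (s := (n : ℝ) + 1 + (β + 1)) (by positivity),
      Real.Gamma_add_one (s := (n : ℝ) + 1 + (β + 2)) (by positivity),
      Real.Gamma_add_one (s := (n : ℝ) + 1 + 1) (by positivity),
      Real.Gamma_add_one (s := (n : ℝ) + 1 + (2 * β + 2)) (by positivity)]
    have g1 := (Real.Gamma_pos_of_pos (by positivity : 0 < (n : ℝ) + 1 + 1)).ne'
    have g2 := (Real.Gamma_pos_of_pos (by positivity : 0 < (n : ℝ) + 1 + (2 * β + 2))).ne'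
    have p1 : (n : ℝ) + 1 + 1 ≠ 0 := by positivity
    have p2 : (n : ℝ) + 1 + (2 * β + 2) ≠ 0 := by positivity
    field_simp
    linear_combination (-1) * h1
  have hconst : ∀ n, R n = R 0 := fun n => by
    induction n with
    | zero => rfl
    | succ n ih => rw [hstep, ih]
  have hlim : Tendsto R atTop (𝓝 1) := by
    have t1 := tendsto_risingRatio_div_rpow (a := β + 1) (by linarith)
    have t2 := tendsto_risingRatio_div_rpow (a := β + 2) (by linarith)
    have t3 := tendsto_risingRatio_div_rpow (a := 1) (by linarith)
    have t4 := tendsto_risingRatio_div_rpow (a := 2 * β + 2) (by linarith)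
    have g : ∀ x : ℝ, 0 < x → Real.Gamma x ≠ 0 := fun x hx => (Real.Gamma_pos_of_pos hx).ne'
    have g1 := g (β + 1 + 1) (by linarith)
    have g2 := g (β + 2 + 1) (by linarith)
    have g3 := g (1 + 1) (by linarith)
    have g4 := g (2 * β + 2 + 1) (by linarith)
    have t := tendsto_tsum_hyperTerm.mul
      (((t1.mul t2).div (t3.mul t4) (mul_ne_zero (inv_ne_zero g3) (inv_ne_zero g4))).mul_const
        (Real.Gamma (β + 1 + 1) * Real.Gamma (β + 2 + 1) /
          (Real.Gamma (1 + 1) * Real.Gamma (2 * β + 2 + 1))))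
    have e : (1 : ℝ) * ((Real.Gamma (β + 1 + 1))⁻¹ * (Real.Gamma (β + 2 + 1))⁻¹ /
        ((Real.Gamma (1 + 1))⁻¹ * (Real.Gamma (2 * β + 2 + 1))⁻¹) *
        (Real.Gamma (β + 1 + 1) * Real.Gamma (β + 2 + 1) /
          (Real.Gamma (1 + 1) * Real.Gamma (2 * β + 2 + 1)))) = 1 := by
      field_simp
    rw [e] at t
    refine t.congr' ?_
    filter_upwards [eventually_gt_atTop 0] with n hn
    have hn' : (0 : ℝ) < n := by exact_mod_cast hn
    simp only [hR, Pi.div_apply]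
    congr 1
    have r := fun (a : ℝ) (ha : 0 < a) => (risingRatio_pos ha n).ne'
    have q := fun a : ℝ => (Real.rpow_pos_of_pos hn' a).ne'
    have hf : (n.factorial : ℝ) ≠ 0 := by positivity
    have hpow : (n : ℝ) ^ (β + 1) * (n : ℝ) ^ (β + 2) = (n : ℝ) ^ (1 : ℝ) * (n : ℝ) ^ (2 * β + 2) := by
      rw [← Real.rpow_add hn', ← Real.rpow_add hn']
      congr 1
      ring
    rw [risingRatio_eq_Gamma (by linarith), risingRatio_eq_Gamma (by linarith),
      risingRatio_eq_Gamma (by linarith), risingRatio_eq_Gamma (by linarith),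
      add_comm 1 (β + 1), add_comm 1 (β + 2), add_comm 1 (2 * β + 2)]
    have r3 := r 1 one_pos
    have r4 := r (2 * β + 2) (by linarith)
    have q1 := q (β + 1)
    have q2 := q (β + 2)
    have q3 := q 1
    have q4 := q (2 * β + 2)
    generalize (n : ℝ) ^ (β + 1) = x1 at *
    generalize (n : ℝ) ^ (β + 2) = x2 at *
    generalize (n : ℝ) ^ (1 : ℝ) = x3 at *
    generalize (n : ℝ) ^ (2 * β + 2) = x4 at *
    have : risingRatio (β + 1) n / x1 * (risingRatio (β + 2) n / x2) /
        (risingRatio 1 n / x3 * (risingRatio (2 * β + 2) n / x4)) =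
        risingRatio (β + 1) n * risingRatio (β + 2) n /
        (risingRatio 1 n * risingRatio (2 * β + 2) n) * ((x3 * x4) / (x1 * x2)) := by
      field_simp
    rw [this, hpow, div_self (mul_ne_zero q3 q4), mul_one]
    field_simp
  have h0 : R 0 = 1 := tendsto_nhds_unique (tendsto_const_nhds.congr fun n => (hconst n).symm) hlim
  simp only [hR] at h0
  have e1 : ((0 : ℕ) : ℝ) + 1 + (β + 1) = β + 2 := by push_cast; ring
  have e2 : ((0 : ℕ) : ℝ) + 1 + (β + 2) = β + 3 := by push_cast; ring
  have e3 : ((0 : ℕ) : ℝ) + 1 + 1 = 2 := by norm_num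
  have e4 : ((0 : ℕ) : ℝ) + 1 + (2 * β + 2) = 2 * β + 3 := by push_cast; ring
  have e5 : ((0 : ℕ) : ℝ) + 2 = 2 := by norm_num
  rw [e1, e2, e3, e4, e5, Real.Gamma_two, one_mul] at h0
  have g1 := (Real.Gamma_pos_of_pos (by linarith : 0 < β + 2)).ne'
  have g2 := (Real.Gamma_pos_of_pos (by linarith : 0 < β + 3)).ne'
  have g3 := (Real.Gamma_pos_of_pos (by linarith : 0 < 2 * β + 3)).ne'
  field_simp at h0 ⊢
  linarith

/-! ### The scalar recursion of the mean cost -/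

/-- The solution `D` of `D 0 = 1`, `D n = 4 / (n (n+1)) ∑_{k<n} (n-k) D k`, given explicitly: its
generating function is `(1-z)^(-β-1) ₂F₁(-β, -1-β; 2; z)`. -/
noncomputable def homSol (n : ℕ) : ℝ :=
  ∑ ij ∈ Finset.HasAntidiagonal.antidiagonal n, risingRatio β ij.1 * hyperTerm 2 ij.2

theorem homSol_zero : homSol 0 = 1 := by simp [homSol]

section PowerSeries

open PowerSeries

/-- The function `w = z (1-z)^(-β-1) ₂F₁(-β, -1-β; 2; z)` solves `(1-z)² w'' = 4 w / z`. -/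
theorem homSol_ode :
    (1 - X) ^ 2 * d⁄dX ℝ (d⁄dX ℝ (X * mk homSol)) = 4 * mk homSol := by
  set R : PowerSeries ℝ := mk (risingRatio β) with hR
  set F : PowerSeries ℝ := mk (hyperTerm 2) with hF
  have hy : mk homSol = R * F := by
    ext n
    simp [hR, hF, coeff_mul, homSol]
  have hR' : (1 - X) * d⁄dX ℝ R = C (β + 1) * R := by
    ext n
    rw [sub_mul, one_mul, map_sub, coeff_C_mul]
    cases n with
    | zero => simp [hR, coeff_derivative, risingRatio_succ, add_comm]
    | succ n =>
      rw [coeff_succ_X_mul]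
      simp only [hR, coeff_derivative, coeff_mk, risingRatio_succ β (n + 1)]
      push_cast
      field_simp
      ring
  have hF' : X * (1 - X) * d⁄dX ℝ (d⁄dX ℝ F) + (2 + C (2 * β) * X) * d⁄dX ℝ F =
      C (β * (1 + β)) * F := by
    have e : X * (1 - X) * d⁄dX ℝ (d⁄dX ℝ F) + (2 + C (2 * β) * X) * d⁄dX ℝ F =
        X * d⁄dX ℝ (d⁄dX ℝ F) - X * (X * d⁄dX ℝ (d⁄dX ℝ F)) + C 2 * d⁄dX ℝ F +
          C (2 * β) * (X * d⁄dX ℝ F) := by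
      rw [show (C (2 : ℝ) : PowerSeries ℝ) = 2 from map_ofNat C 2]
      ring
    rw [e]
    ext n
    match n with
    | 0 =>
      simp only [map_add, map_sub, coeff_C_mul, coeff_zero_X_mul]
      simp only [hF, coeff_derivative, coeff_mk, hyperTerm_succ, hyperTerm_zero]
      push_cast
      ring
    | 1 =>
      simp only [map_add, map_sub, coeff_C_mul, coeff_succ_X_mul, coeff_zero_X_mul]
      simp only [hF, coeff_derivative, coeff_mk, hyperTerm_succ, hyperTerm_zero]
      push_cast
      field_simp
      ring
    | n + 2 =>
      simp only [map_add, map_sub, coeff_C_mul, coeff_succ_X_mul]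
      simp only [hF, coeff_derivative, coeff_mk, hyperTerm_succ 2 (n + 2)]
      push_cast
      field_simp
      ring
  have hR'' : (1 - X) * d⁄dX ℝ (d⁄dX ℝ R) = C (β + 2) * d⁄dX ℝ R := by
    have := congrArg (d⁄dX ℝ) hR'
    simp only [Derivation.leibniz, map_sub, Derivation.map_one_eq_zero, derivative_X, smul_eq_mul,
      derivative_C, mul_zero, add_zero] at this
    have e : (C (β + 2) : PowerSeries ℝ) = C (β + 1) + 1 := by
      rw [← map_one (C (R := ℝ)), ← map_add]
      congr 1
      ring
    rw [e]
    linear_combination this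
  have c1 : (C (β + 1) * C (β + 2) : PowerSeries ℝ) = 4 := by
    rw [← map_mul, β_add_one_mul]
    exact map_ofNat C 4
  have c2 : (C (β + 1) : PowerSeries ℝ) = C β + 1 := by simp
  have c3 : (C (β + 2) : PowerSeries ℝ) = C β + 2 := by
    rw [map_add, map_ofNat C 2]
  have c4 : (C (2 * β) : PowerSeries ℝ) = 2 * C β := by
    rw [map_mul, map_ofNat C 2]
  have c5 : (C (β * (1 + β)) : PowerSeries ℝ) = C β * (1 + C β) := by simp
  rw [hy]
  simp only [Derivation.leibniz, map_add, derivative_X, smul_eq_mul, mul_one]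
  rw [c2, c3] at c1
  rw [c2] at hR'
  rw [c3] at hR''
  rw [c4, c5] at hF'
  generalize d⁄dX ℝ (d⁄dX ℝ R) = R2 at *
  generalize d⁄dX ℝ (d⁄dX ℝ F) = F2 at *
  generalize d⁄dX ℝ R = R1 at *
  generalize d⁄dX ℝ F = F1 at *
  generalize (C β : PowerSeries ℝ) = b at *
  generalize (X : PowerSeries ℝ) = x at *
  linear_combination (2 * (1 - x) * F + 2 * x * (1 - x) * F1 + x * (b + 2) * F) * hR' +
    x * (1 - x) * F * hR'' + (1 - x) * R * hF' + R * F * c1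

end PowerSeries

theorem homSol_recurrence (n : ℕ) :
    ((n : ℝ) + 2) * (n + 3) * homSol (n + 2) - 2 * ((n + 1) * (n + 2) * homSol (n + 1)) +
      n * (n + 1) * homSol n = 4 * homSol (n + 1) := by
  have hode := homSol_ode
  have e : (1 - PowerSeries.X) ^ 2 *
      PowerSeries.derivative ℝ (PowerSeries.derivative ℝ (PowerSeries.X * PowerSeries.mk homSol)) =
      PowerSeries.derivative ℝ (PowerSeries.derivative ℝ (PowerSeries.X * PowerSeries.mk homSol)) -
      PowerSeries.C 2 * (PowerSeries.X * PowerSeries.derivative ℝ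
        (PowerSeries.derivative ℝ (PowerSeries.X * PowerSeries.mk homSol))) +
      PowerSeries.X * (PowerSeries.X * PowerSeries.derivative ℝ
        (PowerSeries.derivative ℝ (PowerSeries.X * PowerSeries.mk homSol))) := by
    rw [show (PowerSeries.C (2 : ℝ) : PowerSeries ℝ) = 2 from map_ofNat PowerSeries.C 2]
    ring
  have e4 : (4 : PowerSeries ℝ) * PowerSeries.mk homSol = PowerSeries.C 4 * PowerSeries.mk homSol := by
    rw [show (PowerSeries.C (4 : ℝ) : PowerSeries ℝ) = 4 from map_ofNat PowerSeries.C 4]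
  rw [e, e4] at hode
  have := congrArg (PowerSeries.coeff (n + 1)) hode
  cases n with
  | zero =>
    simp only [map_add, map_sub, PowerSeries.coeff_C_mul, PowerSeries.coeff_succ_X_mul,
      PowerSeries.coeff_zero_X_mul, PowerSeries.coeff_derivative, PowerSeries.coeff_mk] at this
    push_cast at this ⊢
    linear_combination this
  | succ n =>
    simp only [map_add, map_sub, PowerSeries.coeff_C_mul, PowerSeries.coeff_succ_X_mul,
      PowerSeries.coeff_derivative, PowerSeries.coeff_mk] at this
    push_cast at this ⊢
    linear_combination this

theorem homSol_one : homSol 1 = 2 := by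
  simp [homSol, Finset.Nat.antidiagonal_succ, risingRatio_succ, hyperTerm_succ]
  linarith [β_sq]

theorem sum_homSol (n : ℕ) :
    4 * ∑ k ∈ Finset.range (n + 1), ((n : ℝ) + 1 - k) * homSol k =
      (n + 1) * (n + 2) * homSol (n + 1) := by
  -- The recurrence is of second order, so the induction carries the first difference along.
  have key : ∀ n : ℕ, 4 * ∑ k ∈ Finset.range (n + 1), ((n : ℝ) + 1 - k) * homSol k =
      (n + 1) * (n + 2) * homSol (n + 1) ∧
      4 * ∑ k ∈ Finset.range (n + 1), homSol k =
        (n + 1) * (n + 2) * homSol (n + 1) - n * (n + 1) * homSol n := by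
    intro n
    induction n with
    | zero => constructor <;> simp [homSol_zero, homSol_one] <;> norm_num
    | succ n ih =>
      have hrec := homSol_recurrence n
      have h2 : 4 * ∑ k ∈ Finset.range (n + 1 + 1), homSol k =
          ((n + 1 : ℕ) + 1) * ((n + 1 : ℕ) + 2) * homSol (n + 1 + 1) -
            (n + 1 : ℕ) * ((n + 1 : ℕ) + 1) * homSol (n + 1) := by
        rw [Finset.sum_range_succ]
        push_cast
        linear_combination ih.2 - hrec
      refine ⟨?_, h2⟩
      have : ∀ k ∈ Finset.range (n + 1 + 1), (((n + 1 : ℕ) : ℝ) + 1 - k) * homSol k =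
          ((n : ℝ) + 1 - k) * homSol k + homSol k := fun k _ => by push_cast; ring
      rw [Finset.sum_congr rfl this, Finset.sum_add_distrib, mul_add, h2, Finset.sum_range_succ,
        mul_add, ih.1]
      push_cast
      ring
  exact (key n).1

theorem homSol_succ (n : ℕ) :
    homSol (n + 1) = 4 / ((n + 1) * (n + 2)) *
      ∑ k ∈ Finset.range (n + 1), ((n : ℝ) + 1 - k) * homSol k := by
  have := sum_homSol n
  field_simp
  linarith

theorem homSol_pos (n : ℕ) : 0 < homSol n := by
  induction n using Nat.strong_induction_on with
  | _ n ih =>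
    cases n with
    | zero => simp [homSol_zero]
    | succ n =>
      rw [homSol_succ]
      refine mul_pos (by positivity) (Finset.sum_pos (fun k hk => ?_) (by simp))
      have hk' : k < n + 1 := Finset.mem_range.1 hk
      have : (k : ℝ) < n + 1 := by exact_mod_cast hk'
      exact mul_pos (by linarith) (ih k hk')

/-- The constant `κ` in the asymptotics `κ n ^ β` of the mean cost of a query at a uniform point. -/
noncomputable def meanConst : ℝ := Real.Gamma (2 * β + 2) / (2 * Real.Gamma (β + 1) ^ 3)

/-- The factor `₂F₁` of the generating function is continuous at the singularity `z = 1`, where the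
other factor is `(1 - z) ^ (-β - 1)`. -/
theorem tendsto_homSol : Tendsto (fun n : ℕ => homSol n / (n : ℝ) ^ β) atTop (𝓝 meanConst) := by
  have hb := β_pos
  have h1 : ∀ n, homSol n / risingRatio β n =
      ∑' j, if j ≤ n then risingRatio β (n - j) / risingRatio β n * hyperTerm 2 j else 0 := by
    intro n
    rw [tsum_eq_sum (s := Finset.range (n + 1))
      (fun j hj => if_neg (by simpa [Nat.lt_succ_iff] using hj)), homSol,
      Finset.Nat.sum_antidiagonal_eq_sum_range_succ_mk, ← Finset.sum_range_reflect, Finset.sum_div]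
    refine Finset.sum_congr rfl fun j hj => ?_
    have hj' : j ≤ n := Nat.lt_succ_iff.1 (Finset.mem_range.1 hj)
    simp only [hj', if_true]
    have e1 : n + 1 - 1 - j = n - j := by omega
    have e2 : n - (n - j) = j := by omega
    rw [e1, e2]
    ring
  have hratio : ∀ j : ℕ, Tendsto (fun n : ℕ => risingRatio β (n - j) / risingRatio β n) atTop (𝓝 1) := by
    intro j
    rw [← tendsto_add_atTop_iff_nat j]
    simp only [Nat.add_sub_cancel]
    induction j with
    | zero => simp [div_self (risingRatio_pos hb _).ne']
    | succ j ih =>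
      have h2 : Tendsto (fun n : ℕ => (((n + j : ℕ) : ℝ) + 1) / ((n + j : ℕ) + 1 + β)) atTop (𝓝 1) := by
        have h3 : Tendsto (fun n : ℕ => 1 - β / (((n + j : ℕ) : ℝ) + 1 + β)) atTop (𝓝 (1 - 0)) := by
          refine tendsto_const_nhds.sub (tendsto_const_nhds.div_atTop ?_)
          refine tendsto_atTop_add_const_right _ _ (tendsto_atTop_add_const_right _ _ ?_)
          exact tendsto_natCast_atTop_atTop.comp (tendsto_add_atTop_nat j)
        rw [sub_zero] at h3
        refine h3.congr fun n => ?_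
        have : ((n + j : ℕ) : ℝ) + 1 + β ≠ 0 := by positivity
        field_simp
        ring
      have h4 := ih.mul h2
      rw [one_mul] at h4
      refine h4.congr fun n => ?_
      rw [← add_assoc, risingRatio_succ, div_mul_div_comm, mul_div_assoc', div_div_eq_mul_div]
  have hlim : Tendsto (fun n => homSol n / risingRatio β n) atTop (𝓝 (∑' j, hyperTerm 2 j)) := by
    simp only [h1]
    refine tendsto_tsum_of_dominated_convergence (bound := fun j => |hyperTerm 2 j|)
      (summable_hyperTerm le_rfl).abs (fun j => ?_) (Eventually.of_forall fun n j => ?_)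
    · have := (hratio j).mul_const (hyperTerm 2 j)
      rw [one_mul] at this
      refine this.congr' ?_
      filter_upwards [eventually_ge_atTop j] with n hn
      simp [hn]
    · split_ifs with hj
      · rw [norm_mul, Real.norm_eq_abs, Real.norm_eq_abs]
        refine mul_le_of_le_one_left (abs_nonneg _) ?_
        rw [abs_of_pos (div_pos (risingRatio_pos hb _) (risingRatio_pos hb _)),
          div_le_one (risingRatio_pos hb _)]
        exact risingRatio_mono hb (Nat.sub_le n j)
      · simp
  have h := hlim.mul (tendsto_risingRatio_div_rpow hb)
  have hval : (∑' j, hyperTerm 2 j) * (Real.Gamma (β + 1))⁻¹ = meanConst := by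
    rw [tsum_hyperTerm_two, meanConst]
    have e1 : Real.Gamma (2 * β + 3) = (2 * β + 2) * Real.Gamma (2 * β + 2) := by
      rw [← Real.Gamma_add_one (by linarith)]; congr 1; ring
    have e2 : Real.Gamma (β + 2) = (β + 1) * Real.Gamma (β + 1) := by
      rw [← Real.Gamma_add_one (by linarith)]; congr 1; ring
    have e3 : Real.Gamma (β + 3) = (β + 2) * Real.Gamma (β + 2) := by
      rw [← Real.Gamma_add_one (by linarith)]; congr 1; ring
    rw [e3, e1, e2]
    have g := (Real.Gamma_pos_of_pos (by linarith : 0 < β + 1)).ne'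
    have g1 : β + 1 ≠ 0 := by linarith
    have g2 : β + 2 ≠ 0 := by linarith
    field_simp
    linear_combination (-1 : ℝ) * β_add_one_mul
  rw [hval] at h
  refine h.congr fun n => ?_
  have := (risingRatio_pos hb n).ne'
  field_simp

theorem exists_homSol_le : ∃ C > 0, ∀ n : ℕ, 0 < n → homSol n ≤ C * (n : ℝ) ^ β := by
  obtain ⟨C, hC⟩ := tendsto_homSol.bddAbove_range
  refine ⟨max C 1, by positivity, fun n hn => ?_⟩
  have hn' : (0 : ℝ) < n := by exact_mod_cast hn
  have := (hC ⟨n, rfl⟩).trans (le_max_left C 1)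
  rwa [div_le_iff₀ (Real.rpow_pos_of_pos hn' β)] at this

theorem K₁_pos : 0 < K₁ := by
  have hb := β_pos
  have g := fun (x : ℝ) (hx : 0 < x) => Real.Gamma_pos_of_pos hx
  have g1 := g (2 * β + 2) (by linarith)
  have g2 := g (β + 2) (by linarith)
  have g3 := g (β + 1) (by linarith)
  have g4 := g (β / 2 + 1) (by linarith)
  unfold K₁
  positivity

theorem meanConst_div_K₁ : meanConst / K₁ = ProbabilityTheory.beta (β / 2 + 1) (β / 2 + 1) := by
  have hb := β_pos
  have g := fun (x : ℝ) (hx : 0 < x) => (Real.Gamma_pos_of_pos hx).ne'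
  have g1 := g (2 * β + 2) (by linarith)
  have g2 := g (β + 2) (by linarith)
  have g3 := g (β + 1) (by linarith)
  have g4 := g (β / 2 + 1) (by linarith)
  rw [meanConst, K₁, ProbabilityTheory.beta, show β / 2 + 1 + (β / 2 + 1) = β + 2 by ring]
  field_simp

/-! ### The one-dimensional fixed-point equation -/

/-- The uniform law on `[0,1]`. -/
noncomputable abbrev unif : Measure ℝ := volume.restrict (Icc (0 : ℝ) 1)

instance : IsProbabilityMeasure unif := ⟨by simp⟩

theorem ae_unif_mem : ∀ᵐ u ∂unif, u ∈ Icc (0 : ℝ) 1 := ae_restrict_mem measurableSet_Icc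

theorem integral_unif (f : ℝ → ℝ) : ∫ u, f u ∂unif = ∫ u in (0 : ℝ)..1, f u := by
  rw [integral_Icc_eq_integral_Ioc, intervalIntegral.integral_of_le zero_le_one]

theorem integral_unif_rpow {a : ℝ} (ha : 0 ≤ a) : ∫ u, u ^ a ∂unif = 1 / (a + 1) := by
  rw [integral_unif, integral_rpow (Or.inl (by linarith)), Real.one_rpow,
    Real.zero_rpow (by linarith), sub_zero]

theorem integral_unif_one_sub_rpow {a : ℝ} (ha : 0 ≤ a) :
    ∫ u, (1 - u) ^ a ∂unif = 1 / (a + 1) := by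
  rw [integral_unif, intervalIntegral.integral_comp_sub_left (fun x : ℝ => x ^ a), sub_self, sub_zero,
    integral_rpow (Or.inl (by linarith)), Real.one_rpow, Real.zero_rpow (by linarith), sub_zero]

theorem integrable_unif_of_continuousOn {f : ℝ → ℝ} (hf : ContinuousOn f (Icc 0 1)) :
    Integrable f unif := hf.integrableOn_compact isCompact_Icc

theorem integrable_unif_rpow {a : ℝ} (ha : 0 ≤ a) : Integrable (fun u : ℝ => u ^ a) unif :=
  integrable_unif_of_continuousOn fun _ _ => (Real.continuousAt_rpow_const _ _ (Or.inr ha)).continuousWithinAt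

theorem integrable_unif_one_sub_rpow {a : ℝ} (ha : 0 ≤ a) :
    Integrable (fun u : ℝ => (1 - u) ^ a) unif :=
  integrable_unif_of_continuousOn
    ((Real.continuous_rpow_const ha).comp (continuous_const.sub continuous_id)).continuousOn

/-- The first coefficient `U^(β/2) V^β` of the fixed-point equation. -/
noncomputable def coefL (x : ℝ × ℝ) : ℝ := x.1 ^ (β / 2) * x.2 ^ β

/-- The second coefficient `U^(β/2) (1-V)^β` of the fixed-point equation. -/
noncomputable def coefR (x : ℝ × ℝ) : ℝ := x.1 ^ (β / 2) * (1 - x.2) ^ β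

@[fun_prop] theorem measurable_coefL : Measurable coefL := by unfold coefL; fun_prop
@[fun_prop] theorem measurable_coefR : Measurable coefR := by unfold coefR; fun_prop

theorem ae_unif_prod_mem : ∀ᵐ x ∂(unif.prod unif), x.1 ∈ Icc (0 : ℝ) 1 ∧ x.2 ∈ Icc (0 : ℝ) 1 := by
  have h1 : ∀ᵐ x ∂(unif.prod unif), x.1 ∈ Icc (0 : ℝ) 1 :=
    Measure.quasiMeasurePreserving_fst.ae ae_unif_mem
  have h2 : ∀ᵐ x ∂(unif.prod unif), x.2 ∈ Icc (0 : ℝ) 1 :=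
    Measure.quasiMeasurePreserving_snd.ae ae_unif_mem
  filter_upwards [h1, h2] with x a b using ⟨a, b⟩

theorem ae_coef_mem : ∀ᵐ x ∂(unif.prod unif), coefL x ∈ Icc (0 : ℝ) 1 ∧ coefR x ∈ Icc (0 : ℝ) 1 := by
  have hb := β_pos
  filter_upwards [ae_unif_prod_mem] with x hx
  have h1 := Real.rpow_nonneg hx.1.1 (β / 2)
  have h2 := Real.rpow_le_one hx.1.1 hx.1.2 (by linarith : 0 ≤ β / 2)
  have h3 := Real.rpow_nonneg hx.2.1 β
  have h4 := Real.rpow_le_one hx.2.1 hx.2.2 hb.le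
  have h5 := Real.rpow_nonneg (sub_nonneg.2 hx.2.2) β
  have h6 := Real.rpow_le_one (sub_nonneg.2 hx.2.2) (by linarith [hx.2.1]) hb.le
  exact ⟨⟨mul_nonneg h1 h3, mul_le_one₀ h2 h3 h4⟩, ⟨mul_nonneg h1 h5, mul_le_one₀ h2 h5 h6⟩⟩

theorem integrable_coefL : Integrable coefL (unif.prod unif) :=
  (integrable_unif_rpow (by linarith [β_pos])).mul_prod (integrable_unif_rpow β_pos.le)

theorem integrable_coefR : Integrable coefR (unif.prod unif) :=
  (integrable_unif_rpow (by linarith [β_pos])).mul_prod (integrable_unif_one_sub_rpow β_pos.le)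

theorem integral_coefL_add_coefR :
    ∫ x, coefL x ∂(unif.prod unif) + ∫ x, coefR x ∂(unif.prod unif) = 1 := by
  have hb := β_pos
  unfold coefL coefR
  rw [integral_prod_mul (fun u : ℝ => u ^ (β / 2)) (fun v : ℝ => v ^ β),
    integral_prod_mul (fun u : ℝ => u ^ (β / 2)) (fun v : ℝ => (1 - v) ^ β),
    integral_unif_rpow (by linarith), integral_unif_rpow hb.le, integral_unif_one_sub_rpow hb.le]
  field_simp
  linear_combination (-1 : ℝ) * β_add_one_mul

theorem sq_coefL_ae : (fun x => coefL x ^ 2) =ᵐ[unif.prod unif] fun x => x.1 ^ β * x.2 ^ (2 * β) := by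
  filter_upwards [ae_unif_prod_mem] with x hx
  rw [coefL, mul_pow, ← Real.rpow_mul_natCast hx.1.1, ← Real.rpow_mul_natCast hx.2.1]
  congr 2 <;> push_cast <;> ring

theorem sq_coefR_ae :
    (fun x => coefR x ^ 2) =ᵐ[unif.prod unif] fun x => x.1 ^ β * (1 - x.2) ^ (2 * β) := by
  filter_upwards [ae_unif_prod_mem] with x hx
  rw [coefR, mul_pow, ← Real.rpow_mul_natCast hx.1.1, ← Real.rpow_mul_natCast (sub_nonneg.2 hx.2.2)]
  congr 2 <;> push_cast <;> ring

theorem integrable_sq_coefL : Integrable (fun x => coefL x ^ 2) (unif.prod unif) :=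
  ((integrable_unif_rpow β_pos.le).mul_prod
    (integrable_unif_rpow (a := 2 * β) (by linarith [β_pos]))).congr sq_coefL_ae.symm

theorem integrable_sq_coefR : Integrable (fun x => coefR x ^ 2) (unif.prod unif) :=
  ((integrable_unif_rpow β_pos.le).mul_prod
    (integrable_unif_one_sub_rpow (a := 2 * β) (by linarith [β_pos]))).congr sq_coefR_ae.symm

/-- The contraction factor `E[U^β (V^(2β) + (1-V)^(2β))]` of the fixed-point map in `L²`. -/
noncomputable def contr : ℝ := 2 / ((β + 1) * (2 * β + 1))

theorem contr_pos : 0 < contr := by have := β_pos; unfold contr; positivity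

theorem contr_lt_one : contr < 1 := by
  have := half_lt_β
  unfold contr
  rw [div_lt_one (by positivity)]
  nlinarith

theorem integral_sq_coef :
    ∫ x, coefL x ^ 2 ∂(unif.prod unif) + ∫ x, coefR x ^ 2 ∂(unif.prod unif) = contr := by
  have hb := β_pos
  rw [integral_congr_ae sq_coefL_ae, integral_congr_ae sq_coefR_ae,
    integral_prod_mul (fun u : ℝ => u ^ β) (fun v : ℝ => v ^ (2 * β)),
    integral_prod_mul (fun u : ℝ => u ^ β) (fun v : ℝ => (1 - v) ^ (2 * β)),
    integral_unif_rpow hb.le, integral_unif_rpow (by linarith),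
    integral_unif_one_sub_rpow (by linarith), contr]
  field_simp
  ring

theorem fixedPointMap_eq (ψ : Measure ℝ) : fixedPointMap ψ = ((unif.prod unif).prod (ψ.prod ψ)).map
    (fun x => coefL x.1 * x.2.1 + coefR x.1 * x.2.2) := rfl

theorem measurable_fixedPoint_integrand : Measurable
    (fun x : (ℝ × ℝ) × (ℝ × ℝ) => coefL x.1 * x.2.1 + coefR x.1 * x.2.2) := by fun_prop

instance (ψ : Measure ℝ) [IsProbabilityMeasure ψ] : IsProbabilityMeasure (fixedPointMap ψ) := by
  rw [fixedPointMap_eq]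
  exact Measure.isProbabilityMeasure_map measurable_fixedPoint_integrand.aemeasurable

theorem charFun_fixedPointMap (ψ : Measure ℝ) [IsProbabilityMeasure ψ] (t : ℝ) :
    charFun (fixedPointMap ψ) t =
      ∫ x, charFun ψ (coefL x * t) * charFun ψ (coefR x * t) ∂(unif.prod unif) := by
  rw [charFun_apply_real, fixedPointMap_eq,
    integral_map measurable_fixedPoint_integrand.aemeasurable (by fun_prop), integral_prod]
  · refine integral_congr_ae (Eventually.of_forall fun x => ?_)
    simp only [charFun_apply_real]
    rw [← integral_prod_mul]
    refine integral_congr_ae (Eventually.of_forall fun y => ?_)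
    simp only
    rw [← Complex.exp_add]
    push_cast
    congr 1
    ring
  · refine Integrable.of_bound (C := 1) (by fun_prop) (Eventually.of_forall fun x => ?_)
    rw [show (t : ℂ) * ((coefL x.1 * x.2.1 + coefR x.1 * x.2.2 : ℝ) : ℂ) * Complex.I =
      ((t * (coefL x.1 * x.2.1 + coefR x.1 * x.2.2) : ℝ) : ℂ) * Complex.I by push_cast; ring,
      Complex.norm_exp_ofReal_mul_I]

theorem integrable_charFun_mul (ψ : Measure ℝ) [IsProbabilityMeasure ψ] (t : ℝ) :
    Integrable (fun x => charFun ψ (coefL x * t) * charFun ψ (coefR x * t)) (unif.prod unif) := by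
  refine Integrable.of_bound (C := 1) ?_ (Eventually.of_forall fun x => ?_)
  · have h1 : Measurable (fun x => charFun ψ (coefL x * t)) :=
      measurable_charFun.comp (by fun_prop)
    have h2 : Measurable (fun x => charFun ψ (coefR x * t)) :=
      measurable_charFun.comp (by fun_prop)
    exact (h1.mul h2).aestronglyMeasurable
  · rw [norm_mul]
    exact mul_le_one₀ (norm_charFun_le_one _) (norm_nonneg _) (norm_charFun_le_one _)

/-- In the distance `sup |f₁(t) - f₂(t)| / t²` between characteristic functions the fixed-point
map is a contraction. -/
theorem norm_charFun_fixedPointMap_sub_le {φ ψ : Measure ℝ} [IsProbabilityMeasure φ]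
    [IsProbabilityMeasure ψ] {C : ℝ} (hC : ∀ t, ‖charFun φ t - charFun ψ t‖ ≤ C * t ^ 2) (t : ℝ) :
    ‖charFun (fixedPointMap φ) t - charFun (fixedPointMap ψ) t‖ ≤ C * contr * t ^ 2 := by
  rw [charFun_fixedPointMap, charFun_fixedPointMap,
    ← integral_sub (integrable_charFun_mul φ t) (integrable_charFun_mul ψ t)]
  have hint : Integrable (fun x => C * t ^ 2 * (coefL x ^ 2 + coefR x ^ 2)) (unif.prod unif) :=
    (integrable_sq_coefL.add integrable_sq_coefR).const_mul _
  refine (norm_integral_le_of_norm_le hint (Eventually.of_forall fun x => ?_)).trans (le_of_eq ?_)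
  · have h1 := hC (coefL x * t)
    have h2 := hC (coefR x * t)
    set a := charFun φ (coefL x * t)
    set b := charFun φ (coefR x * t)
    set a' := charFun ψ (coefL x * t)
    set b' := charFun ψ (coefR x * t)
    have hb : ‖b‖ ≤ 1 := norm_charFun_le_one _
    have ha' : ‖a'‖ ≤ 1 := norm_charFun_le_one _
    calc ‖a * b - a' * b'‖ = ‖(a - a') * b + a' * (b - b')‖ := by ring_nf
      _ ≤ ‖a - a'‖ * ‖b‖ + ‖a'‖ * ‖b - b'‖ := by
        refine (norm_add_le _ _).trans ?_
        rw [norm_mul, norm_mul]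
      _ ≤ ‖a - a'‖ * 1 + 1 * ‖b - b'‖ := by gcongr
      _ ≤ _ := by nlinarith
  · rw [integral_const_mul, integral_add integrable_sq_coefL integrable_sq_coefR, integral_sq_coef]
    ring

theorem norm_exp_I_sub_le (x : ℝ) :
    ‖Complex.exp (x * Complex.I) - 1 - x * Complex.I‖ ≤ 3 * x ^ 2 := by
  have hx : ‖(x : ℂ) * Complex.I‖ = |x| := by simp
  rcases le_or_gt |x| 1 with h | h
  · have := Complex.norm_exp_sub_one_sub_id_le (x := x * Complex.I) (by rwa [hx])
    rw [hx, sq_abs] at this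
    nlinarith [sq_nonneg x]
  · refine (norm_sub_le _ _).trans ?_
    rw [hx]
    have h1 : ‖Complex.exp (x * Complex.I) - 1‖ ≤ 2 := by
      refine (norm_sub_le _ _).trans ?_
      rw [Complex.norm_exp_ofReal_mul_I, norm_one]
      norm_num
    have h2 : |x| ^ 2 = x ^ 2 := sq_abs x
    nlinarith

theorem norm_charFun_sub_le {ψ : Measure ℝ} [IsProbabilityMeasure ψ]
    (h2 : MemLp (fun x : ℝ => x) 2 ψ) (t : ℝ) :
    ‖charFun ψ t - 1 - t * (∫ x, x ∂ψ : ℝ) * Complex.I‖ ≤ 3 * (∫ x, x ^ 2 ∂ψ) * t ^ 2 := by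
  have hi : Integrable (fun x : ℝ => x) ψ := h2.integrable (by norm_num)
  have hexp : Integrable (fun x : ℝ => Complex.exp (t * x * Complex.I)) ψ := by
    refine Integrable.of_bound (C := 1) (by fun_prop) (Eventually.of_forall fun x => ?_)
    rw [← Complex.ofReal_mul, Complex.norm_exp_ofReal_mul_I]
  have hlin : Integrable (fun x : ℝ => (t : ℂ) * x * Complex.I) ψ :=
    (hi.ofReal.const_mul _).mul_const _
  have e : charFun ψ t - 1 - t * (∫ x, x ∂ψ : ℝ) * Complex.I =
      ∫ x, (Complex.exp (t * x * Complex.I) - 1 - t * x * Complex.I) ∂ψ := by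
    have h1 : Integrable (fun x : ℝ => Complex.exp (t * x * Complex.I) - 1) ψ :=
      hexp.sub (integrable_const _)
    rw [integral_sub h1 hlin, integral_sub hexp (integrable_const _),
      charFun_apply_real, integral_mul_const, integral_const_mul]
    have h2 : ∫ x : ℝ, (x : ℂ) ∂ψ = ((∫ x, x ∂ψ : ℝ) : ℂ) := integral_ofReal
    rw [h2]
    simp
  rw [e]
  refine (norm_integral_le_of_norm_le (g := fun x => 3 * t ^ 2 * x ^ 2) (h2.integrable_sq.const_mul _)
    (Eventually.of_forall fun x => ?_)).trans (le_of_eq ?_)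
  · have := norm_exp_I_sub_le (t * x)
    push_cast at this
    refine this.trans (le_of_eq (by ring))
  · rw [integral_const_mul]
    ring

/-- Two solutions have the same mean, so the difference of their characteristic functions is of order
`t ^ 2`, where the fixed-point map contracts. -/
theorem IsSolution.unique {φ ψ : Measure ℝ} (hφ : IsSolution φ) (hψ : IsSolution ψ) : φ = ψ := by
  have := hφ.isProbabilityMeasure
  have := hψ.isProbabilityMeasure
  have h0 : ∀ t, ‖charFun φ t - charFun ψ t‖ ≤ (3 * (∫ x, x ^ 2 ∂φ) + 3 * (∫ x, x ^ 2 ∂ψ)) * t ^ 2 := by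
    intro t
    have h1 := norm_charFun_sub_le hφ.memLp_two t
    have h2 := norm_charFun_sub_le hψ.memLp_two t
    rw [hφ.mean_eq_one] at h1
    rw [hψ.mean_eq_one] at h2
    refine (norm_sub_le_norm_sub_add_norm_sub _ (1 + t * ((1 : ℝ) : ℂ) * Complex.I) _).trans ?_
    rw [norm_sub_rev _ (charFun ψ t), ← sub_sub, ← sub_sub]
    linarith
  set C := 3 * (∫ x, x ^ 2 ∂φ) + 3 * (∫ x, x ^ 2 ∂ψ)
  have hn : ∀ n : ℕ, ∀ t, ‖charFun φ t - charFun ψ t‖ ≤ C * contr ^ n * t ^ 2 := by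
    intro n
    induction n with
    | zero => simpa using h0
    | succ n ih =>
      intro t
      have := norm_charFun_fixedPointMap_sub_le ih t
      rw [hφ.fixed, hψ.fixed] at this
      refine this.trans (le_of_eq (by ring))
  refine Measure.ext_of_charFun (funext fun t => ?_)
  have hlim : Tendsto (fun n : ℕ => C * contr ^ n * t ^ 2) atTop (𝓝 (C * 0 * t ^ 2)) :=
    ((tendsto_pow_atTop_nhds_zero_of_lt_one contr_pos.le contr_lt_one).const_mul _).mul_const _
  have := ge_of_tendsto' hlim fun n => hn n t
  simp only [mul_zero, zero_mul] at this
  exact sub_eq_zero.1 (norm_le_zero_iff.1 this)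

/-- The moments of the image of a law of mean `1` under the fixed-point map. -/
theorem fixedPointMap_moments {ψ : Measure ℝ} [IsProbabilityMeasure ψ]
    (h2 : MemLp (fun x : ℝ => x) 2 ψ) (h1 : ∫ x, x ∂ψ = 1) :
    MemLp (fun x : ℝ => x) 2 (fixedPointMap ψ) ∧ ∫ x, x ∂(fixedPointMap ψ) = 1 ∧
      ∫ x, x ^ 2 ∂(fixedPointMap ψ) ≤ contr * ∫ x, x ^ 2 ∂ψ + 2 := by
  have hi : Integrable (fun x : ℝ => x) ψ := h2.integrable (by norm_num)
  have hm := measurable_fixedPoint_integrand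
  have hsq := h2.integrable_sq
  have hLR : Integrable (fun x => coefL x * coefR x) (unif.prod unif) := by
    refine Integrable.of_bound (C := 1) (by fun_prop) ?_
    filter_upwards [ae_coef_mem] with x hx
    rw [Real.norm_eq_abs, abs_of_nonneg (mul_nonneg hx.1.1 hx.2.1)]
    exact mul_le_one₀ hx.1.2 hx.2.1 hx.2.2
  have hLR1 : ∫ x, coefL x * coefR x ∂(unif.prod unif) ≤ 1 := by
    have := integral_mono_ae hLR (integrable_const (1 : ℝ)) (by
      filter_upwards [ae_coef_mem] with x hx
      exact mul_le_one₀ hx.1.2 hx.2.1 hx.2.2)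
    simpa using this
  have i1 : Integrable (fun x : (ℝ × ℝ) × (ℝ × ℝ) => coefL x.1 ^ 2 * x.2.1 ^ 2)
      ((unif.prod unif).prod (ψ.prod ψ)) := integrable_sq_coefL.mul_prod (hsq.comp_fst ψ)
  have i2 : Integrable (fun x : (ℝ × ℝ) × (ℝ × ℝ) => coefR x.1 ^ 2 * x.2.2 ^ 2)
      ((unif.prod unif).prod (ψ.prod ψ)) := integrable_sq_coefR.mul_prod (hsq.comp_snd ψ)
  have i3 : Integrable (fun x : (ℝ × ℝ) × (ℝ × ℝ) => (coefL x.1 * coefR x.1) * (x.2.1 * x.2.2))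
      ((unif.prod unif).prod (ψ.prod ψ)) := hLR.mul_prod (hi.mul_prod hi)
  have i4 : Integrable (fun x : (ℝ × ℝ) × (ℝ × ℝ) => coefL x.1 * x.2.1)
      ((unif.prod unif).prod (ψ.prod ψ)) := integrable_coefL.mul_prod (hi.comp_fst ψ)
  have i5 : Integrable (fun x : (ℝ × ℝ) × (ℝ × ℝ) => coefR x.1 * x.2.2)
      ((unif.prod unif).prod (ψ.prod ψ)) := integrable_coefR.mul_prod (hi.comp_snd ψ)
  have i12 : Integrable (fun x : (ℝ × ℝ) × (ℝ × ℝ) => coefL x.1 ^ 2 * x.2.1 ^ 2 +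
      coefR x.1 ^ 2 * x.2.2 ^ 2) ((unif.prod unif).prod (ψ.prod ψ)) := i1.add i2
  have esq : (fun x : (ℝ × ℝ) × (ℝ × ℝ) => (coefL x.1 * x.2.1 + coefR x.1 * x.2.2) ^ 2) =
      fun x => coefL x.1 ^ 2 * x.2.1 ^ 2 + coefR x.1 ^ 2 * x.2.2 ^ 2 +
        2 * ((coefL x.1 * coefR x.1) * (x.2.1 * x.2.2)) := by
    funext x; ring
  have hfst : ∀ f : ℝ → ℝ, ∫ y : ℝ × ℝ, f y.1 ∂(ψ.prod ψ) = ∫ y, f y ∂ψ := fun f => by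
    simpa using integral_prod_mul (μ := ψ) (ν := ψ) f (fun _ => (1 : ℝ))
  have hsnd : ∀ f : ℝ → ℝ, ∫ y : ℝ × ℝ, f y.2 ∂(ψ.prod ψ) = ∫ y, f y ∂ψ := fun f => by
    simpa using integral_prod_mul (μ := ψ) (ν := ψ) (fun _ => (1 : ℝ)) f
  refine ⟨?_, ?_, ?_⟩
  · rw [memLp_two_iff_integrable_sq (by fun_prop), fixedPointMap_eq,
      integrable_map_measure (by fun_prop) hm.aemeasurable]
    change Integrable (fun x : (ℝ × ℝ) × (ℝ × ℝ) => (coefL x.1 * x.2.1 + coefR x.1 * x.2.2) ^ 2) _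
    rw [esq]
    exact i12.add (i3.const_mul 2)
  · rw [fixedPointMap_eq, integral_map hm.aemeasurable (by fun_prop), integral_add i4 i5,
      integral_prod_mul (fun x => coefL x) (fun y : ℝ × ℝ => y.1),
      integral_prod_mul (fun x => coefR x) (fun y : ℝ × ℝ => y.2), hfst (fun y => y),
      hsnd (fun y => y), h1, mul_one, mul_one, integral_coefL_add_coefR]
  · rw [fixedPointMap_eq, integral_map hm.aemeasurable (by fun_prop), esq,
      integral_add i12 (i3.const_mul 2), integral_add i1 i2, integral_const_mul,
      integral_prod_mul (fun x => coefL x ^ 2) (fun y : ℝ × ℝ => y.1 ^ 2),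
      integral_prod_mul (fun x => coefR x ^ 2) (fun y : ℝ × ℝ => y.2 ^ 2),
      integral_prod_mul (fun x => coefL x * coefR x) (fun y : ℝ × ℝ => y.1 * y.2),
      hfst (fun y => y ^ 2), hsnd (fun y => y ^ 2),
      integral_prod_mul (fun x : ℝ => x) (fun x : ℝ => x), h1, ← add_mul, integral_sq_coef]
    linarith

/-- The iterates of the fixed-point map from the Dirac mass at `1`. -/
noncomputable def iterLaw : ℕ → Measure ℝ
  | 0 => Measure.dirac 1
  | n + 1 => fixedPointMap (iterLaw n)

instance (n : ℕ) : IsProbabilityMeasure (iterLaw n) := by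
  induction n with
  | zero => unfold iterLaw; infer_instance
  | succ n ih => unfold iterLaw; infer_instance

theorem iterLaw_moments (n : ℕ) :
    MemLp (fun x : ℝ => x) 2 (iterLaw n) ∧ ∫ x, x ∂(iterLaw n) = 1 ∧
      ∫ x, x ^ 2 ∂(iterLaw n) ≤ 2 / (1 - contr) := by
  have hc := contr_pos
  have hc1 := contr_lt_one
  have h1c : 0 < 1 - contr := by linarith
  induction n with
  | zero =>
    unfold iterLaw
    refine ⟨?_, by simp, ?_⟩
    · rw [memLp_two_iff_integrable_sq (by fun_prop)]
      exact integrable_dirac (by simp)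
    · rw [integral_dirac, le_div_iff₀ h1c]
      linarith
  | succ n ih =>
    obtain ⟨a, b, c⟩ := fixedPointMap_moments ih.1 ih.2.1
    refine ⟨a, b, c.trans ?_⟩
    have := mul_le_mul_of_nonneg_left ih.2.2 hc.le
    refine (add_le_add_left this 2).trans (le_of_eq ?_)
    field_simp
    ring

theorem iterLaw_nonneg (n : ℕ) : ∀ᵐ x ∂(iterLaw n), 0 ≤ x := by
  induction n with
  | zero =>
    unfold iterLaw
    rw [ae_dirac_iff measurableSet_Ici]
    exact zero_le_one
  | succ n ih =>
    change ∀ᵐ x ∂(fixedPointMap (iterLaw n)), 0 ≤ x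
    rw [fixedPointMap_eq, ae_map_iff measurable_fixedPoint_integrand.aemeasurable measurableSet_Ici]
    have h1 : ∀ᵐ x ∂((unif.prod unif).prod ((iterLaw n).prod (iterLaw n))),
        coefL x.1 ∈ Icc (0 : ℝ) 1 ∧ coefR x.1 ∈ Icc (0 : ℝ) 1 :=
      Measure.quasiMeasurePreserving_fst.ae ae_coef_mem
    have h2 : ∀ᵐ y ∂((iterLaw n).prod (iterLaw n)), 0 ≤ y.1 :=
      Measure.quasiMeasurePreserving_fst.ae ih
    have h3 : ∀ᵐ y ∂((iterLaw n).prod (iterLaw n)), 0 ≤ y.2 :=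
      Measure.quasiMeasurePreserving_snd.ae ih
    have h4 : ∀ᵐ x ∂((unif.prod unif).prod ((iterLaw n).prod (iterLaw n))), 0 ≤ x.2.1 ∧ 0 ≤ x.2.2 :=
      Measure.quasiMeasurePreserving_snd.ae (h2.and h3)
    filter_upwards [h1, h4] with x a b
    exact add_nonneg (mul_nonneg a.1.1 b.1) (mul_nonneg a.2.1 b.2)

/-- The characteristic functions of the iterates converge geometrically, and by Lévy's continuity
theorem the limit is that of a law. -/
theorem exists_isSolution : ∃ ψ : Measure ℝ, (∀ᵐ x ∂ψ, 0 ≤ x) ∧ IsSolution ψ := by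
  have hc := contr_pos
  have hc1 := contr_lt_one
  have h1c : 0 < 1 - contr := by linarith
  set B := 2 / (1 - contr) with hB
  have hquad : ∀ n t, ‖charFun (iterLaw n) t - 1 - t * Complex.I‖ ≤ 3 * B * t ^ 2 := by
    intro n t
    obtain ⟨a, b, c⟩ := iterLaw_moments n
    have := norm_charFun_sub_le a t
    rw [b] at this
    simp only [Complex.ofReal_one, mul_one] at this
    refine this.trans (mul_le_mul_of_nonneg_right ?_ (sq_nonneg t))
    linarith
  have hdiff : ∀ n t, ‖charFun (iterLaw n) t - charFun (iterLaw (n + 1)) t‖ ≤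
      6 * B * contr ^ n * t ^ 2 := by
    intro n
    induction n with
    | zero =>
      intro t
      have h1 := hquad 0 t
      have h2 := hquad 1 t
      refine (norm_sub_le_norm_sub_add_norm_sub _ (1 + t * Complex.I) _).trans ?_
      rw [norm_sub_rev _ (charFun (iterLaw (0 + 1)) t), ← sub_sub, ← sub_sub]
      simp only [pow_zero, zero_add] at *
      linarith
    | succ n ih =>
      intro t
      refine (norm_charFun_fixedPointMap_sub_le ih t).trans (le_of_eq (by ring))
  have hcauchy : ∀ t, CauchySeq fun n => charFun (iterLaw n) t := fun t =>
    cauchySeq_of_le_geometric contr (6 * B * t ^ 2) hc1 fun n => by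
      rw [dist_eq_norm]
      exact (hdiff n t).trans (le_of_eq (by ring))
  choose f hf using fun t => cauchySeq_tendsto_of_complete (hcauchy t)
  have hfquad : ∀ t, ‖f t - 1 - t * Complex.I‖ ≤ 3 * B * t ^ 2 := fun t =>
    le_of_tendsto' (((hf t).sub_const 1).sub_const _).norm fun n => hquad n t
  have hf0 : f 0 = 1 := by
    have := hfquad 0
    simpa [sub_eq_zero] using this
  have hfcont : ContinuousAt f 0 := by
    have h1 : Tendsto (fun t : ℝ => f t - 1 - t * Complex.I) (𝓝 0) (𝓝 0) := by
      refine squeeze_zero_norm hfquad ?_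
      have : Continuous fun t : ℝ => 3 * B * t ^ 2 := by fun_prop
      simpa using this.tendsto 0
    have h2 : Tendsto (fun t : ℝ => 1 + (t : ℂ) * Complex.I) (𝓝 0) (𝓝 1) := by
      have : Continuous fun t : ℝ => 1 + (t : ℂ) * Complex.I := by fun_prop
      simpa using this.tendsto 0
    have h3 := h1.add h2
    rw [zero_add] at h3
    rw [ContinuousAt, hf0]
    refine h3.congr fun t => ?_
    ring
  have htight := isTightMeasureSet_of_tendsto_charFun hfcont hf
  set P : ℕ → ProbabilityMeasure ℝ := fun n => ⟨iterLaw n, inferInstance⟩ with hP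
  have hcomp : IsCompact (closure (Set.range P)) := by
    apply isCompact_closure_of_isTightMeasureSet
    refine htight.subset ?_
    rintro _ ⟨_, ⟨n, rfl⟩, rfl⟩
    exact ⟨n, rfl⟩
  obtain ⟨ψ, -, k, hk, hψ⟩ := hcomp.tendsto_subseq (x := P) fun n => subset_closure ⟨n, rfl⟩
  have hchar : ∀ t, charFun (ψ : Measure ℝ) t = f t := fun t =>
    tendsto_nhds_unique ((ProbabilityMeasure.tendsto_iff_tendsto_charFun.1 hψ) t)
      ((hf t).comp hk.tendsto_atTop)
  have hint : ∀ g : BoundedContinuousFunction ℝ ℝ, Tendsto (fun n => ∫ x, g x ∂(iterLaw (k n))) atTop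
      (𝓝 (∫ x, g x ∂(ψ : Measure ℝ))) := fun g =>
    (ProbabilityMeasure.tendsto_iff_forall_integral_tendsto.1 hψ) g
  -- Nonnegativity, tested against a bounded continuous function vanishing on `[0, ∞)`.
  have hnonneg : ∀ᵐ x ∂(ψ : Measure ℝ), 0 ≤ x := by
    let g : BoundedContinuousFunction ℝ ℝ := BoundedContinuousFunction.ofNormedAddCommGroup
      (fun x => min (max (-x) 0) 1) (by fun_prop) 1 (fun x => by
        rw [Real.norm_eq_abs, abs_of_nonneg (by positivity)]
        exact min_le_right _ _)
    have h0 : ∀ n, ∫ x, g x ∂(iterLaw n) = 0 := fun n => by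
      refine integral_eq_zero_of_ae ?_
      filter_upwards [iterLaw_nonneg n] with x hx
      change min (max (-x) 0) 1 = 0
      rw [max_eq_right (by linarith)]
      exact min_eq_left zero_le_one
    have h1 : ∫ x, g x ∂(ψ : Measure ℝ) = 0 :=
      tendsto_nhds_unique (hint g) (by simp [h0])
    rw [integral_eq_zero_iff_of_nonneg (fun x => by
      change 0 ≤ min (max (-x) 0) 1
      positivity) (g.integrable _)] at h1
    filter_upwards [h1] with x hx
    change min (max (-x) 0) 1 = 0 at hx
    by_contra hneg
    have : 0 < min (max (-x) 0) 1 := lt_min (lt_max_of_lt_left (by linarith)) one_pos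
    linarith
  have hsq : ∫⁻ x, ENNReal.ofReal (x ^ 2) ∂(ψ : Measure ℝ) ≤ ENNReal.ofReal B := by
    have hK : ∀ K : ℕ, ∫⁻ x, ENNReal.ofReal (min (x ^ 2) K) ∂(ψ : Measure ℝ) ≤ ENNReal.ofReal B := by
      intro K
      let g : BoundedContinuousFunction ℝ ℝ := BoundedContinuousFunction.ofNormedAddCommGroup
        (fun x => min (x ^ 2) K) (by fun_prop) K (fun x => by
          rw [Real.norm_eq_abs, abs_of_nonneg (by positivity)]
          exact min_le_right _ _)
      have h1 : ∫ x, g x ∂(ψ : Measure ℝ) ≤ B := by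
        refine le_of_tendsto' (hint g) fun n => ?_
        obtain ⟨a, b, c⟩ := iterLaw_moments (k n)
        exact (integral_mono (g.integrable _) a.integrable_sq fun x => min_le_left _ _).trans c
      have h2 := ofReal_integral_eq_lintegral_ofReal (g.integrable (ψ : Measure ℝ))
        (Eventually.of_forall fun x => by change 0 ≤ min (x ^ 2) (K : ℝ); positivity)
      change ∫⁻ x, ENNReal.ofReal (g x) ∂(ψ : Measure ℝ) ≤ _
      rw [← h2]
      exact ENNReal.ofReal_le_ofReal h1
    have hmono := lintegral_iSup (μ := (ψ : Measure ℝ))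
      (f := fun (K : ℕ) (x : ℝ) => ENNReal.ofReal (min (x ^ 2) K)) (fun K => by fun_prop)
      (fun K L hKL x => ENNReal.ofReal_le_ofReal (min_le_min_left _ (by exact_mod_cast hKL)))
    have hsup : ∀ x : ℝ, ⨆ K : ℕ, ENNReal.ofReal (min (x ^ 2) K) = ENNReal.ofReal (x ^ 2) := by
      intro x
      refine le_antisymm (iSup_le fun K => ENNReal.ofReal_le_ofReal (min_le_left _ _)) ?_
      obtain ⟨K, hK⟩ := exists_nat_ge (x ^ 2)
      refine le_iSup_of_le K ?_
      rw [min_eq_left hK]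
    simp only [hsup] at hmono
    rw [hmono]
    exact iSup_le hK
  have hmem : MemLp (fun x : ℝ => x) 2 (ψ : Measure ℝ) := by
    rw [memLp_two_iff_integrable_sq (by fun_prop)]
    refine ⟨by fun_prop, ?_⟩
    rw [hasFiniteIntegral_iff_ofReal (Eventually.of_forall fun x => sq_nonneg x)]
    exact hsq.trans_lt ENNReal.ofReal_lt_top
  -- Two expansions of the characteristic function at `0` identify the mean.
  have hmean : ∫ x, x ∂(ψ : Measure ℝ) = 1 := by
    set m := ∫ x, x ∂(ψ : Measure ℝ) with hm
    set C := 3 * (∫ x, x ^ 2 ∂(ψ : Measure ℝ)) + 3 * B with hC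
    have h1 : ∀ t : ℝ, 0 < t → |m - 1| ≤ C * t := by
      intro t ht
      have a := norm_charFun_sub_le hmem t
      have b := hfquad t
      rw [hchar, ← hm] at a
      have e : ((t * (m - 1) : ℝ) : ℂ) * Complex.I = (f t - 1 - t * Complex.I) -
          (f t - 1 - t * m * Complex.I) := by push_cast; ring
      have h2 : ‖((t * (m - 1) : ℝ) : ℂ) * Complex.I‖ = t * |m - 1| := by
        rw [norm_mul, Complex.norm_I, mul_one, Complex.norm_real, Real.norm_eq_abs, abs_mul,
          abs_of_pos ht]
      have h3 : t * |m - 1| ≤ t * (C * t) := by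
        rw [← h2, e]
        refine (norm_sub_le _ _).trans ?_
        rw [hC]
        linarith
      exact le_of_mul_le_mul_left h3 ht
    have h2 : Tendsto (fun t : ℝ => C * t) (𝓝[>] 0) (𝓝 (C * 0)) :=
      (tendsto_id.const_mul C).mono_left nhdsWithin_le_nhds
    rw [mul_zero] at h2
    have h3 := ge_of_tendsto h2 (eventually_mem_nhdsWithin.mono fun t ht => h1 t ht)
    exact sub_eq_zero.1 (abs_nonpos_iff.1 h3)
  refine ⟨ψ, hnonneg, inferInstance, ?_, hmem, hmean⟩
  refine Measure.ext_of_charFun (funext fun t => ?_)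
  rw [charFun_fixedPointMap, hchar]
  refine tendsto_nhds_unique (f := fun n => charFun (iterLaw (n + 1)) t) ?_
    ((hf t).comp (tendsto_add_atTop_nat 1))
  change Tendsto (fun n => charFun (fixedPointMap (iterLaw n)) t) _ _
  simp only [charFun_fixedPointMap, hchar]
  refine tendsto_integral_of_dominated_convergence (fun _ => (1 : ℝ))
    (fun n => (integrable_charFun_mul _ t).aestronglyMeasurable) (integrable_const _)
    (fun n => Eventually.of_forall fun x => ?_) (Eventually.of_forall fun x => (hf _).mul (hf _))
  rw [norm_mul]
  exact mul_le_one₀ (norm_charFun_le_one _) (norm_nonneg _) (norm_charFun_le_one _)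

open scoped ENNReal

/-! ### Binomial and trinomial averages -/

/-- The expectation of `φ (N)` for a binomial `N`, as a polynomial in the probabilities `a` of
success and `c` of failure. -/
noncomputable def bin (a c : ℝ≥0∞) : ℕ → (ℕ → ℝ≥0∞) → ℝ≥0∞
  | 0, φ => φ 0
  | n + 1, φ => a * bin a c n (fun i => φ (i + 1)) + c * bin a c n φ

/-- The expectation of `Φ (N₁, N₂)` for a trinomial vector with class probabilities `a`, `b`, `c`. -/
noncomputable def tri (a b c : ℝ≥0∞) : ℕ → (ℕ → ℕ → ℝ≥0∞) → ℝ≥0∞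
  | 0, Φ => Φ 0 0
  | n + 1, Φ => a * tri a b c n (fun i j => Φ (i + 1) j) + b * tri a b c n (fun i j => Φ i (j + 1)) +
      c * tri a b c n Φ

theorem tri_const_mul (a b c : ℝ≥0∞) (n : ℕ) (k : ℝ≥0∞) (Φ : ℕ → ℕ → ℝ≥0∞) :
    tri a b c n (fun i j => k * Φ i j) = k * tri a b c n Φ := by
  induction n generalizing Φ with
  | zero => rfl
  | succ n ih =>
    simp only [tri, ih]
    ring

theorem tri_add (a b c : ℝ≥0∞) (n : ℕ) (Φ Ψ : ℕ → ℕ → ℝ≥0∞) :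
    tri a b c n (fun i j => Φ i j + Ψ i j) = tri a b c n Φ + tri a b c n Ψ := by
  induction n generalizing Φ Ψ with
  | zero => rfl
  | succ n ih =>
    simp only [tri, ih]
    ring

theorem tri_mono (a b c : ℝ≥0∞) (n : ℕ) {Φ Ψ : ℕ → ℕ → ℝ≥0∞} (hΦ : ∀ i j, Φ i j ≤ Ψ i j) :
    tri a b c n Φ ≤ tri a b c n Ψ := by
  induction n generalizing Φ Ψ with
  | zero => exact hΦ 0 0
  | succ n ih =>
    simp only [tri]
    gcongr
    · exact ih fun i j => hΦ _ _
    · exact ih fun i j => hΦ _ _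
    · exact ih hΦ

theorem tri_fst (a b c : ℝ≥0∞) (n : ℕ) (φ : ℕ → ℝ≥0∞) :
    tri a b c n (fun i _ => φ i) = bin a (b + c) n φ := by
  induction n generalizing φ with
  | zero => rfl
  | succ n ih =>
    simp only [tri, bin, ih]
    ring

theorem tri_snd (a b c : ℝ≥0∞) (n : ℕ) (φ : ℕ → ℝ≥0∞) :
    tri a b c n (fun _ j => φ j) = bin b (a + c) n φ := by
  induction n generalizing φ with
  | zero => rfl
  | succ n ih =>
    simp only [tri, bin, ih]
    ring

theorem bin_const_mul (a c : ℝ≥0∞) (n : ℕ) (k : ℝ≥0∞) (φ : ℕ → ℝ≥0∞) :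
    bin a c n (fun i => k * φ i) = k * bin a c n φ := by
  induction n generalizing φ with
  | zero => rfl
  | succ n ih =>
    simp only [bin, ih]
    ring

theorem bin_add (a c : ℝ≥0∞) (n : ℕ) (φ χ : ℕ → ℝ≥0∞) :
    bin a c n (fun i => φ i + χ i) = bin a c n φ + bin a c n χ := by
  induction n generalizing φ χ with
  | zero => rfl
  | succ n ih =>
    simp only [bin, ih]
    ring

theorem bin_mono (a c : ℝ≥0∞) (n : ℕ) {φ χ : ℕ → ℝ≥0∞} (hφ : ∀ i, φ i ≤ χ i) :
    bin a c n φ ≤ bin a c n χ := by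
  induction n generalizing φ χ with
  | zero => exact hφ 0
  | succ n ih =>
    simp only [bin]
    gcongr
    · exact ih fun i => hφ _
    · exact ih hφ

theorem bin_mono_of_le (a c : ℝ≥0∞) (n : ℕ) {φ χ : ℕ → ℝ≥0∞} (hφ : ∀ i ≤ n, φ i ≤ χ i) :
    bin a c n φ ≤ bin a c n χ := by
  induction n generalizing φ χ with
  | zero => exact hφ 0 le_rfl
  | succ n ih =>
    simp only [bin]
    gcongr
    · exact ih fun i hi => hφ _ (by omega)
    · exact ih fun i hi => hφ _ (by omega)

theorem bin_const {a c : ℝ≥0∞} (hac : a + c = 1) (n : ℕ) (k : ℝ≥0∞) :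
    bin a c n (fun _ => k) = k := by
  induction n with
  | zero => rfl
  | succ n ih => simp only [bin, ih, ← add_mul, hac, one_mul]

theorem bin_eq_sum (a c : ℝ≥0∞) (n : ℕ) (φ : ℕ → ℝ≥0∞) :
    bin a c n φ = ∑ ij ∈ Finset.HasAntidiagonal.antidiagonal n,
      (n.choose ij.1 : ℝ≥0∞) * (a ^ ij.1 * c ^ ij.2 * φ ij.1) := by
  induction n generalizing φ with
  | zero => simp [bin]
  | succ n ih =>
    rw [bin, ih, ih, Finset.sum_antidiagonal_choose_succ_mul (fun i j => a ^ i * c ^ j * φ i),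
      add_comm, Finset.mul_sum, Finset.mul_sum]
    congr 1
    · exact Finset.sum_congr rfl fun ij _ => by ring
    · refine Finset.sum_congr rfl fun ij hij => ?_
      rw [Nat.choose_symm_of_eq_add (Finset.HasAntidiagonal.mem_antidiagonal.1 hij).symm]
      ring

section Measurability

variable {α : Type*} [MeasurableSpace α]

@[fun_prop]
theorem measurable_tri {a b c : α → ℝ≥0∞} (ha : Measurable a) (hb : Measurable b) (hc : Measurable c)
    (n : ℕ) {H : α → ℕ → ℕ → ℝ≥0∞} (hH : ∀ i j, Measurable fun q => H q i j) :
    Measurable fun q => tri (a q) (b q) (c q) n (H q) := by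
  induction n generalizing H with
  | zero => exact hH 0 0
  | succ n ih =>
    exact ((ha.mul (ih fun i j => hH (i + 1) j)).add (hb.mul (ih fun i j => hH i (j + 1)))).add
      (hc.mul (ih hH))

@[fun_prop]
theorem measurable_bin {a c : α → ℝ≥0∞} (ha : Measurable a) (hc : Measurable c)
    (n : ℕ) {H : α → ℕ → ℝ≥0∞} (hH : ∀ i, Measurable fun q => H q i) :
    Measurable fun q => bin (a q) (c q) n (H q) := by
  induction n generalizing H with
  | zero => exact hH 0
  | succ n ih => exact (ha.mul (ih fun i => hH (i + 1))).add (hc.mul (ih hH))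

theorem lintegral_tri (μ : Measure α) (a b c : ℝ≥0∞) (n : ℕ) {H : α → ℕ → ℕ → ℝ≥0∞}
    (hH : ∀ i j, Measurable fun q => H q i j) :
    ∫⁻ q, tri a b c n (H q) ∂μ = tri a b c n (fun i j => ∫⁻ q, H q i j ∂μ) := by
  induction n generalizing H with
  | zero => rfl
  | succ n ih =>
    have m := fun {K : α → ℕ → ℕ → ℝ≥0∞} (hK : ∀ i j, Measurable fun q => K q i j) =>
      measurable_tri (measurable_const (a := a)) (measurable_const (a := b))
        (measurable_const (a := c)) n hK
    have m1 := m fun i j => hH (i + 1) j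
    have m2 := m fun i j => hH i (j + 1)
    have m12 : Measurable fun q => (a * tri a b c n fun i j => H q (i + 1) j) +
        b * tri a b c n fun i j => H q i (j + 1) := (m1.const_mul a).add (m2.const_mul b)
    simp only [tri]
    rw [lintegral_add_left m12,
      lintegral_add_left (m1.const_mul a), lintegral_const_mul _ m1, lintegral_const_mul _ m2,
      lintegral_const_mul _ (m hH), ih fun i j => hH (i + 1) j, ih fun i j => hH i (j + 1), ih hH]

theorem lintegral_bin (μ : Measure α) (a c : ℝ≥0∞) (n : ℕ) {H : α → ℕ → ℝ≥0∞}
    (hH : ∀ i, Measurable fun q => H q i) :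
    ∫⁻ q, bin a c n (H q) ∂μ = bin a c n (fun i => ∫⁻ q, H q i ∂μ) := by
  have h := lintegral_tri μ a 0 c n (H := fun q i _ => H q i) fun i _ => hH i
  simpa [tri_fst] using h

/-! ### Expectations over lists of independent points -/

/-- The expectation of `f` over a list of `n` independent points with law `m`. -/
noncomputable def listExp (m : Measure α) : ℕ → (List α → ℝ≥0∞) → ℝ≥0∞
  | 0, f => f []
  | n + 1, f => ∫⁻ q, listExp m n (fun l => f (q :: l)) ∂m

/-- A function on lists is measurable if it is so on the lists of each fixed length. -/
def ListMeasurable (f : List α → ℝ≥0∞) : Prop :=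
  ∀ n, Measurable fun v : Fin n → α => f (List.ofFn v)

theorem ListMeasurable.cons_prod {f : List α → ℝ≥0∞} (hf : ListMeasurable f) (n : ℕ) :
    Measurable fun x : α × (Fin n → α) => f (x.1 :: List.ofFn x.2) := by
  have h1 : Measurable fun x : α × (Fin n → α) => (Fin.cons x.1 x.2 : Fin (n + 1) → α) := by
    refine measurable_pi_lambda _ fun i => ?_
    refine Fin.cases ?_ (fun j => ?_) i
    · simpa using measurable_fst
    · simpa [Function.comp_def] using (measurable_pi_apply j).comp measurable_snd
  simpa [Function.comp_def, List.ofFn_succ] using (hf (n + 1)).comp h1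

theorem ListMeasurable.cons {f : List α → ℝ≥0∞} (hf : ListMeasurable f) (q : α) :
    ListMeasurable fun l => f (q :: l) := fun n =>
  (hf.cons_prod n).comp (measurable_const.prodMk measurable_id)

theorem listExp_eq_lintegral_pi (m : Measure α) [IsFiniteMeasure m] (n : ℕ) {f : List α → ℝ≥0∞}
    (hf : ListMeasurable f) :
    listExp m n f = ∫⁻ v, f (List.ofFn v) ∂(Measure.pi fun _ : Fin n => m) := by
  induction n generalizing f with
  | zero =>
    simp [listExp]
  | succ n ih =>
    have hmp := (measurePreserving_piFinSuccAbove (fun _ : Fin (n + 1) => m) 0).symm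
    rw [← hmp.lintegral_comp (hf (n + 1)), lintegral_prod, listExp]
    · refine lintegral_congr fun q => ?_
      rw [ih (hf.cons q)]
      refine lintegral_congr fun v => ?_
      simp [MeasurableEquiv.piFinSuccAbove, List.ofFn_succ]
    · exact ((hf (n + 1)).comp hmp.measurable).aemeasurable

theorem measurable_listExp_cons (m : Measure α) [IsFiniteMeasure m] (n : ℕ) {f : List α → ℝ≥0∞}
    (hf : ListMeasurable f) : Measurable fun q => listExp m n fun l => f (q :: l) := by
  have h : ∀ q, listExp m n (fun l => f (q :: l)) =
      ∫⁻ v, f (q :: List.ofFn v) ∂(Measure.pi fun _ : Fin n => m) := fun q =>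
    listExp_eq_lintegral_pi m n (hf.cons q)
  simp only [h]
  exact (hf.cons_prod n).lintegral_prod_right'

theorem listExp_const (m : Measure α) [IsProbabilityMeasure m] (n : ℕ) (k : ℝ≥0∞) :
    listExp m n (fun _ => k) = k := by
  induction n with
  | zero => rfl
  | succ n ih => simp [listExp, ih]

theorem listExp_map {γ : Type*} [MeasurableSpace γ] (m : Measure α) {φ : α → γ}
    (hφ : MeasurableEmbedding φ) (n : ℕ) (f : List γ → ℝ≥0∞) :
    listExp (m.map φ) n f = listExp m n fun l => f (l.map φ) := by
  induction n generalizing f with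
  | zero => rfl
  | succ n ih =>
    rw [listExp, hφ.lintegral_map, listExp]
    exact lintegral_congr fun q => by simp [ih]

open Classical in
/-- Among independent points, those falling in two disjoint sets form two lists that are
conditionally independent given their lengths, which are trinomial; each list consists of
independent points with the normalized restricted law. A sum of products stands for a general
function of the two lists. -/
theorem listExp_sum_filter_mul_filter {κ : Type*} (T : Finset κ) (m mA mB : Measure α)
    [IsFiniteMeasure mA] [IsFiniteMeasure mB] {A B : Set α} (hA : MeasurableSet A)
    (hB : MeasurableSet B) (hAB : Disjoint A B) {a b : ℝ≥0∞} (ha : m.restrict A = a • mA)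
    (hb : m.restrict B = b • mB) (n : ℕ) {f g : κ → List α → ℝ≥0∞}
    (hf : ∀ k, ListMeasurable (f k)) (hg : ∀ k, ListMeasurable (g k)) :
    listExp m n (fun l => ∑ k ∈ T, f k (l.filter (· ∈ A)) * g k (l.filter (· ∈ B))) =
      tri a b (m (A ∪ B)ᶜ) n fun i j => ∑ k ∈ T, listExp mA i (f k) * listExp mB j (g k) := by
  induction n generalizing f g with
  | zero => simp [listExp, tri]
  | succ n ih =>
    have mf := fun i k => measurable_listExp_cons mA i (hf k)
    have mg := fun j k => measurable_listExp_cons mB j (hg k)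
    rw [listExp, ← lintegral_add_compl _ (hA.union hB), lintegral_union hB hAB, tri]
    congr 1
    · congr 1
      · rw [setLIntegral_congr_fun (g := fun q => tri a b (m (A ∪ B)ᶜ) n fun i j =>
          ∑ k ∈ T, listExp mA i (fun l => f k (q :: l)) * listExp mB j (g k)) hA]
        · rw [ha, lintegral_smul_measure, lintegral_tri _ _ _ _ _ (fun i j =>
            Finset.measurable_fun_sum _ fun k _ => (mf i k).mul_const _), smul_eq_mul]
          congr 2
          funext i j
          rw [lintegral_finsetSum _ fun k _ => (mf i k).mul_const _]
          exact Finset.sum_congr rfl fun k _ => lintegral_mul_const _ (mf i k)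
        · intro q hq
          have hq' : q ∉ B := fun h => hAB.le_bot ⟨hq, h⟩
          simp only [List.filter_cons, hq, hq', decide_true, if_true, decide_false,
            Bool.false_eq_true, if_false]
          exact ih (fun k => (hf k).cons q) hg
      · rw [setLIntegral_congr_fun (g := fun q => tri a b (m (A ∪ B)ᶜ) n fun i j =>
          ∑ k ∈ T, listExp mA i (f k) * listExp mB j (fun l => g k (q :: l))) hB]
        · rw [hb, lintegral_smul_measure, lintegral_tri _ _ _ _ _ (fun i j =>
            Finset.measurable_fun_sum _ fun k _ => (mg j k).const_mul _), smul_eq_mul]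
          congr 2
          funext i j
          rw [lintegral_finsetSum _ fun k _ => (mg j k).const_mul _]
          exact Finset.sum_congr rfl fun k _ => lintegral_const_mul _ (mg j k)
        · intro q hq
          have hq' : q ∉ A := fun h => hAB.le_bot ⟨h, hq⟩
          simp only [List.filter_cons, hq, hq', decide_true, if_true, decide_false,
            Bool.false_eq_true, if_false]
          exact ih hf fun k => (hg k).cons q
    · rw [setLIntegral_congr_fun (g := fun q => tri a b (m (A ∪ B)ᶜ) n fun i j =>
          ∑ k ∈ T, listExp mA i (f k) * listExp mB j (g k)) (hA.union hB).compl]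
      · rw [setLIntegral_const, mul_comm]
      · intro q hq
        have hq1 : q ∉ A := fun h => hq (Or.inl h)
        have hq2 : q ∉ B := fun h => hq (Or.inr h)
        simp only [List.filter_cons, hq1, hq2, decide_false, Bool.false_eq_true, if_false]
        exact ih hf hg

end Measurability

/-! ### The cost of a query as a function of the list of inserted points -/

/-- The cost at `s` in the quadtree obtained by inserting the points of a list in order. -/
noncomputable def listCost (s : ℝ) (l : List (ℝ × ℝ)) : ℕ :=
  (l.foldl (fun T q => T.insert q) QuadTree.nil).cost s

theorem quadtree_eq_foldl (p : ℕ → ℝ × ℝ) (n : ℕ) :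
    quadtree p n =
      (List.ofFn fun i : Fin n => p i).foldl (fun T q => T.insert q) QuadTree.nil := by
  induction n with
  | zero => simp [quadtree]
  | succ n ih =>
    rw [quadtree, ih, List.ofFn_succ', List.concat_eq_append, List.foldl_append]
    simp

theorem foldl_insert_node (l : List (ℝ × ℝ)) (p : ℝ × ℝ) (sw nw se ne : QuadTree) :
    l.foldl (fun T q => T.insert q) (QuadTree.node p sw nw se ne) =
      QuadTree.node p
        ((l.filter fun q => q.1 < p.1 ∧ q.2 < p.2).foldl (fun T q => T.insert q) sw)
        ((l.filter fun q => q.1 < p.1 ∧ ¬ q.2 < p.2).foldl (fun T q => T.insert q) nw)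
        ((l.filter fun q => ¬ q.1 < p.1 ∧ q.2 < p.2).foldl (fun T q => T.insert q) se)
        ((l.filter fun q => ¬ q.1 < p.1 ∧ ¬ q.2 < p.2).foldl (fun T q => T.insert q) ne) := by
  induction l generalizing sw nw se ne with
  | nil => simp
  | cons q l ih =>
    rw [List.foldl_cons, QuadTree.insert]
    by_cases h1 : q.1 < p.1 <;> by_cases h2 : q.2 < p.2 <;> simp only [h1, h2, ih, List.filter_cons, if_true,
      if_false, decide_true, decide_false, and_true, and_false, not_true_eq_false,
      not_false_eq_true, Bool.false_eq_true, List.foldl_cons]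

/-- The points that go to the same side of the vertical line through `p` as `s`, below `p`. -/
def lowerPart (s : ℝ) (p : ℝ × ℝ) : Set (ℝ × ℝ) := {q | (q.1 < p.1 ↔ s < p.1) ∧ q.2 < p.2}

/-- The points that go to the same side of the vertical line through `p` as `s`, not below `p`. -/
def upperPart (s : ℝ) (p : ℝ × ℝ) : Set (ℝ × ℝ) := {q | (q.1 < p.1 ↔ s < p.1) ∧ ¬ q.2 < p.2}

open Classical in
theorem listCost_cons (s : ℝ) (p : ℝ × ℝ) (l : List (ℝ × ℝ)) :
    listCost s (p :: l) = 1 + listCost s (l.filter (· ∈ lowerPart s p)) +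
      listCost s (l.filter (· ∈ upperPart s p)) := by
  rw [listCost, List.foldl_cons, QuadTree.insert, foldl_insert_node, QuadTree.cost, add_assoc]
  congr 1
  by_cases h : s < p.1 <;> simp [h, listCost, lowerPart, upperPart]

@[simp] theorem listCost_nil (s : ℝ) : listCost s [] = 0 := rfl

open Classical in
/-- The cost depends only on how the points and the query compare with each other. -/
theorem listCost_congr {ι : Type*} (l : List ι) (v w : ι → ℝ × ℝ) (s t : ℝ)
    (h1 : ∀ i ∈ l, ∀ j ∈ l, (v i).1 < (v j).1 ↔ (w i).1 < (w j).1)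
    (h2 : ∀ i ∈ l, ∀ j ∈ l, (v i).2 < (v j).2 ↔ (w i).2 < (w j).2)
    (h3 : ∀ i ∈ l, s < (v i).1 ↔ t < (w i).1) :
    listCost s (l.map v) = listCost t (l.map w) := by
  induction hn : l.length using Nat.strong_induction_on generalizing l with
  | _ n ih =>
    cases l with
    | nil => simp
    | cons i l =>
      rw [List.map_cons, List.map_cons, listCost_cons, listCost_cons, List.filter_map, List.filter_map,
        List.filter_map, List.filter_map]
      have hi : i ∈ i :: l := List.mem_cons_self
      have e1 : l.filter ((fun q => decide (q ∈ lowerPart s (v i))) ∘ v) =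
          l.filter ((fun q => decide (q ∈ lowerPart t (w i))) ∘ w) := by
        refine List.filter_congr fun j hj => ?_
        have hj' : j ∈ i :: l := List.mem_cons_of_mem _ hj
        have h4 : v j ∈ lowerPart s (v i) ↔ w j ∈ lowerPart t (w i) := by
          simp only [lowerPart, mem_ofPred_eq, h1 j hj' i hi, h2 j hj' i hi, h3 i hi]
        exact decide_eq_decide.2 h4
      have e2 : l.filter ((fun q => decide (q ∈ upperPart s (v i))) ∘ v) =
          l.filter ((fun q => decide (q ∈ upperPart t (w i))) ∘ w) := by
        refine List.filter_congr fun j hj => ?_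
        have hj' : j ∈ i :: l := List.mem_cons_of_mem _ hj
        have h4 : v j ∈ upperPart s (v i) ↔ w j ∈ upperPart t (w i) := by
          simp only [upperPart, mem_ofPred_eq, h1 j hj' i hi, h2 j hj' i hi, h3 i hi]
        exact decide_eq_decide.2 h4
      have key : ∀ P : ι → Bool, listCost s ((l.filter P).map v) = listCost t ((l.filter P).map w) := by
        intro P
        have hsub : ∀ j ∈ l.filter P, j ∈ i :: l := fun j hj =>
          List.mem_cons_of_mem _ (List.mem_filter.1 hj).1
        refine ih (l.filter P).length ?_ (l.filter P) (fun a ha b hb => h1 a (hsub a ha) b (hsub b hb))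
          (fun a ha b hb => h2 a (hsub a ha) b (hsub b hb)) (fun a ha => h3 a (hsub a ha)) rfl
        have := List.length_filter_le P l
        simp only [List.length_cons] at hn
        omega
      rw [e1, e2, key, key]

theorem listCost_le_length (s : ℝ) (l : List (ℝ × ℝ)) : listCost s l ≤ l.length := by
  classical
  induction hn : l.length using Nat.strong_induction_on generalizing l with
  | _ n ih =>
    cases l with
    | nil => simp
    | cons p l =>
      rw [listCost_cons]
      have hlen : l.length < n := by simp only [List.length_cons] at hn; omega
      have h1 := ih _ ((List.length_filter_le _ _).trans_lt hlen)
        (l.filter (· ∈ lowerPart s p)) rfl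
      have h2 := ih _ ((List.length_filter_le _ _).trans_lt hlen)
        (l.filter (· ∈ upperPart s p)) rfl
      have h3 : (l.filter (· ∈ lowerPart s p)).length + (l.filter (· ∈ upperPart s p)).length
          ≤ l.length := by
        clear ih hn hlen h1 h2
        induction l with
        | nil => simp
        | cons q l ih =>
          by_cases hq : q ∈ lowerPart s p
          · have hq' : q ∉ upperPart s p := fun h => h.2 hq.2
            simp only [List.filter_cons, hq, hq', decide_true, if_true, decide_false,
              Bool.false_eq_true, if_false, List.length_cons]
            omega
          · by_cases hq' : q ∈ upperPart s p <;>
            simp only [List.filter_cons, hq, hq', decide_true, if_true, decide_false,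
              Bool.false_eq_true, if_false, List.length_cons] <;> omega
      simp only [List.length_cons] at hn
      omega

/-- The cost is jointly measurable in the query and the points, as it depends only on finitely many
comparisons. -/
theorem measurable_listCost (n : ℕ) :
    Measurable fun x : ℝ × (Fin n → ℝ × ℝ) => listCost x.1 (List.ofFn x.2) := by
  classical
  let pat : ℝ × (Fin n → ℝ × ℝ) → (Fin n → Fin n → Bool) × (Fin n → Fin n → Bool) × (Fin n → Bool) :=
    fun x => (fun i j => decide ((x.2 i).1 < (x.2 j).1), fun i j => decide ((x.2 i).2 < (x.2 j).2),
      fun i => decide (x.1 < (x.2 i).1))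
  have hbool : ∀ f g : ℝ × (Fin n → ℝ × ℝ) → ℝ, Measurable f → Measurable g →
      Measurable fun x => decide (f x < g x) := fun f g hf hg =>
    measurable_to_bool (by
      have : (fun x => decide (f x < g x)) ⁻¹' {true} = {x | f x < g x} := by ext; simp
      rw [this]
      exact measurableSet_lt hf hg)
  have hpt : ∀ i : Fin n, Measurable fun x : ℝ × (Fin n → ℝ × ℝ) => x.2 i := fun i =>
    (measurable_pi_apply i).comp measurable_snd
  have hpat : Measurable pat := by
    refine Measurable.prodMk ?_ (Measurable.prodMk ?_ ?_)
    · exact measurable_pi_lambda _ fun i => measurable_pi_lambda _ fun j =>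
        hbool _ _ (hpt i).fst (hpt j).fst
    · exact measurable_pi_lambda _ fun i => measurable_pi_lambda _ fun j =>
        hbool _ _ (hpt i).snd (hpt j).snd
    · exact measurable_pi_lambda _ fun i => hbool _ _ measurable_fst (hpt i).fst
  have hfac : Function.FactorsThrough
      (fun x : ℝ × (Fin n → ℝ × ℝ) => listCost x.1 (List.ofFn x.2)) pat := by
    intro x y hxy
    simp only [pat, Prod.mk.injEq] at hxy
    obtain ⟨e1, e2, e3⟩ := hxy
    have h1 : ∀ i j, (x.2 i).1 < (x.2 j).1 ↔ (y.2 i).1 < (y.2 j).1 := fun i j =>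
      decide_eq_decide.1 (congrFun (congrFun e1 i) j)
    have h2 : ∀ i j, (x.2 i).2 < (x.2 j).2 ↔ (y.2 i).2 < (y.2 j).2 := fun i j =>
      decide_eq_decide.1 (congrFun (congrFun e2 i) j)
    have h3 : ∀ i, x.1 < (x.2 i).1 ↔ y.1 < (y.2 i).1 := fun i => decide_eq_decide.1 (congrFun e3 i)
    simp only [List.ofFn_eq_map]
    exact listCost_congr _ _ _ _ _ (fun i _ j _ => h1 i j) (fun i _ j _ => h2 i j) fun i _ => h3 i
  have heq : (fun x : ℝ × (Fin n → ℝ × ℝ) => listCost x.1 (List.ofFn x.2)) =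
      (Function.extend pat (fun x => listCost x.1 (List.ofFn x.2)) 0) ∘ pat :=
    funext fun x => (hfac.extend_apply 0 x).symm
  rw [heq]
  exact (measurable_of_countable _).comp hpat

/-! ### The recursion for the law of the cost -/

/-- The uniform law on the unit square. -/
noncomputable abbrev unifSq : Measure (ℝ × ℝ) := unif.prod unif

theorem unifSq_eq : unifSq = volume.restrict (Icc (0 : ℝ) 1 ×ˢ Icc (0 : ℝ) 1) := by
  rw [unifSq, unif, Measure.prod_restrict, Measure.volume_eq_prod]

/-- The expectation of `F (Cₙ(s))`. -/
noncomputable def costExp (F : ℕ → ℝ≥0∞) (n : ℕ) (s : ℝ) : ℝ≥0∞ :=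
  listExp unifSq n fun l => F (listCost s l)

theorem listMeasurable_listCost (F : ℕ → ℝ≥0∞) (s : ℝ) :
    ListMeasurable fun l => F (listCost s l) := fun n =>
  (measurable_of_countable F).comp
    ((measurable_listCost n).comp (measurable_const.prodMk measurable_id))

theorem costExp_eq_lintegral (F : ℕ → ℝ≥0∞) (n : ℕ) (s : ℝ) :
    costExp F n s =
      ∫⁻ v, F (listCost s (List.ofFn v)) ∂(Measure.pi fun _ : Fin n => unifSq) :=
  listExp_eq_lintegral_pi _ _ (listMeasurable_listCost F s)

@[fun_prop]
theorem measurable_costExp (F : ℕ → ℝ≥0∞) (n : ℕ) : Measurable (costExp F n) := by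
  have : costExp F n = fun s =>
      ∫⁻ v, F (listCost s (List.ofFn v)) ∂(Measure.pi fun _ : Fin n => unifSq) :=
    funext fun s => costExp_eq_lintegral F n s
  rw [this]
  exact ((measurable_of_countable F).comp (measurable_listCost n)).lintegral_prod_right'

@[simp] theorem costExp_zero (F : ℕ → ℝ≥0∞) (s : ℝ) : costExp F 0 s = F 0 := rfl

theorem costExp_const (k : ℝ≥0∞) (n : ℕ) (s : ℝ) : costExp (fun _ => k) n s = k :=
  listExp_const _ _ _

theorem costExp_le {F : ℕ → ℝ≥0∞} (hF : Monotone F) (n : ℕ) (s : ℝ) : costExp F n s ≤ F n := by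
  rw [costExp_eq_lintegral]
  refine (lintegral_mono (g := fun _ => F n) fun v => hF ?_).trans (by simp)
  simpa using listCost_le_length s (List.ofFn v)

/-- The image of the uniform law under an affine map is, up to the length, the restriction of the
uniform law to the image. -/
theorem unif_restrict {a b : ℝ} (hab : a < b) {I : Set ℝ}
    (hI : MeasurableSet I) (hI' : (I ∩ Icc (0 : ℝ) 1 : Set ℝ) =ᵐ[volume] Icc a b) :
    unif.restrict I = ENNReal.ofReal (b - a) • unif.map fun u => a + (b - a) * u := by
  have hba : 0 < b - a := sub_pos.2 hab
  have h1 : unif.restrict I = volume.restrict (Icc a b) := by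
    rw [unif, Measure.restrict_restrict hI]
    exact Measure.restrict_congr_set hI'
  have hemb : MeasurableEmbedding fun u : ℝ => a + (b - a) * u :=
    (measurableEmbedding_addLeft a).comp (measurableEmbedding_mulLeft₀ hba.ne')
  have hpre : (fun u : ℝ => a + (b - a) * u) ⁻¹' Icc a b = Icc 0 1 := by
    ext u
    simp only [mem_preimage, mem_Icc]
    constructor
    · rintro ⟨h1, h2⟩
      exact ⟨by nlinarith, by nlinarith⟩
    · rintro ⟨h1, h2⟩
      exact ⟨by nlinarith, by nlinarith⟩
  have hvol : ENNReal.ofReal (b - a) • (volume : Measure ℝ).map (fun u : ℝ => a + (b - a) * u) =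
      volume := by
    have e : (fun u : ℝ => a + (b - a) * u) = (fun u => a + u) ∘ fun u => (b - a) * u := rfl
    have hsmul := Real.smul_map_volume_mul_left hba.ne'
    rw [abs_of_pos hba] at hsmul
    rw [e, ← Measure.map_map (measurable_const_add a) (measurable_const_mul _), ← Measure.map_smul, hsmul]
    exact (measurePreserving_add_left volume a).map_eq
  rw [h1, unif, ← hpre, ← hemb.restrict_map, ← Measure.restrict_smul, hvol]

theorem Iio_inter_ae {x : ℝ} (hx : x ≤ 1) :
    (Iio x ∩ Icc (0 : ℝ) 1 : Set ℝ) =ᵐ[volume] Icc 0 x := by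
  have : Iio x ∩ Icc (0 : ℝ) 1 = Ico 0 x := by
    ext u
    simp only [mem_inter_iff, mem_Iio, mem_Icc, mem_Ico]
    constructor
    · rintro ⟨a, b, c⟩; exact ⟨b, a⟩
    · rintro ⟨a, b⟩; exact ⟨b, a, by linarith⟩
  rw [this]
  exact Ico_ae_eq_Icc

theorem Ici_inter_ae {x : ℝ} (hx : 0 ≤ x) :
    (Ici x ∩ Icc (0 : ℝ) 1 : Set ℝ) =ᵐ[volume] Icc x 1 := by
  have : Ici x ∩ Icc (0 : ℝ) 1 = Icc x 1 := by
    ext u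
    simp only [mem_inter_iff, mem_Ici, mem_Icc]
    constructor
    · rintro ⟨a, b, c⟩; exact ⟨a, c⟩
    · rintro ⟨a, b⟩; exact ⟨a, by linarith, b⟩
  exact this ▸ ae_eq_refl _

theorem unifSq_restrict_prod {I J : Set ℝ} {a b : ℝ≥0∞} {φ χ : ℝ → ℝ} (hφ : Measurable φ)
    (hχ : Measurable χ)
    (hI : unif.restrict I = a • unif.map φ) (hJ : unif.restrict J = b • unif.map χ) :
    unifSq.restrict (I ×ˢ J) = (a * b) • unifSq.map (Prod.map φ χ) := by
  rw [unifSq, ← Measure.prod_restrict, hI, hJ, ← Measure.map_prod_map _ _ hφ hχ]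
  rw [Measure.prod_smul_left, Measure.prod_smul_right, smul_smul]

/-- The width of the side of the vertical line at `x` on which `s` lies. -/
noncomputable def sideWidth (s x : ℝ) : ℝ := if s < x then x else 1 - x

/-- The position of `s` relative to its side of the vertical line at `x`. -/
noncomputable def sidePos (s x : ℝ) : ℝ := if s < x then s / x else (s - x) / (1 - x)

theorem sideWidth_mem {s x : ℝ} (hx : x ∈ Ioo (0 : ℝ) 1) : sideWidth s x ∈ Ioo (0 : ℝ) 1 := by
  unfold sideWidth
  split_ifs
  · exact hx
  · exact ⟨by linarith [hx.2], by linarith [hx.1]⟩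

theorem sidePos_mem {s x : ℝ} (hs : s ∈ Icc (0 : ℝ) 1) (hx : x ∈ Ioo (0 : ℝ) 1) :
    sidePos s x ∈ Icc (0 : ℝ) 1 := by
  have h0 := hx.1
  have h1 : 0 < 1 - x := by linarith [hx.2]
  unfold sidePos
  split_ifs with h
  · exact ⟨div_nonneg hs.1 h0.le, (div_le_one h0).2 h.le⟩
  · exact ⟨div_nonneg (by linarith) h1.le, (div_le_one h1).2 (by linarith [hs.2])⟩

theorem measurableSet_side (s x : ℝ) : MeasurableSet {u : ℝ | u < x ↔ s < x} := by
  by_cases h : s < x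
  · simp only [h, iff_true]; exact measurableSet_Iio
  · simp only [h, iff_false, not_lt]; exact measurableSet_Ici

/-- The left end of the side of the vertical line at `x` on which `s` lies. -/
noncomputable def sideStart (s x : ℝ) : ℝ := if s < x then 0 else x

theorem unif_restrict_side (s : ℝ) {x : ℝ} (hx : x ∈ Ioo (0 : ℝ) 1) :
    unif.restrict {u : ℝ | u < x ↔ s < x} = ENNReal.ofReal (sideWidth s x) •
      unif.map fun u => sideStart s x + sideWidth s x * u := by
  by_cases h : s < x
  · have := unif_restrict hx.1 measurableSet_Iio (Iio_inter_ae hx.2.le)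
    simpa [h, sideWidth, sideStart, Iio_def] using this
  · have := unif_restrict hx.2 measurableSet_Ici (Ici_inter_ae hx.1.le)
    simpa [h, sideWidth, sideStart, Ici_def] using this

/-- After an increasing affine change of coordinates, the cost of a query on the side of `x` is the
cost of the query at the relative position. -/
theorem listCost_map_affine (s : ℝ) {x c d : ℝ} (hx : x ∈ Ioo (0 : ℝ) 1) (hd : 0 < d)
    (l : List (ℝ × ℝ)) :
    listCost s (l.map (Prod.map (fun u => sideStart s x + sideWidth s x * u) fun v => c + d * v)) =
      listCost (sidePos s x) l := by
  have hw := (sideWidth_mem (s := s) hx).1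
  have h := listCost_congr l (Prod.map (fun u => sideStart s x + sideWidth s x * u) fun v => c + d * v)
    id s (sidePos s x) (fun i _ j _ => by simp [hw]) (fun i _ j _ => by simp [hd])
    (fun i _ => ?_)
  · simpa using h
  · have h1 : 0 < 1 - x := by linarith [hx.2]
    have h0 := hx.1
    simp only [Prod.map_fst, id]
    unfold sideStart sideWidth sidePos
    split_ifs with hs
    · rw [div_lt_iff₀ h0, zero_add, mul_comm]
    · rw [div_lt_iff₀ h1, sub_lt_iff_lt_add', mul_comm]

theorem measurableSet_lowerPart (s : ℝ) (p : ℝ × ℝ) : MeasurableSet (lowerPart s p) :=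
  (measurable_fst (measurableSet_side s p.1)).inter (measurable_snd measurableSet_Iio)

theorem measurableSet_upperPart (s : ℝ) (p : ℝ × ℝ) : MeasurableSet (upperPart s p) :=
  (measurable_fst (measurableSet_side s p.1)).inter (measurable_snd measurableSet_Iio.compl)

theorem disjoint_parts (s : ℝ) (p : ℝ × ℝ) : Disjoint (lowerPart s p) (upperPart s p) :=
  Set.disjoint_left.2 fun _ h1 h2 => h2.2 h1.2

open Classical in
/-- Given the first point `p`, the two subtrees visited by a query at `s` are independent given
their sizes, and the costs in them are those of queries at the relative position of `s`. -/
theorem listExp_sum_parts {κ : Type*} (T : Finset κ) (F G : κ → ℕ → ℝ≥0∞) (n : ℕ) (s : ℝ)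
    {p : ℝ × ℝ} (hx : p.1 ∈ Ioo (0 : ℝ) 1) (hy : p.2 ∈ Ioo (0 : ℝ) 1) :
    listExp unifSq n (fun l => ∑ k ∈ T, F k (listCost s (l.filter (· ∈ lowerPart s p))) *
      G k (listCost s (l.filter (· ∈ upperPart s p)))) =
    tri (ENNReal.ofReal (sideWidth s p.1 * p.2)) (ENNReal.ofReal (sideWidth s p.1 * (1 - p.2)))
      (ENNReal.ofReal (1 - sideWidth s p.1)) n
      fun i j => ∑ k ∈ T, costExp (F k) i (sidePos s p.1) * costExp (G k) j (sidePos s p.1) := by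
  set w := sideWidth s p.1 with hw
  have hw0 : 0 < w := (sideWidth_mem hx).1
  have hw1 : w < 1 := (sideWidth_mem hx).2
  have hy1 : 0 < 1 - p.2 := by linarith [hy.2]
  set φ : ℝ → ℝ := fun u => sideStart s p.1 + w * u with hφ
  have hm : ∀ c d : ℝ, Measurable fun u : ℝ => c + d * u := fun c d => by fun_prop
  have hemb : ∀ c d : ℝ, 0 < d → MeasurableEmbedding fun u : ℝ => c + d * u := fun c d hd =>
    (measurableEmbedding_addLeft c).comp (measurableEmbedding_mulLeft₀ hd.ne')
  have hI : unif.restrict {u : ℝ | u < p.1 ↔ s < p.1} = ENNReal.ofReal w • unif.map φ :=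
    unif_restrict_side s hx
  have hJ1 := unif_restrict hy.1 measurableSet_Iio (Iio_inter_ae hy.2.le)
  have hJ2 := unif_restrict hy.2 measurableSet_Ici (Ici_inter_ae hy.1.le)
  rw [sub_zero] at hJ1
  have hlow : unifSq.restrict (lowerPart s p) = ENNReal.ofReal (w * p.2) •
      unifSq.map (Prod.map φ fun v => 0 + p.2 * v) := by
    have e : lowerPart s p = {u : ℝ | u < p.1 ↔ s < p.1} ×ˢ Iio p.2 := rfl
    rw [e, unifSq_restrict_prod (hm _ _) (hm _ _) hI hJ1,
      ENNReal.ofReal_mul hw0.le]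
  have hupp : unifSq.restrict (upperPart s p) = ENNReal.ofReal (w * (1 - p.2)) •
      unifSq.map (Prod.map φ fun v => p.2 + (1 - p.2) * v) := by
    have e : upperPart s p = {u : ℝ | u < p.1 ↔ s < p.1} ×ˢ Ici p.2 := by
      ext q; simp [upperPart]
    rw [e, unifSq_restrict_prod (hm _ _) (hm _ _) hI hJ2,
      ENNReal.ofReal_mul hw0.le]
  have hmass : ∀ (A : Set (ℝ × ℝ)) (a : ℝ≥0∞) (ψ : ℝ × ℝ → ℝ × ℝ), Measurable ψ →
      unifSq.restrict A = a • unifSq.map ψ → unifSq A = a := by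
    intro A a ψ hψ h
    have := congrArg (fun μ : Measure (ℝ × ℝ) => μ univ) h
    simpa [Measure.map_apply hψ MeasurableSet.univ] using this
  have hrest : unifSq (lowerPart s p ∪ upperPart s p)ᶜ = ENNReal.ofReal (1 - w) := by
    rw [prob_compl_eq_one_sub ((measurableSet_lowerPart s p).union (measurableSet_upperPart s p)),
      measure_union (disjoint_parts s p) (measurableSet_upperPart s p),
      hmass _ _ _ ((hm _ _).prodMap (hm _ _)) hlow, hmass _ _ _ ((hm _ _).prodMap (hm _ _)) hupp,
      ← ENNReal.ofReal_add (by nlinarith [hy.1]) (by nlinarith), ← ENNReal.ofReal_one,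
      ← ENNReal.ofReal_sub _ (by nlinarith [hy.1])]
    congr 1
    ring
  have := Measure.isProbabilityMeasure_map (μ := unifSq)
    ((hm (sideStart s p.1) w).prodMap (hm 0 p.2)).aemeasurable
  have := Measure.isProbabilityMeasure_map (μ := unifSq)
    ((hm (sideStart s p.1) w).prodMap (hm p.2 (1 - p.2))).aemeasurable
  rw [listExp_sum_filter_mul_filter T _ _ _ (measurableSet_lowerPart s p) (measurableSet_upperPart s p)
    (disjoint_parts s p) hlow hupp n
    (fun k => listMeasurable_listCost (F k) s) (fun k => listMeasurable_listCost (G k) s), hrest]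
  congr 1
  funext i j
  refine Finset.sum_congr rfl fun k _ => ?_
  rw [listExp_map _ ((hemb _ _ hw0).prodMap (hemb _ _ hy.1)),
    listExp_map _ ((hemb _ _ hw0).prodMap (hemb _ _ hy1))]
  simp only [hw, listCost_map_affine s hx hy.1, listCost_map_affine s hx hy1]
  rfl

/-! ### Averages over the first point and over the query -/

theorem ae_unif_Ioo : ∀ᵐ u ∂unif, u ∈ Ioo (0 : ℝ) 1 := by
  rw [unif, ← Measure.restrict_congr_set Ioo_ae_eq_Icc]
  exact ae_restrict_mem measurableSet_Ioo

theorem ae_unifSq_Ioo : ∀ᵐ p ∂unifSq, p.1 ∈ Ioo (0 : ℝ) 1 ∧ p.2 ∈ Ioo (0 : ℝ) 1 := by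
  have h1 : ∀ᵐ p ∂unifSq, p.1 ∈ Ioo (0 : ℝ) 1 :=
    Measure.quasiMeasurePreserving_fst.ae ae_unif_Ioo
  have h2 : ∀ᵐ p ∂unifSq, p.2 ∈ Ioo (0 : ℝ) 1 :=
    Measure.quasiMeasurePreserving_snd.ae ae_unif_Ioo
  filter_upwards [h1, h2] with p a b using ⟨a, b⟩

theorem measurableEmbedding_affine (c : ℝ) {d : ℝ} (hd : 0 < d) :
    MeasurableEmbedding fun u : ℝ => c + d * u :=
  (measurableEmbedding_addLeft c).comp (measurableEmbedding_mulLeft₀ hd.ne')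

theorem setLIntegral_unif_Iio {x : ℝ} (hx : x ∈ Ioo (0 : ℝ) 1) (f : ℝ → ℝ≥0∞) :
    ∫⁻ u in Iio x, f u ∂unif = ENNReal.ofReal x * ∫⁻ u, f (x * u) ∂unif := by
  rw [unif_restrict hx.1 measurableSet_Iio (Iio_inter_ae hx.2.le), lintegral_smul_measure,
    (measurableEmbedding_affine 0 (by linarith [hx.1])).lintegral_map]
  simp

theorem setLIntegral_unif_Ici {x : ℝ} (hx : x ∈ Ioo (0 : ℝ) 1) (f : ℝ → ℝ≥0∞) :
    ∫⁻ u in Ici x, f u ∂unif =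
      ENNReal.ofReal (1 - x) * ∫⁻ u, f (x + (1 - x) * u) ∂unif := by
  rw [unif_restrict hx.2 measurableSet_Ici (Ici_inter_ae hx.1.le), lintegral_smul_measure,
    (measurableEmbedding_affine x (by linarith [hx.2])).lintegral_map, smul_eq_mul]

theorem map_one_sub_unif : unif.map (fun u => 1 - u) = unif := by
  have hmp : MeasurePreserving (fun u : ℝ => 1 - u) volume volume :=
    Measure.measurePreserving_sub_left volume 1
  have hemb : MeasurableEmbedding fun u : ℝ => 1 - u :=
    (MeasurableEquiv.subLeft (1 : ℝ)).measurableEmbedding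
  have h := (hmp.restrict_preimage_emb hemb (Icc 0 1)).map_eq
  have hpre : (fun u : ℝ => 1 - u) ⁻¹' Icc 0 1 = Icc 0 1 := by
    ext u
    simp only [mem_preimage, mem_Icc]
    constructor <;> rintro ⟨h1, h2⟩ <;> constructor <;> linarith
  rwa [hpre] at h

theorem lintegral_unif_one_sub (f : ℝ → ℝ≥0∞) :
    ∫⁻ u, f (1 - u) ∂unif = ∫⁻ u, f u ∂unif := by
  have hemb : MeasurableEmbedding fun u : ℝ => 1 - u :=
    (MeasurableEquiv.subLeft (1 : ℝ)).measurableEmbedding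
  conv_rhs => rw [← map_one_sub_unif, hemb.lintegral_map]

@[fun_prop]
theorem measurable_sideWidth : Measurable fun x : ℝ × ℝ => sideWidth x.1 x.2 :=
  Measurable.ite (measurableSet_lt measurable_fst measurable_snd) (by fun_prop) (by fun_prop)

@[fun_prop]
theorem measurable_sidePos : Measurable fun x : ℝ × ℝ => sidePos x.1 x.2 :=
  Measurable.ite (measurableSet_lt measurable_fst measurable_snd) (by fun_prop) (by fun_prop)

theorem Measurable.sideWidth_comp {α : Type*} [MeasurableSpace α] {f g : α → ℝ} (hf : Measurable f)
    (hg : Measurable g) : Measurable fun a => sideWidth (f a) (g a) :=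
  measurable_sideWidth.comp (hf.prodMk hg)

theorem Measurable.sidePos_comp {α : Type*} [MeasurableSpace α] {f g : α → ℝ} (hf : Measurable f)
    (hg : Measurable g) : Measurable fun a => sidePos (f a) (g a) :=
  measurable_sidePos.comp (hf.prodMk hg)

/-- The sum of `F` over the two regions that a query at `s` visits below the root, each described by
its area and by the relative position of `s`, averaged over the position of the root. -/
noncomputable def branchOp (F : ℝ → ℝ → ℝ≥0∞) (s : ℝ) : ℝ≥0∞ :=
  ∫⁻ p, (F (sideWidth s p.1 * p.2) (sidePos s p.1) +
    F (sideWidth s p.1 * (1 - p.2)) (sidePos s p.1)) ∂unifSq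

theorem measurable_uncurry_side {F : ℝ → ℝ → ℝ≥0∞} (hF : Measurable fun x : ℝ × ℝ => F x.1 x.2) :
    Measurable fun x : ℝ × (ℝ × ℝ) => F (sideWidth x.1 x.2.1 * x.2.2) (sidePos x.1 x.2.1) := by
  have h1 : Measurable fun x : ℝ × (ℝ × ℝ) => sideWidth x.1 x.2.1 :=
    Measurable.sideWidth_comp measurable_fst measurable_snd.fst
  have h2 : Measurable fun x : ℝ × (ℝ × ℝ) => sidePos x.1 x.2.1 :=
    Measurable.sidePos_comp measurable_fst measurable_snd.fst
  exact hF.comp ((h1.mul measurable_snd.snd).prodMk h2)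

theorem measurable_uncurry_side' {F : ℝ → ℝ → ℝ≥0∞} (hF : Measurable fun x : ℝ × ℝ => F x.1 x.2) :
    Measurable fun x : ℝ × (ℝ × ℝ) =>
      F (sideWidth x.1 x.2.1 * (1 - x.2.2)) (sidePos x.1 x.2.1) := by
  have h1 : Measurable fun x : ℝ × (ℝ × ℝ) => sideWidth x.1 x.2.1 :=
    Measurable.sideWidth_comp measurable_fst measurable_snd.fst
  have h2 : Measurable fun x : ℝ × (ℝ × ℝ) => sidePos x.1 x.2.1 :=
    Measurable.sidePos_comp measurable_fst measurable_snd.fst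
  exact hF.comp ((h1.mul (measurable_const.sub measurable_snd.snd)).prodMk h2)

theorem measurable_branchOp {F : ℝ → ℝ → ℝ≥0∞} (hF : Measurable fun x : ℝ × ℝ => F x.1 x.2) :
    Measurable (branchOp F) :=
  ((measurable_uncurry_side hF).add (measurable_uncurry_side' hF)).lintegral_prod_right'

theorem branchOp_eq {F : ℝ → ℝ → ℝ≥0∞} (hF : Measurable fun x : ℝ × ℝ => F x.1 x.2) (s : ℝ) :
    branchOp F s =
      2 * ∫⁻ x, ∫⁻ y, F (sideWidth s x * y) (sidePos s x) ∂unif ∂unif := by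
  have m1 : Measurable fun p : ℝ × ℝ => F (sideWidth s p.1 * p.2) (sidePos s p.1) :=
    (measurable_uncurry_side hF).comp (measurable_const.prodMk measurable_id)
  have m2 : Measurable fun p : ℝ × ℝ => F (sideWidth s p.1 * (1 - p.2)) (sidePos s p.1) :=
    (measurable_uncurry_side' hF).comp (measurable_const.prodMk measurable_id)
  rw [branchOp, lintegral_add_left m1, lintegral_prod _ m1.aemeasurable,
    lintegral_prod _ m2.aemeasurable, two_mul]
  congr 1
  exact lintegral_congr fun x =>
    lintegral_unif_one_sub fun y => F (sideWidth s x * y) (sidePos s x)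

theorem lintegral_side {x : ℝ} (hx : x ∈ Ioo (0 : ℝ) 1) {G : ℝ → ℝ → ℝ≥0∞} :
    ∫⁻ s, G (sideWidth s x) (sidePos s x) ∂unif =
      ENNReal.ofReal x * ∫⁻ s, G x s ∂unif + ENNReal.ofReal (1 - x) * ∫⁻ s, G (1 - x) s ∂unif := by
  have h0 := hx.1
  have h1 : 0 < 1 - x := by linarith [hx.2]
  rw [← lintegral_add_compl _ (measurableSet_Iio (a := x)), compl_Iio]
  congr 1
  · rw [setLIntegral_congr_fun (g := fun s => G x (s / x)) measurableSet_Iio, setLIntegral_unif_Iio hx]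
    · congr 1
      exact lintegral_congr fun u => by rw [mul_div_cancel_left₀ _ h0.ne']
    · intro s hs
      have hs' : s < x := hs
      simp [sideWidth, sidePos, hs']
  · rw [setLIntegral_congr_fun (g := fun s => G (1 - x) ((s - x) / (1 - x))) measurableSet_Ici,
      setLIntegral_unif_Ici hx]
    · congr 1
      exact lintegral_congr fun u => by rw [add_sub_cancel_left, mul_div_cancel_left₀ _ h1.ne']
    · intro s hs
      have hs' : ¬ s < x := not_lt.2 hs
      simp [sideWidth, sidePos, hs']

theorem unif_Ioi {z : ℝ} (hz : z ∈ Icc (0 : ℝ) 1) : unif (Ioi z) = ENNReal.ofReal (1 - z) := by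
  rw [unif, Measure.restrict_apply measurableSet_Ioi]
  have : Ioi z ∩ Icc (0 : ℝ) 1 = Ioc z 1 := by
    ext u
    simp only [mem_inter_iff, mem_Ioi, mem_Icc, mem_Ioc]
    constructor
    · rintro ⟨a, b, c⟩; exact ⟨a, c⟩
    · rintro ⟨a, b⟩; exact ⟨a, by linarith [hz.1], b⟩
  rw [this, Real.volume_Ioc]

/-- Averaged over a uniform query, the area of a visited region has the density `2 (1-z)` (there are
two such regions, hence the factor `4`), and the relative position of the query is again uniform. -/
theorem lintegral_branchOp {F : ℝ → ℝ → ℝ≥0∞} (hF : Measurable fun x : ℝ × ℝ => F x.1 x.2) :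
    ∫⁻ s, branchOp F s ∂unif =
      4 * ∫⁻ z, ENNReal.ofReal (1 - z) * ∫⁻ s, F z s ∂unif ∂unif := by
  have hmeas3 := measurable_uncurry_side hF
  set f : ℝ → ℝ≥0∞ := fun z => ∫⁻ s, F z s ∂unif with hf
  have hfm : Measurable f := hF.lintegral_prod_right'
  have h1 : ∫⁻ s, branchOp F s ∂unif =
      2 * ∫⁻ x, ∫⁻ s, ∫⁻ y, F (sideWidth s x * y) (sidePos s x) ∂unif ∂unif ∂unif := by
    have m1 : Measurable fun q : ℝ × ℝ => ∫⁻ y, F (sideWidth q.1 q.2 * y) (sidePos q.1 q.2) ∂unif :=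
      Measurable.lintegral_prod_right' (f := fun z : (ℝ × ℝ) × ℝ =>
        F (sideWidth z.1.1 z.1.2 * z.2) (sidePos z.1.1 z.1.2))
        (hmeas3.comp (measurable_fst.fst.prodMk (measurable_fst.snd.prodMk measurable_snd)))
    simp only [branchOp_eq hF]
    rw [lintegral_const_mul _ m1.lintegral_prod_right', lintegral_lintegral_swap m1.aemeasurable]
  -- For a fixed abscissa of the root, both sides of it contribute an affine copy of `unif`.
  have h2 : ∀ x ∈ Ioo (0 : ℝ) 1, ∫⁻ s, ∫⁻ y, F (sideWidth s x * y) (sidePos s x) ∂unif ∂unif =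
      ENNReal.ofReal x * ∫⁻ y, f (x * y) ∂unif +
        ENNReal.ofReal (1 - x) * ∫⁻ y, f ((1 - x) * y) ∂unif := by
    intro x hx
    have hsw : ∀ w : ℝ, ∫⁻ s, ∫⁻ y, F (w * y) s ∂unif ∂unif = ∫⁻ y, f (w * y) ∂unif := fun w =>
      lintegral_lintegral_swap (hF.comp
        ((measurable_snd.const_mul w).prodMk measurable_fst)).aemeasurable
    rw [lintegral_side hx (G := fun w t => ∫⁻ y, F (w * y) t ∂unif), hsw, hsw]
  have h3 : ∀ x ∈ Ioo (0 : ℝ) 1, ENNReal.ofReal x * ∫⁻ y, f (x * y) ∂unif =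
      ∫⁻ z, (Ioi z).indicator (fun _ => f z) x ∂unif := by
    intro x hx
    rw [← setLIntegral_unif_Iio hx, ← lintegral_indicator measurableSet_Iio]
    refine lintegral_congr fun z => ?_
    by_cases hz : z < x <;> simp [hz]
  have hind : Measurable fun q : ℝ × ℝ => (Ioi q.2).indicator (fun _ => f q.2) q.1 := by
    have : (fun q : ℝ × ℝ => (Ioi q.2).indicator (fun _ => f q.2) q.1) =
        {q : ℝ × ℝ | q.2 < q.1}.indicator fun q => f q.2 := by
      funext q
      by_cases hq : q.2 < q.1 <;> simp [hq]
    rw [this]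
    exact (hfm.comp measurable_snd).indicator (measurableSet_lt measurable_snd measurable_fst)
  have h4 : ∫⁻ x, ∫⁻ z, (Ioi z).indicator (fun _ => f z) x ∂unif ∂unif =
      ∫⁻ z, ENNReal.ofReal (1 - z) * f z ∂unif := by
    rw [lintegral_lintegral_swap hind.aemeasurable]
    refine lintegral_congr_ae ?_
    filter_upwards [ae_unif_mem] with z hz
    rw [lintegral_indicator_const measurableSet_Ioi, unif_Ioi hz, mul_comm]
  have hg : Measurable fun x => ENNReal.ofReal x * ∫⁻ y, f (x * y) ∂unif :=
    ENNReal.measurable_ofReal.mul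
      (hfm.comp (measurable_fst.mul measurable_snd)).lintegral_prod_right'
  have h5 : ∫⁻ x, ENNReal.ofReal x * ∫⁻ y, f (x * y) ∂unif ∂unif =
      ∫⁻ z, ENNReal.ofReal (1 - z) * f z ∂unif := by
    rw [← h4]
    refine lintegral_congr_ae ?_
    filter_upwards [ae_unif_Ioo] with x hx using h3 x hx
  rw [h1]
  have h6 : ∫⁻ x, ∫⁻ s, ∫⁻ y, F (sideWidth s x * y) (sidePos s x) ∂unif ∂unif ∂unif =
      2 * ∫⁻ z, ENNReal.ofReal (1 - z) * f z ∂unif := by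
    rw [lintegral_congr_ae (g := fun x => ENNReal.ofReal x * ∫⁻ y, f (x * y) ∂unif +
        ENNReal.ofReal (1 - x) * ∫⁻ y, f ((1 - x) * y) ∂unif), lintegral_add_left hg,
      lintegral_unif_one_sub (fun x => ENNReal.ofReal x * ∫⁻ y, f (x * y) ∂unif), h5, two_mul]
    filter_upwards [ae_unif_Ioo] with x hx using h2 x hx
  rw [h6, ← mul_assoc, show (2 : ℝ≥0∞) * 2 = 4 by norm_num]

/-! ### Beta integrals and the scalar recursion -/

theorem lintegral_unif_beta {a b : ℝ} (ha : 0 < a) (hb : 0 < b) :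
    ∫⁻ x, ENNReal.ofReal (x ^ (a - 1) * (1 - x) ^ (b - 1)) ∂unif =
      ENNReal.ofReal (ProbabilityTheory.beta a b) := by
  have hpos := ProbabilityTheory.beta_pos ha hb
  have h := lintegral_betaPDF_eq_one ha hb
  rw [lintegral_betaPDF] at h
  simp only [mul_assoc] at h
  rw [setLIntegral_congr_fun (g := fun x => ENNReal.ofReal (1 / ProbabilityTheory.beta a b) *
    ENNReal.ofReal (x ^ (a - 1) * (1 - x) ^ (b - 1))) measurableSet_Ioo
    (fun x _ => ENNReal.ofReal_mul (by positivity)), lintegral_const_mul' _ _ ENNReal.ofReal_ne_top] at h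
  rw [unif, ← Measure.restrict_congr_set Ioo_ae_eq_Icc]
  have h2 : ENNReal.ofReal (ProbabilityTheory.beta a b) *
      ENNReal.ofReal (1 / ProbabilityTheory.beta a b) = 1 := by
    rw [← ENNReal.ofReal_mul hpos.le, mul_one_div_cancel hpos.ne', ENNReal.ofReal_one]
  rw [← one_mul (∫⁻ x in Ioo (0 : ℝ) 1, _), ← h2, mul_assoc, h, mul_one]

theorem lintegral_unif_pow (k m : ℕ) :
    ∫⁻ x, ENNReal.ofReal (x ^ k * (1 - x) ^ m) ∂unif =
      ENNReal.ofReal (k.factorial * m.factorial / (k + m + 1).factorial) := by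
  have h := lintegral_unif_beta (a := k + 1) (b := m + 1) (by positivity) (by positivity)
  simp only [add_sub_cancel_right, Real.rpow_natCast] at h
  rw [h, ProbabilityTheory.beta, Real.Gamma_nat_eq_factorial, Real.Gamma_nat_eq_factorial,
    show (k : ℝ) + 1 + (m + 1) = ((k + m + 1 : ℕ) : ℝ) + 1 by push_cast; ring,
    Real.Gamma_nat_eq_factorial]

/-- The operator on sequences which averages a function of the size of a visited subtree, for a
uniform query, summed over the two visited subtrees. -/
noncomputable def scalarOp (Φ : ℕ → ℝ≥0∞) (n : ℕ) : ℝ≥0∞ :=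
  ENNReal.ofReal (4 / ((n + 1) * (n + 2))) *
    ∑ k ∈ Finset.range (n + 1), ENNReal.ofReal (n + 1 - k) * Φ k

theorem lintegral_bin_eq_scalarOp (Φ : ℕ → ℝ≥0∞) (n : ℕ) :
    4 * ∫⁻ z, ENNReal.ofReal (1 - z) *
      bin (ENNReal.ofReal z) (ENNReal.ofReal (1 - z)) n Φ ∂unif = scalarOp Φ n := by
  have h1 : ∀ᵐ z ∂unif, ENNReal.ofReal (1 - z) * bin (ENNReal.ofReal z) (ENNReal.ofReal (1 - z)) n Φ =
      ∑ ij ∈ Finset.HasAntidiagonal.antidiagonal n, (n.choose ij.1 : ℝ≥0∞) * Φ ij.1 *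
        ENNReal.ofReal (z ^ ij.1 * (1 - z) ^ (ij.2 + 1)) := by
    filter_upwards [ae_unif_mem] with z hz
    have hz1 : 0 ≤ 1 - z := by linarith [hz.2]
    rw [bin_eq_sum, Finset.mul_sum]
    refine Finset.sum_congr rfl fun ij _ => ?_
    rw [ENNReal.ofReal_mul (pow_nonneg hz.1 _), ENNReal.ofReal_pow hz.1, ENNReal.ofReal_pow hz1, pow_succ]
    ring
  rw [lintegral_congr_ae h1, lintegral_finsetSum _ fun ij _ => by fun_prop, scalarOp,
    Finset.Nat.sum_antidiagonal_eq_sum_range_succ_mk, Finset.mul_sum, Finset.mul_sum]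
  refine Finset.sum_congr rfl fun k hk => ?_
  have hk' : k ≤ n := Nat.lt_succ_iff.1 (Finset.mem_range.1 hk)
  obtain ⟨m, rfl⟩ := Nat.exists_eq_add_of_le hk'
  simp only [Nat.add_sub_cancel_left]
  rw [lintegral_const_mul _ (by fun_prop), lintegral_unif_pow]
  have e : (4 : ℝ≥0∞) = ENNReal.ofReal 4 := by simp
  rw [e, ← ENNReal.ofReal_natCast]
  have : ∀ a b c d x : ℝ≥0∞, a * b = c * d → a * x * b = c * (d * x) := fun a b c d x hx => by
    calc a * x * b = a * b * x := by ring
      _ = _ := by rw [hx]; ring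
  calc ENNReal.ofReal 4 * (ENNReal.ofReal ((k + m).choose k) * Φ k *
        ENNReal.ofReal (k.factorial * (m + 1).factorial / (k + (m + 1) + 1).factorial))
      = (ENNReal.ofReal 4 * ENNReal.ofReal ((k + m).choose k) *
        ENNReal.ofReal (k.factorial * (m + 1).factorial / (k + (m + 1) + 1).factorial)) * Φ k := by ring
    _ = (ENNReal.ofReal (4 / ((((k + m : ℕ) : ℝ) + 1) * ((k + m : ℕ) + 2))) *
        ENNReal.ofReal ((k + m : ℕ) + 1 - k)) * Φ k := by
        congr 1
        rw [← ENNReal.ofReal_mul (by norm_num), ← ENNReal.ofReal_mul (by positivity),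
          ← ENNReal.ofReal_mul (by positivity)]
        congr 1
        have hc : ((k + m).choose k : ℝ) = (k + m).factorial / (k.factorial * m.factorial) := by
          rw [Nat.cast_choose ℝ hk', Nat.add_sub_cancel_left]
        have e2 : (k + (m + 1) + 1).factorial = (k + m + 2) * ((k + m + 1) * (k + m).factorial) := by
          rw [show k + (m + 1) + 1 = (k + m + 1) + 1 by ring, Nat.factorial_succ, Nat.factorial_succ]
        have f1 : (k.factorial : ℝ) ≠ 0 := by positivity
        have f2 : (m.factorial : ℝ) ≠ 0 := by positivity
        have f3 : ((k + m).factorial : ℝ) ≠ 0 := by positivity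
        rw [hc, e2, Nat.factorial_succ]
        push_cast
        field_simp
        ring
    _ = _ := by ring

theorem lintegral_branchOp_bin {φ : ℕ → ℝ → ℝ≥0∞} (hφ : ∀ k, Measurable (φ k)) (n : ℕ) :
    ∫⁻ s, branchOp (fun z s => bin (ENNReal.ofReal z) (ENNReal.ofReal (1 - z)) n fun k => φ k s) s ∂unif
      = scalarOp (fun k => ∫⁻ s, φ k s ∂unif) n := by
  have hm : Measurable fun x : ℝ × ℝ =>
      bin (ENNReal.ofReal x.1) (ENNReal.ofReal (1 - x.1)) n fun k => φ k x.2 :=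
    measurable_bin (by fun_prop) (by fun_prop) n fun k => (hφ k).comp measurable_snd
  rw [lintegral_branchOp hm, ← lintegral_bin_eq_scalarOp]
  congr 1
  refine lintegral_congr fun z => ?_
  rw [lintegral_bin _ _ _ _ hφ]

theorem scalarOp_mono {n : ℕ} {Φ Ψ : ℕ → ℝ≥0∞} (hΦ : ∀ k ≤ n, Φ k ≤ Ψ k) :
    scalarOp Φ n ≤ scalarOp Ψ n := by
  unfold scalarOp
  gcongr with k hk
  exact hΦ k (Nat.lt_succ_iff.1 (Finset.mem_range.1 hk))

theorem scalarOp_add (Φ Ψ : ℕ → ℝ≥0∞) (n : ℕ) :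
    scalarOp (fun k => Φ k + Ψ k) n = scalarOp Φ n + scalarOp Ψ n := by
  simp only [scalarOp, mul_add, Finset.sum_add_distrib]

theorem scalarOp_const_mul (c : ℝ≥0∞) (Φ : ℕ → ℝ≥0∞) (n : ℕ) :
    scalarOp (fun k => c * Φ k) n = c * scalarOp Φ n := by
  simp only [scalarOp, Finset.mul_sum]
  exact Finset.sum_congr rfl fun k _ => by ring

theorem scalarOp_ofReal {f : ℕ → ℝ} (hf : ∀ k, 0 ≤ f k) (n : ℕ) :
    scalarOp (fun k => ENNReal.ofReal (f k)) n = ENNReal.ofReal (4 / ((n + 1) * (n + 2)) *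
      ∑ k ∈ Finset.range (n + 1), ((n : ℝ) + 1 - k) * f k) := by
  have hk : ∀ k ∈ Finset.range (n + 1), (0 : ℝ) ≤ (n : ℝ) + 1 - k := fun k hk => by
    have : (k : ℝ) ≤ n := by exact_mod_cast Nat.lt_succ_iff.1 (Finset.mem_range.1 hk)
    linarith
  rw [scalarOp, ENNReal.ofReal_mul (by positivity),
    ENNReal.ofReal_sum_of_nonneg fun k h => mul_nonneg (hk k h) (hf k)]
  congr 1
  exact Finset.sum_congr rfl fun k h => (ENNReal.ofReal_mul (hk k h)).symm

theorem scalarOp_homSol (n : ℕ) :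
    scalarOp (fun k => ENNReal.ofReal (homSol k)) n = ENNReal.ofReal (homSol (n + 1)) := by
  rw [scalarOp_ofReal fun k => (homSol_pos k).le, homSol_succ]

theorem scalarOp_risingRatio {a : ℝ} (ha : 0 < a) (n : ℕ) :
    scalarOp (fun k => ENNReal.ofReal (risingRatio a k)) n =
      ENNReal.ofReal (4 / ((a + 1) * (a + 2)) * ((n + a + 2) / (n + 2)) * risingRatio a (n + 1)) := by
  rw [scalarOp_ofReal fun k => (risingRatio_pos ha k).le]
  have := sum_sub_mul_risingRatio ha (n + 1)
  push_cast at this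
  rw [this]
  congr 1
  field_simp
  ring

/-- A uniform query visits exactly one of the two sides of the root. -/
theorem scalarOp_one (n : ℕ) : scalarOp (fun _ => 1) n = 2 := by
  have hsum : ∑ k ∈ Finset.range (n + 1), ((n : ℝ) + 1 - k) = (n + 1) * (n + 2) / 2 := by
    induction n with
    | zero => norm_num
    | succ n ih =>
      have e : ∀ k ∈ Finset.range (n + 1 + 1), ((n + 1 : ℕ) : ℝ) + 1 - k = ((n : ℝ) + 1 - k) + 1 :=
        fun k _ => by push_cast; ring
      rw [Finset.sum_congr rfl e, Finset.sum_add_distrib, Finset.sum_range_succ, ih]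
      simp
      ring
  have h := scalarOp_ofReal (f := fun _ => 1) (fun _ => zero_le_one) n
  simp only [ENNReal.ofReal_one, mul_one] at h
  rw [h, hsum]
  have : (4 : ℝ) / ((n + 1) * (n + 2)) * ((n + 1) * (n + 2) / 2) = 2 := by field_simp; norm_num
  rw [this]
  simp

/-! ### Recursions for the moments of the cost -/

theorem costExp_mono {F G : ℕ → ℝ≥0∞} (hFG : ∀ k, F k ≤ G k) (n : ℕ) (s : ℝ) :
    costExp F n s ≤ costExp G n s := by
  simp only [costExp_eq_lintegral]
  exact lintegral_mono fun v => hFG _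

theorem measurable_listCost_ofFn (F : ℕ → ℝ≥0∞) (n : ℕ) (s : ℝ) :
    Measurable fun v : Fin n → ℝ × ℝ => F (listCost s (List.ofFn v)) :=
  listMeasurable_listCost F s n

theorem costExp_add (F G : ℕ → ℝ≥0∞) (n : ℕ) (s : ℝ) :
    costExp (fun k => F k + G k) n s = costExp F n s + costExp G n s := by
  simp only [costExp_eq_lintegral]
  exact lintegral_add_left (measurable_listCost_ofFn F n s) _

theorem costExp_const_mul (c : ℝ≥0∞) (F : ℕ → ℝ≥0∞) (n : ℕ) (s : ℝ) :
    costExp (fun k => c * F k) n s = c * costExp F n s := by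
  simp only [costExp_eq_lintegral]
  exact lintegral_const_mul _ (measurable_listCost_ofFn F n s)

/-- Splitting off the first point, for a function of `1 + i + j` that is a finite sum of products. -/
theorem costExp_succ {κ : Type*} (T : Finset κ) {H : ℕ → ℝ≥0∞} {F G : κ → ℕ → ℝ≥0∞}
    (hH : ∀ i j, H (1 + i + j) = ∑ k ∈ T, F k i * G k j) (n : ℕ) (s : ℝ) :
    costExp H (n + 1) s = ∫⁻ p, tri (ENNReal.ofReal (sideWidth s p.1 * p.2))
      (ENNReal.ofReal (sideWidth s p.1 * (1 - p.2))) (ENNReal.ofReal (1 - sideWidth s p.1)) n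
      (fun i j => ∑ k ∈ T, costExp (F k) i (sidePos s p.1) * costExp (G k) j (sidePos s p.1))
      ∂unifSq := by
  classical
  rw [costExp, listExp]
  refine lintegral_congr_ae ?_
  filter_upwards [ae_unifSq_Ioo] with p hp
  rw [← listExp_sum_parts T F G n s hp.1 hp.2]
  congr 1
  funext l
  rw [listCost_cons, hH]

theorem tri_const {a b c : ℝ≥0∞} (habc : a + b + c = 1) (n : ℕ) (k : ℝ≥0∞) :
    tri a b c n (fun _ _ => k) = k := by
  rw [tri_fst a b c n fun _ => k, bin_const (by rw [← add_assoc, habc])]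

theorem bin_id {a c : ℝ≥0∞} (hac : a + c = 1) (n : ℕ) : bin a c n (fun k => (k : ℝ≥0∞)) = n * a := by
  induction n with
  | zero => simp [bin]
  | succ n ih =>
    simp only [bin, Nat.cast_add, Nat.cast_one, bin_add, bin_const hac, ih]
    calc a * (n * a + 1) + c * (n * a) = (a + c) * (n * a) + a := by ring
      _ = (n + 1) * a := by rw [hac]; ring

/-- The probabilities that a point falls below, above and beside the root, for `p` in the open
unit square. -/
theorem part_weights {s : ℝ} {p : ℝ × ℝ} (hx : p.1 ∈ Ioo (0 : ℝ) 1) (hy : p.2 ∈ Ioo (0 : ℝ) 1) :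
    ENNReal.ofReal (sideWidth s p.1 * (1 - p.2)) + ENNReal.ofReal (1 - sideWidth s p.1) =
        ENNReal.ofReal (1 - sideWidth s p.1 * p.2) ∧
    ENNReal.ofReal (sideWidth s p.1 * p.2) + ENNReal.ofReal (1 - sideWidth s p.1) =
        ENNReal.ofReal (1 - sideWidth s p.1 * (1 - p.2)) ∧
    ENNReal.ofReal (sideWidth s p.1 * p.2) + ENNReal.ofReal (sideWidth s p.1 * (1 - p.2)) +
        ENNReal.ofReal (1 - sideWidth s p.1) = 1 := by
  have hw := sideWidth_mem (s := s) hx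
  set w := sideWidth s p.1
  have h1 : 0 ≤ w * p.2 := mul_nonneg hw.1.le hy.1.le
  have h2 : 0 ≤ w * (1 - p.2) := mul_nonneg hw.1.le (by linarith [hy.2])
  have h3 : 0 ≤ 1 - w := by linarith [hw.2]
  refine ⟨?_, ?_, ?_⟩
  · rw [← ENNReal.ofReal_add h2 h3]; congr 1; ring
  · rw [← ENNReal.ofReal_add h1 h3]; congr 1; ring
  · rw [← ENNReal.ofReal_add h1 h2, ← ENNReal.ofReal_add (by linarith) h3, ← ENNReal.ofReal_one]
    congr 1; ring

theorem ofReal_add_one_sub {z : ℝ} (hz : z ∈ Icc (0 : ℝ) 1) :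
    ENNReal.ofReal z + ENNReal.ofReal (1 - z) = 1 := by
  rw [← ENNReal.ofReal_add hz.1 (by linarith [hz.2]), ← ENNReal.ofReal_one]
  congr 1; ring

/-- The sum over the two visited regions of `φ` applied to the number of points in the region and to
the relative position of the query. -/
noncomputable def branchBin (φ : ℕ → ℝ → ℝ≥0∞) (n : ℕ) : ℝ → ℝ≥0∞ :=
  branchOp fun z s => bin (ENNReal.ofReal z) (ENNReal.ofReal (1 - z)) n fun k => φ k s

theorem measurable_bin_uncurry {φ : ℕ → ℝ → ℝ≥0∞} (hφ : ∀ k, Measurable (φ k)) (n : ℕ) :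
    Measurable fun x : ℝ × ℝ =>
      bin (ENNReal.ofReal x.1) (ENNReal.ofReal (1 - x.1)) n fun k => φ k x.2 :=
  measurable_bin (by fun_prop) (by fun_prop) n fun k => (hφ k).comp measurable_snd

theorem branchBin_add {φ χ : ℕ → ℝ → ℝ≥0∞} (hφ : ∀ k, Measurable (φ k)) (n : ℕ) (s : ℝ) :
    branchBin (fun k s => φ k s + χ k s) n s = branchBin φ n s + branchBin χ n s := by
  simp only [branchBin, branchOp, bin_add]
  have m1 := (measurable_uncurry_side (F := fun z s => bin (ENNReal.ofReal z) (ENNReal.ofReal (1 - z)) n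
    fun k => φ k s) (measurable_bin_uncurry hφ n)).comp
    (measurable_const (a := s).prodMk measurable_id)
  have m2 := (measurable_uncurry_side' (F := fun z s => bin (ENNReal.ofReal z) (ENNReal.ofReal (1 - z)) n
    fun k => φ k s) (measurable_bin_uncurry hφ n)).comp
    (measurable_const (a := s).prodMk measurable_id)
  rw [← lintegral_add_left]
  · refine lintegral_congr fun p => ?_
    ring
  · exact m1.add m2

theorem branchBin_const_mul {φ : ℕ → ℝ → ℝ≥0∞} (hφ : ∀ k, Measurable (φ k)) (c : ℝ≥0∞) (n : ℕ)
    (s : ℝ) : branchBin (fun k s => c * φ k s) n s = c * branchBin φ n s := by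
  simp only [branchBin, branchOp, bin_const_mul]
  have m1 := (measurable_uncurry_side (F := fun z s => bin (ENNReal.ofReal z) (ENNReal.ofReal (1 - z)) n
    fun k => φ k s) (measurable_bin_uncurry hφ n)).comp
    (measurable_const (a := s).prodMk measurable_id)
  have m2 := (measurable_uncurry_side' (F := fun z s => bin (ENNReal.ofReal z) (ENNReal.ofReal (1 - z)) n
    fun k => φ k s) (measurable_bin_uncurry hφ n)).comp
    (measurable_const (a := s).prodMk measurable_id)
  rw [← lintegral_const_mul]
  · refine lintegral_congr fun p => ?_
    ring
  · exact m1.add m2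

theorem branchOp_mono {F G : ℝ → ℝ → ℝ≥0∞} {s : ℝ} (hs : s ∈ Ioo (0 : ℝ) 1)
    (hFG : ∀ z ∈ Ioo (0 : ℝ) 1, ∀ t ∈ Icc (0 : ℝ) 1, F z t ≤ G z t) :
    branchOp F s ≤ branchOp G s := by
  refine lintegral_mono_ae ?_
  filter_upwards [ae_unifSq_Ioo] with p hp
  have hw := sideWidth_mem (s := s) hp.1
  have hpos := sidePos_mem (Ioo_subset_Icc_self hs) hp.1
  have hy : 1 - p.2 ∈ Ioo (0 : ℝ) 1 := ⟨by linarith [hp.2.2], by linarith [hp.2.1]⟩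
  exact add_le_add (hFG _ ⟨mul_pos hw.1 hp.2.1, mul_lt_one_of_nonneg_of_lt_one_left hw.1.le hw.2
      hp.2.2.le⟩ _ hpos)
    (hFG _ ⟨mul_pos hw.1 hy.1, mul_lt_one_of_nonneg_of_lt_one_left hw.1.le hw.2 hy.2.le⟩ _ hpos)

/-- An additive functional of the two parts of the tree. -/
theorem lintegral_tri_const_add {φ : ℕ → ℝ → ℝ≥0∞} (κ : ℝ≥0∞) (n : ℕ)
    (s : ℝ) :
    ∫⁻ p, tri (ENNReal.ofReal (sideWidth s p.1 * p.2))
      (ENNReal.ofReal (sideWidth s p.1 * (1 - p.2))) (ENNReal.ofReal (1 - sideWidth s p.1)) n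
      (fun i j => κ + (φ i (sidePos s p.1) + φ j (sidePos s p.1))) ∂unifSq =
    κ + branchBin φ n s := by
  have h1 : κ = ∫⁻ _p : ℝ × ℝ, κ ∂unifSq := by simp
  rw [branchBin, branchOp, h1, ← lintegral_add_left measurable_const]
  refine lintegral_congr_ae ?_
  filter_upwards [ae_unifSq_Ioo] with p hp
  obtain ⟨e1, e2, e3⟩ := part_weights (s := s) hp.1 hp.2
  rw [← h1, tri_add, tri_const e3, tri_add, tri_fst _ _ _ _ fun i => φ i (sidePos s p.1),
    tri_snd _ _ _ _ fun i => φ i (sidePos s p.1), e1, e2]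

theorem ennreal_two_mul_le_add_sq (a b : ℝ≥0∞) : 2 * a * b ≤ a ^ 2 + b ^ 2 := by
  wlog hab : a ≤ b generalizing a b
  · calc 2 * a * b = 2 * b * a := by ring
      _ ≤ b ^ 2 + a ^ 2 := this b a (le_of_not_ge hab)
      _ = _ := add_comm _ _
  obtain ⟨d, rfl⟩ := exists_add_of_le hab
  calc 2 * a * (a + d) ≤ 2 * a * (a + d) + d ^ 2 := le_self_add
    _ = _ := by ring

/-- The expected cost. -/
noncomputable def meanCost (n : ℕ) (s : ℝ) : ℝ≥0∞ := costExp (fun k => (k : ℝ≥0∞)) n s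

/-- The second moment of the cost. -/
noncomputable def sqCost (n : ℕ) (s : ℝ) : ℝ≥0∞ := costExp (fun k => (k : ℝ≥0∞) ^ 2) n s

theorem measurable_meanCost (n : ℕ) : Measurable (meanCost n) := measurable_costExp _ n

theorem measurable_sqCost (n : ℕ) : Measurable (sqCost n) := measurable_costExp _ n

theorem meanCost_le (n : ℕ) (s : ℝ) : meanCost n s ≤ n :=
  costExp_le (fun _ _ hab => Nat.cast_le.2 hab) n s

@[simp] theorem meanCost_zero (s : ℝ) : meanCost 0 s = 0 := by simp [meanCost]

@[simp] theorem sqCost_zero (s : ℝ) : sqCost 0 s = 0 := by simp [sqCost]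

theorem meanCost_succ (n : ℕ) (s : ℝ) : meanCost (n + 1) s = 1 + branchBin meanCost n s := by
  rw [meanCost, costExp_succ (Finset.univ : Finset (Fin 3)) (F := ![fun _ => 1, fun i => i, fun _ => 1])
    (G := ![fun _ => 1, fun _ => 1, fun j => j]), ← lintegral_tri_const_add]
  · refine lintegral_congr fun p => ?_
    congr 1
    funext i j
    simp [Fin.sum_univ_three, costExp_const, meanCost, add_assoc]
  · intro i j
    simp [Fin.sum_univ_three]

theorem sqCost_succ_le (n : ℕ) (s : ℝ) :
    sqCost (n + 1) s ≤ 1 + branchBin (fun k s => 2 * meanCost k s + sqCost k s + meanCost k s ^ 2) n s := by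
  rw [sqCost, costExp_succ (Finset.univ : Finset (Fin 3))
    (F := ![fun i => 1 + (2 * i + i ^ 2), fun _ => 1, fun i => 2 * i])
    (G := ![fun _ => 1, fun j => 2 * j + j ^ 2, fun j => j]), ← lintegral_tri_const_add]
  · refine lintegral_mono fun p => tri_mono _ _ _ _ fun i j => ?_
    set t := sidePos s p.1
    simp only [Fin.sum_univ_three, Matrix.cons_val_zero, Matrix.cons_val_one, Matrix.cons_val_two,
      Matrix.tail_cons, Matrix.head_cons, costExp_const, costExp_add,
      costExp_const_mul, mul_one, one_mul]
    change 1 + (2 * meanCost i t + sqCost i t) + (2 * meanCost j t + sqCost j t) +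
      2 * meanCost i t * meanCost j t ≤ _
    have := ennreal_two_mul_le_add_sq (meanCost i t) (meanCost j t)
    calc 1 + (2 * meanCost i t + sqCost i t) + (2 * meanCost j t + sqCost j t) +
        2 * meanCost i t * meanCost j t ≤ 1 + (2 * meanCost i t + sqCost i t) +
          (2 * meanCost j t + sqCost j t) + (meanCost i t ^ 2 + meanCost j t ^ 2) := by gcongr
      _ = _ := by ring
  · intro i j
    simp [Fin.sum_univ_three]
    ring

/-- The mean cost, averaged over the query. -/
theorem lintegral_meanCost (n : ℕ) :
    1 + ∫⁻ s, meanCost n s ∂unif = ENNReal.ofReal (homSol n) := by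
  induction n using Nat.strong_induction_on with
  | _ n ih =>
    cases n with
    | zero => simp [homSol_zero]
    | succ n =>
      simp only [meanCost_succ]
      rw [lintegral_add_left measurable_const]
      simp only [branchBin]
      rw [lintegral_branchOp_bin measurable_meanCost, ← scalarOp_homSol]
      have h1 : scalarOp (fun k => ENNReal.ofReal (homSol k)) n =
          scalarOp (fun k => 1 + ∫⁻ s, meanCost k s ∂unif) n :=
        le_antisymm (scalarOp_mono fun k hk => (ih k (by omega)).ge)
          (scalarOp_mono fun k hk => (ih k (by omega)).le)
      rw [h1, scalarOp_add, scalarOp_one]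
      simp [← add_assoc, one_add_one_eq_two]

/-- The Laplace transform of the cost (`θ = exp (-u)`). -/
noncomputable def genCost (θ : ℝ≥0∞) (n : ℕ) (s : ℝ) : ℝ≥0∞ := costExp (fun k => θ ^ k) n s

theorem genCost_succ (θ : ℝ≥0∞) (n : ℕ) (s : ℝ) :
    genCost θ (n + 1) s = θ * ∫⁻ p, tri (ENNReal.ofReal (sideWidth s p.1 * p.2))
      (ENNReal.ofReal (sideWidth s p.1 * (1 - p.2))) (ENNReal.ofReal (1 - sideWidth s p.1)) n
      (fun i j => genCost θ i (sidePos s p.1) * genCost θ j (sidePos s p.1)) ∂unifSq := by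
  have hm : Measurable fun p : ℝ × ℝ => tri (ENNReal.ofReal (sideWidth s p.1 * p.2))
      (ENNReal.ofReal (sideWidth s p.1 * (1 - p.2))) (ENNReal.ofReal (1 - sideWidth s p.1)) n
      (fun i j => genCost θ i (sidePos s p.1) * genCost θ j (sidePos s p.1)) := by
    have hw : Measurable fun p : ℝ × ℝ => sideWidth s p.1 :=
      Measurable.sideWidth_comp measurable_const measurable_fst
    have hp : Measurable fun p : ℝ × ℝ => sidePos s p.1 :=
      Measurable.sidePos_comp measurable_const measurable_fst
    exact measurable_tri (by fun_prop) (by fun_prop) (by fun_prop) n fun i j =>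
      ((measurable_costExp _ i).comp hp).mul ((measurable_costExp _ j).comp hp)
  rw [← lintegral_const_mul _ hm, genCost,
    costExp_succ (Finset.univ : Finset Unit) (F := fun _ i => θ * θ ^ i) (G := fun _ j => θ ^ j)]
  · refine lintegral_congr fun p => ?_
    rw [← tri_const_mul]
    congr 1
    funext i j
    simp [costExp_const_mul, genCost, mul_assoc]
  · intro i j
    simp [pow_add, mul_assoc]

/-! ### The function `h` and the second moments -/

theorem lintegral_unif_rpow {a : ℝ} (ha : 0 < a) :
    ∫⁻ x, ENNReal.ofReal (x ^ a) ∂unif = ENNReal.ofReal (1 / (a + 1)) := by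
  have h1 := lintegral_unif_beta (a := a + 1) (b := 1) (by linarith) one_pos
  simp only [add_sub_cancel_right, sub_self, Real.rpow_zero, mul_one] at h1
  rw [h1, ProbabilityTheory.beta, Real.Gamma_one, Real.Gamma_add_one (s := a + 1) (by linarith)]
  have := Real.Gamma_pos_of_pos (s := a + 1) (by linarith)
  congr 1
  field_simp

@[fun_prop]
theorem measurable_h : Measurable h := by unfold h; fun_prop

theorem h_nonneg {s : ℝ} (hs : s ∈ Icc (0 : ℝ) 1) : 0 ≤ h s :=
  Real.rpow_nonneg (mul_nonneg hs.1 (by linarith [hs.2])) _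

theorem h_pos {s : ℝ} (hs : s ∈ Ioo (0 : ℝ) 1) : 0 < h s :=
  Real.rpow_pos_of_pos (mul_pos hs.1 (by linarith [hs.2])) _

theorem h_le_one {s : ℝ} (hs : s ∈ Icc (0 : ℝ) 1) : h s ≤ 1 := by
  have hb := β_pos
  exact Real.rpow_le_one (mul_nonneg hs.1 (by linarith [hs.2])) (by nlinarith [hs.1, hs.2]) (by linarith)

theorem lintegral_h : ∫⁻ s, ENNReal.ofReal (h s) ∂unif = ENNReal.ofReal (meanConst / K₁) := by
  have hb := β_pos
  have := lintegral_unif_beta (a := β / 2 + 1) (b := β / 2 + 1) (by linarith) (by linarith)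
  rw [meanConst_div_K₁, ← this]
  refine lintegral_congr_ae ?_
  filter_upwards [ae_unif_mem] with s hs
  rw [h, Real.mul_rpow hs.1 (by linarith [hs.2]), add_sub_cancel_right]

theorem lintegral_inv_h : ∫⁻ s, (ENNReal.ofReal (h s))⁻¹ ∂unif =
    ENNReal.ofReal (ProbabilityTheory.beta (1 - β / 2) (1 - β / 2)) := by
  have hb := β_lt
  rw [← lintegral_unif_beta (a := 1 - β / 2) (b := 1 - β / 2) (by linarith) (by linarith)]
  refine lintegral_congr_ae ?_
  filter_upwards [ae_unif_Ioo] with s hs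
  have h1 : 0 < 1 - s := by linarith [hs.2]
  rw [← ENNReal.ofReal_inv_of_pos (h_pos hs), h, ← Real.rpow_neg (mul_pos hs.1 h1).le,
    Real.mul_rpow hs.1.le h1.le]
  congr 3 <;> ring

theorem sideWidth_rpow_mul_h_of_lt {s x : ℝ} (h0 : 0 < s) (hsx : s < x) :
    sideWidth s x ^ β * h (sidePos s x) = (s * (x - s)) ^ (β / 2) := by
  have hx0 : 0 < x := h0.trans hsx
  have h1 : s / x * (1 - s / x) = s * (x - s) / x ^ 2 := by field_simp
  have h2 : (x ^ 2) ^ (β / 2) = x ^ β := by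
    rw [← Real.rpow_natCast, ← Real.rpow_mul hx0.le]; congr 1; push_cast; ring
  rw [sideWidth, sidePos, if_pos hsx, if_pos hsx, h, h1,
    Real.div_rpow (mul_nonneg h0.le (by linarith)) (by positivity), h2]
  have := Real.rpow_pos_of_pos hx0 β
  field_simp

theorem sideWidth_rpow_mul_h_of_ge {s x : ℝ} (hsx : x ≤ s) (hs : s < 1) :
    sideWidth s x ^ β * h (sidePos s x) = ((s - x) * (1 - s)) ^ (β / 2) := by
  have hx0 : 0 < 1 - x := by linarith
  have h1 : (s - x) / (1 - x) * (1 - (s - x) / (1 - x)) = (s - x) * (1 - s) / (1 - x) ^ 2 := by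
    field_simp; ring
  have h2 : ((1 - x) ^ 2) ^ (β / 2) = (1 - x) ^ β := by
    rw [← Real.rpow_natCast, ← Real.rpow_mul hx0.le]; congr 1; push_cast; ring
  rw [sideWidth, sidePos, if_neg hsx.not_gt, if_neg hsx.not_gt, h, h1,
    Real.div_rpow (mul_nonneg (by linarith) (by linarith)) (by positivity), h2]
  have := Real.rpow_pos_of_pos hx0 β
  field_simp

/-- If the abscissa of the root is uniform, then `w ^ β h(s')`, where `w` is the width of the side of
the query and `s'` its relative position, has the law of `h(s) U ^ (β / 2)`. -/
theorem lintegral_sideWidth_rpow_mul_h {s : ℝ} (hs : s ∈ Ioo (0 : ℝ) 1) (G : ℝ → ℝ≥0∞) :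
    ∫⁻ x, G (sideWidth s x ^ β * h (sidePos s x)) ∂unif = ∫⁻ u, G (h s * u ^ (β / 2)) ∂unif := by
  have hs1 : 0 < 1 - s := by linarith [hs.2]
  have hsplit := lintegral_add_compl (μ := unif)
    (fun x => G (sideWidth s x ^ β * h (sidePos s x))) (measurableSet_Iio (a := s))
  rw [compl_Iio, setLIntegral_unif_Iio hs, setLIntegral_unif_Ici hs] at hsplit
  have h1 : ∫⁻ u, G (sideWidth s (s * u) ^ β * h (sidePos s (s * u))) ∂unif =
      ∫⁻ u, G (h s * u ^ (β / 2)) ∂unif := by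
    rw [← lintegral_unif_one_sub]
    refine lintegral_congr_ae ?_
    filter_upwards [ae_unif_Ioo] with u hu
    rw [sideWidth_rpow_mul_h_of_ge (by nlinarith [hs.1, hu.1]) hs.2, h,
      ← Real.mul_rpow (mul_pos hs.1 hs1).le hu.1.le]
    congr 2; ring
  have h2 : ∫⁻ u, G (sideWidth s (s + (1 - s) * u) ^ β * h (sidePos s (s + (1 - s) * u))) ∂unif =
      ∫⁻ u, G (h s * u ^ (β / 2)) ∂unif := by
    refine lintegral_congr_ae ?_
    filter_upwards [ae_unif_Ioo] with u hu
    rw [sideWidth_rpow_mul_h_of_lt hs.1 (by nlinarith [hu.1]), h,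
      ← Real.mul_rpow (mul_pos hs.1 hs1).le hu.1.le]
    congr 2; ring
  rw [← hsplit, h1, h2, ← add_mul, ofReal_add_one_sub (Ioo_subset_Icc_self hs), one_mul]

/-- The function `h` is invariant under the mean recursion. -/
theorem branchOp_rpow_mul_h {s : ℝ} (hs : s ∈ Ioo (0 : ℝ) 1) :
    branchOp (fun z t => ENNReal.ofReal (z ^ β) * ENNReal.ofReal (h t)) s = ENNReal.ofReal (h s) := by
  have hb := β_pos
  have hconst : (2 : ℝ≥0∞) * (ENNReal.ofReal (1 / (β + 1)) * ENNReal.ofReal (1 / (β / 2 + 1))) = 1 := by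
    rw [← ENNReal.ofReal_mul (by positivity), ← ENNReal.ofReal_ofNat,
      ← ENNReal.ofReal_mul (by positivity), ← ENNReal.ofReal_one]
    congr 1
    have := β_add_one_mul
    field_simp
    linarith
  rw [branchOp_eq (by fun_prop)]
  have h1 : ∫⁻ x, ∫⁻ y, ENNReal.ofReal ((sideWidth s x * y) ^ β) *
      ENNReal.ofReal (h (sidePos s x)) ∂unif ∂unif =
      ∫⁻ x, ENNReal.ofReal (1 / (β + 1)) *
        ENNReal.ofReal (sideWidth s x ^ β * h (sidePos s x)) ∂unif := by
    refine lintegral_congr_ae ?_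
    filter_upwards [ae_unif_Ioo] with x hx
    have hw := (sideWidth_mem (s := s) hx).1
    rw [← lintegral_unif_rpow hb, ← lintegral_mul_const' _ _ ENNReal.ofReal_ne_top]
    refine lintegral_congr_ae ?_
    filter_upwards [ae_unif_Ioo] with y hy
    rw [Real.mul_rpow hw.le hy.1.le, ENNReal.ofReal_mul (by positivity),
      ENNReal.ofReal_mul (by positivity)]
    ring
  rw [h1, lintegral_const_mul' _ _ ENNReal.ofReal_ne_top,
    lintegral_sideWidth_rpow_mul_h hs ENNReal.ofReal]
  simp only [ENNReal.ofReal_mul (h_pos hs).le]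
  rw [lintegral_const_mul' _ _ ENNReal.ofReal_ne_top, lintegral_unif_rpow (by linarith),
    mul_comm (ENNReal.ofReal (h s)), ← mul_assoc, ← mul_assoc, mul_assoc 2, hconst, one_mul]

/-- Jensen's inequality for the concave function `k ↦ k ^ β`. -/
theorem bin_rpow_le {z : ℝ} (hz : z ∈ Ioo (0 : ℝ) 1) (n : ℕ) :
    bin (ENNReal.ofReal z) (ENNReal.ofReal (1 - z)) n (fun k => ENNReal.ofReal ((k : ℝ) ^ β)) ≤
      ENNReal.ofReal (((n : ℝ) * z) ^ β) := by
  have hb := β_pos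
  have hb1 := β_lt
  rcases Nat.eq_zero_or_pos n with rfl | hn
  · simp [bin]
  have ht : 0 < (n : ℝ) * z := mul_pos (by exact_mod_cast hn) hz.1
  set t := (n : ℝ) * z with htdef
  -- The tangent of `k ^ β` at the mean `t = n z`.
  have key : ∀ k : ℕ, ENNReal.ofReal ((k : ℝ) ^ β) ≤
      ENNReal.ofReal ((1 - β) * t ^ β) + ENNReal.ofReal (β * t ^ (β - 1)) * (k : ℝ≥0∞) := by
    intro k
    rw [← ENNReal.ofReal_natCast, ← ENNReal.ofReal_mul (by positivity),
      ← ENNReal.ofReal_add (mul_nonneg (by linarith) (by positivity)) (by positivity)]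
    refine ENNReal.ofReal_le_ofReal ?_
    have := Real.geom_mean_le_arith_mean2_weighted (w₁ := 1 - β) (w₂ := β) (p₁ := 1)
      (p₂ := k / t) (by linarith) hb.le zero_le_one (by positivity) (by ring)
    rw [Real.one_rpow, one_mul, Real.div_rpow (by positivity) ht.le,
      div_le_iff₀ (by positivity)] at this
    calc (k : ℝ) ^ β ≤ ((1 - β) * 1 + β * (k / t)) * t ^ β := this
      _ = _ := by rw [Real.rpow_sub_one ht.ne']; ring
  refine (bin_mono _ _ _ key).trans_eq ?_
  have hz1 := ofReal_add_one_sub (Ioo_subset_Icc_self hz)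
  rw [bin_add, bin_const hz1, bin_const_mul, bin_id hz1, ← ENNReal.ofReal_natCast,
    ← ENNReal.ofReal_mul (by positivity), ← htdef, ← ENNReal.ofReal_mul (by positivity),
    ← ENNReal.ofReal_add (mul_nonneg (by linarith) (by positivity)) (by positivity)]
  congr 1
  rw [Real.rpow_sub_one ht.ne']
  field_simp
  ring

theorem branchBin_rpow_mul_h_le {s : ℝ} (hs : s ∈ Ioo (0 : ℝ) 1) (n : ℕ) :
    branchBin (fun k t => ENNReal.ofReal ((k : ℝ) ^ β) * ENNReal.ofReal (h t)) n s ≤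
      ENNReal.ofReal ((n : ℝ) ^ β) * ENNReal.ofReal (h s) := by
  rw [← branchOp_rpow_mul_h hs]
  have hm : Measurable fun p : ℝ × ℝ =>
      ENNReal.ofReal ((sideWidth s p.1 * p.2) ^ β) * ENNReal.ofReal (h (sidePos s p.1)) +
      ENNReal.ofReal ((sideWidth s p.1 * (1 - p.2)) ^ β) * ENNReal.ofReal (h (sidePos s p.1)) := by
    have hw : Measurable fun p : ℝ × ℝ => sideWidth s p.1 :=
      Measurable.sideWidth_comp measurable_const measurable_fst
    have hp : Measurable fun p : ℝ × ℝ => sidePos s p.1 :=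
      Measurable.sidePos_comp measurable_const measurable_fst
    fun_prop
  have e : ENNReal.ofReal ((n : ℝ) ^ β) *
      branchOp (fun z t => ENNReal.ofReal (z ^ β) * ENNReal.ofReal (h t)) s =
      branchOp (fun z t => ENNReal.ofReal ((n : ℝ) ^ β) *
        (ENNReal.ofReal (z ^ β) * ENNReal.ofReal (h t))) s := by
    rw [branchOp, branchOp, ← lintegral_const_mul _ hm]
    exact lintegral_congr fun p => by ring
  rw [e]
  refine branchOp_mono hs fun z hz t ht => ?_
  have : ∀ k : ℕ, ENNReal.ofReal ((k : ℝ) ^ β) * ENNReal.ofReal (h t) =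
    ENNReal.ofReal (h t) * ENNReal.ofReal ((k : ℝ) ^ β) := fun k => mul_comm _ _
  simp only [this]
  rw [bin_const_mul, ← mul_assoc, ← ENNReal.ofReal_mul (by positivity),
    ← Real.mul_rpow (by positivity) hz.1.le, mul_comm]
  gcongr
  exact bin_rpow_le hz n

/-! ### Second moments of the cost, averaged over the query -/

theorem ennreal_two_mul_le_weighted (l m : ℝ≥0∞) {e : ℝ≥0∞} (he : e ≠ ⊤) :
    2 * l * m ≤ l ^ 2 * e + m ^ 2 * e⁻¹ := by
  rcases eq_or_ne e 0 with rfl | h0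
  · rcases eq_or_ne m 0 with rfl | hm
    · simp
    · simp [ENNReal.mul_top, hm]
  · have hc := ENNReal.mul_inv_cancel h0 he
    calc 2 * l * m = 2 * l * m * (e * e⁻¹) := by rw [hc, mul_one]
      _ = 2 * (l * e) * m * e⁻¹ := by ring
      _ ≤ ((l * e) ^ 2 + m ^ 2) * e⁻¹ := by
        gcongr
        exact ennreal_two_mul_le_add_sq _ _
      _ = l ^ 2 * e * (e * e⁻¹) + m ^ 2 * e⁻¹ := by ring
      _ = _ := by rw [hc, mul_one]

/-- The square of the mean cost, relative to `n ^ β h`. -/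
noncomputable def relSqMean (n : ℕ) (s : ℝ) : ℝ≥0∞ :=
  meanCost n s ^ 2 * (ENNReal.ofReal ((n : ℝ) ^ β) * ENNReal.ofReal (h s))⁻¹

theorem measurable_relSqMean (n : ℕ) : Measurable (relSqMean n) := by
  have := measurable_meanCost n
  unfold relSqMean
  fun_prop

theorem relSqMean_zero (s : ℝ) : relSqMean 0 s = 0 := by simp [relSqMean]

theorem branchBin_mono {φ χ : ℕ → ℝ → ℝ≥0∞} {s : ℝ} (hs : s ∈ Ioo (0 : ℝ) 1) (n : ℕ)
    (hφ : ∀ k ≤ n, ∀ t ∈ Icc (0 : ℝ) 1, φ k t ≤ χ k t) : branchBin φ n s ≤ branchBin χ n s :=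
  branchOp_mono hs fun _ _ t ht => bin_mono_of_le _ _ _ fun k hk => hφ k hk t ht

/-- The tangent inequality `2 λ c ≤ λ² e + c² / e` turns the linear recursion for the mean cost into a
linear one for its square relative to `e = n ^ β h`, because `e` is almost invariant. -/
theorem relSqMean_succ_le {s : ℝ} (hs : s ∈ Ioo (0 : ℝ) 1) (n : ℕ) :
    relSqMean (n + 1) s ≤
      2 * ENNReal.ofReal (((n : ℝ) + 1) ^ (1 - β)) * (ENNReal.ofReal (h s))⁻¹ +
        branchBin relSqMean n s := by
  have hb := β_pos
  set e : ℝ≥0∞ := ENNReal.ofReal (((n + 1 : ℕ) : ℝ) ^ β) * ENNReal.ofReal (h s) with he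
  have he0 : e ≠ 0 := by
    rw [he, ← ENNReal.ofReal_mul (by positivity)]
    have := h_pos hs
    exact (ENNReal.ofReal_pos.2 (by positivity)).ne'
  have hetop : e ≠ ⊤ := ENNReal.mul_ne_top ENNReal.ofReal_ne_top ENNReal.ofReal_ne_top
  set l : ℝ≥0∞ := meanCost (n + 1) s * e⁻¹ with hl
  have hmtop : meanCost (n + 1) s ≠ ⊤ :=
    ((meanCost_le _ _).trans_lt (ENNReal.natCast_lt_top _)).ne
  have hle : l * e = meanCost (n + 1) s := by
    rw [hl, mul_assoc, ENNReal.inv_mul_cancel he0 hetop, mul_one]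
  have hq : relSqMean (n + 1) s = l * meanCost (n + 1) s := by
    rw [relSqMean, ← he, hl]; ring
  have hltop : l ≠ ⊤ := ENNReal.mul_ne_top hmtop (ENNReal.inv_ne_top.2 he0)
  have hqtop : relSqMean (n + 1) s ≠ ⊤ := hq ▸ ENNReal.mul_ne_top hltop hmtop
  have hme : ∀ k : ℕ, Measurable fun t => ENNReal.ofReal ((k : ℝ) ^ β) * ENNReal.ofReal (h t) :=
    fun k => by fun_prop
  have h1 : 2 * l * branchBin meanCost n s ≤ relSqMean (n + 1) s + branchBin relSqMean n s := by
    calc 2 * l * branchBin meanCost n s = branchBin (fun k t => 2 * l * meanCost k t) n s :=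
          (branchBin_const_mul measurable_meanCost _ n s).symm
      _ ≤ branchBin (fun k t => l ^ 2 * (ENNReal.ofReal ((k : ℝ) ^ β) * ENNReal.ofReal (h t)) +
            relSqMean k t) n s :=
          branchBin_mono hs n fun k _ t _ => ennreal_two_mul_le_weighted _ _
            (ENNReal.mul_ne_top ENNReal.ofReal_ne_top ENNReal.ofReal_ne_top)
      _ = l ^ 2 * branchBin (fun k t => ENNReal.ofReal ((k : ℝ) ^ β) * ENNReal.ofReal (h t)) n s +
            branchBin relSqMean n s := by
          rw [branchBin_add fun k => (hme k).const_mul _, branchBin_const_mul hme]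
      _ ≤ l ^ 2 * e + branchBin relSqMean n s := by
          gcongr
          refine (branchBin_rpow_mul_h_le hs n).trans ?_
          rw [he]
          gcongr
          simp
      _ = relSqMean (n + 1) s + branchBin relSqMean n s := by
          rw [hq, ← hle]; ring
  have h2 : l ≤ ENNReal.ofReal (((n : ℝ) + 1) ^ (1 - β)) * (ENNReal.ofReal (h s))⁻¹ := by
    have hn : (0 : ℝ) < ((n + 1 : ℕ) : ℝ) := by positivity
    calc l ≤ ((n + 1 : ℕ) : ℝ≥0∞) * e⁻¹ := by rw [hl]; gcongr; exact meanCost_le _ _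
      _ = ENNReal.ofReal ((n + 1 : ℕ) : ℝ) * (ENNReal.ofReal (((n + 1 : ℕ) : ℝ) ^ β))⁻¹ *
          (ENNReal.ofReal (h s))⁻¹ := by
        rw [he, ENNReal.mul_inv (Or.inr ENNReal.ofReal_ne_top) (Or.inl ENNReal.ofReal_ne_top),
          ENNReal.ofReal_natCast, mul_assoc]
      _ = _ := by
        rw [← ENNReal.ofReal_inv_of_pos (by positivity), ← ENNReal.ofReal_mul hn.le]
        congr 2
        rw [Real.rpow_sub (by positivity), Real.rpow_one]
        push_cast
        rfl
  have h3 : relSqMean (n + 1) s + relSqMean (n + 1) s ≤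
      2 * l + branchBin relSqMean n s + relSqMean (n + 1) s := by
    calc relSqMean (n + 1) s + relSqMean (n + 1) s = 2 * l * (1 + branchBin meanCost n s) := by
          rw [hq, meanCost_succ]; ring
      _ = 2 * l + 2 * l * branchBin meanCost n s := by ring
      _ ≤ 2 * l + (relSqMean (n + 1) s + branchBin relSqMean n s) := by gcongr
      _ = _ := by ring
  refine ((ENNReal.add_le_add_iff_right hqtop).1 h3).trans ?_
  rw [mul_assoc]
  gcongr

/-- The homogeneous part of the recursion for `relSqMean` is the one solved by `homSol`; the source term,
of order `n ^ (1 - β)`, grows more slowly than `√n`, hence than `n ^ β`. -/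
theorem exists_lintegral_relSqMean_le :
    ∃ A : ℝ, 0 < A ∧ ∀ n, ∫⁻ s, relSqMean n s ∂unif ≤ ENNReal.ofReal (A * homSol n) := by
  have hb := β_lt
  have hb' := half_lt_β
  set ι := ProbabilityTheory.beta (1 - β / 2) (1 - β / 2) with hι
  have hι0 : 0 < ι := ProbabilityTheory.beta_pos (by linarith) (by linarith)
  set B := 30 * ι with hB
  have hr : ∀ n, 0 < risingRatio (1 / 2) n := fun n => risingRatio_pos (by norm_num) n
  have hrpow : ∀ n : ℕ, ((n : ℝ) + 1) ^ (1 - β) ≤ risingRatio (1 / 2) (n + 1) := by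
    intro n
    calc ((n : ℝ) + 1) ^ (1 - β) ≤ ((n : ℝ) + 1) ^ (1 / 2 : ℝ) :=
          Real.rpow_le_rpow_of_exponent_le (by linarith [n.cast_nonneg (α := ℝ)]) (by linarith)
      _ = √((n : ℝ) + 1) := (Real.sqrt_eq_rpow _).symm
      _ ≤ risingRatio (1 / 2) n := (Real.sqrt_le_left (hr n).le).2 (sq_risingRatio_half n)
      _ ≤ _ := risingRatio_mono (by norm_num) (Nat.le_succ n)
  -- The source term is absorbed by a multiple of `risingRatio (1 / 2)`, on which the recursion acts
  -- by a factor at least `16 / 15`.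
  have key : ∀ n, ∫⁻ s, relSqMean n s ∂unif + ENNReal.ofReal (B * risingRatio (1 / 2) n) ≤
      ENNReal.ofReal (B * homSol n) := by
    intro n
    induction n using Nat.strong_induction_on with
    | _ n ih =>
      cases n with
      | zero => simp [relSqMean_zero, homSol_zero]
      | succ n =>
        have h1 : ∫⁻ s, relSqMean (n + 1) s ∂unif ≤
            ENNReal.ofReal (2 * ι * risingRatio (1 / 2) (n + 1)) +
              scalarOp (fun k => ∫⁻ s, relSqMean k s ∂unif) n := by
          calc ∫⁻ s, relSqMean (n + 1) s ∂unif ≤ ∫⁻ s,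
                (2 * ENNReal.ofReal (((n : ℝ) + 1) ^ (1 - β)) * (ENNReal.ofReal (h s))⁻¹ +
                  branchBin relSqMean n s) ∂unif := by
                refine lintegral_mono_ae ?_
                filter_upwards [ae_unif_Ioo] with s hs using relSqMean_succ_le hs n
            _ = 2 * ENNReal.ofReal (((n : ℝ) + 1) ^ (1 - β)) * ENNReal.ofReal ι +
                  scalarOp (fun k => ∫⁻ s, relSqMean k s ∂unif) n := by
                have hm : Measurable fun s => (ENNReal.ofReal (h s))⁻¹ := by fun_prop
                rw [lintegral_add_left (hm.const_mul _), lintegral_const_mul _ hm, lintegral_inv_h]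
                simp only [branchBin]
                rw [lintegral_branchOp_bin measurable_relSqMean]
            _ ≤ _ := by
                gcongr
                rw [← ENNReal.ofReal_ofNat, ← ENNReal.ofReal_mul (by norm_num),
                  ← ENNReal.ofReal_mul (by positivity)]
                refine ENNReal.ofReal_le_ofReal ?_
                nlinarith [hrpow n]
        have h2 : ENNReal.ofReal (16 / 15 * B * risingRatio (1 / 2) (n + 1)) ≤
            scalarOp (fun k => ENNReal.ofReal (B * risingRatio (1 / 2) k)) n := by
          have e : ∀ k, ENNReal.ofReal (B * risingRatio (1 / 2) k) =
              ENNReal.ofReal B * ENNReal.ofReal (risingRatio (1 / 2) k) := fun k =>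
            ENNReal.ofReal_mul (by positivity)
          simp only [e]
          rw [scalarOp_const_mul, scalarOp_risingRatio (by norm_num),
            ← ENNReal.ofReal_mul (by positivity)]
          refine ENNReal.ofReal_le_ofReal ?_
          have h3 : (1 : ℝ) ≤ (n + 1 / 2 + 2) / (n + 2) := by
            rw [le_div_iff₀ (by positivity)]; linarith
          have h4 := mul_pos (show 0 < B by positivity) (hr (n + 1))
          norm_num at h3 ⊢
          nlinarith
        calc ∫⁻ s, relSqMean (n + 1) s ∂unif + ENNReal.ofReal (B * risingRatio (1 / 2) (n + 1))
            ≤ ENNReal.ofReal (2 * ι * risingRatio (1 / 2) (n + 1)) +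
              scalarOp (fun k => ∫⁻ s, relSqMean k s ∂unif) n +
              ENNReal.ofReal (B * risingRatio (1 / 2) (n + 1)) := by gcongr
          _ = scalarOp (fun k => ∫⁻ s, relSqMean k s ∂unif) n +
              ENNReal.ofReal (16 / 15 * B * risingRatio (1 / 2) (n + 1)) := by
            have h5 := hr (n + 1)
            rw [add_right_comm, ← ENNReal.ofReal_add (by positivity) (by positivity), add_comm]
            congr 2
            rw [hB]; ring
          _ ≤ scalarOp (fun k => ∫⁻ s, relSqMean k s ∂unif) n +
              scalarOp (fun k => ENNReal.ofReal (B * risingRatio (1 / 2) k)) n := by gcongr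
          _ ≤ scalarOp (fun k => ENNReal.ofReal B * ENNReal.ofReal (homSol k)) n := by
            rw [← scalarOp_add]
            refine scalarOp_mono fun k hk => (ih k (by omega)).trans_eq ?_
            rw [ENNReal.ofReal_mul (by positivity)]
          _ = _ := by
            rw [scalarOp_const_mul, scalarOp_homSol, ← ENNReal.ofReal_mul (by positivity)]
  exact ⟨B, by positivity, fun n => le_self_add.trans (key n)⟩

theorem meanCost_sq_le {s : ℝ} (hs : s ∈ Ioo (0 : ℝ) 1) (n : ℕ) :
    meanCost n s ^ 2 ≤ ENNReal.ofReal ((n : ℝ) ^ β) * relSqMean n s := by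
  rcases Nat.eq_zero_or_pos n with rfl | hn
  · simp
  have hn' : (0 : ℝ) < n := by exact_mod_cast hn
  have hhs := h_pos hs
  set e : ℝ≥0∞ := ENNReal.ofReal ((n : ℝ) ^ β) * ENNReal.ofReal (h s) with he
  have he0 : e ≠ 0 := by
    rw [he, ← ENNReal.ofReal_mul (by positivity)]
    exact (ENNReal.ofReal_pos.2 (by positivity)).ne'
  have hetop : e ≠ ⊤ := ENNReal.mul_ne_top ENNReal.ofReal_ne_top ENNReal.ofReal_ne_top
  have hle : e ≤ ENNReal.ofReal ((n : ℝ) ^ β) := by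
    refine mul_le_of_le_one_right' ?_
    rw [← ENNReal.ofReal_one]
    exact ENNReal.ofReal_le_ofReal (h_le_one (Ioo_subset_Icc_self hs))
  calc meanCost n s ^ 2 = e * (meanCost n s ^ 2 * e⁻¹) := by
        rw [mul_comm e, mul_assoc, ENNReal.inv_mul_cancel he0 hetop, mul_one]
    _ ≤ _ := by rw [relSqMean, ← he]; gcongr

theorem exists_lintegral_meanCost_sq_le :
    ∃ C : ℝ, 0 < C ∧ ∀ n, ∫⁻ s, meanCost n s ^ 2 ∂unif ≤ ENNReal.ofReal (C * risingRatio (2 * β) n) := by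
  have hb := β_pos
  obtain ⟨A, hA, h1⟩ := exists_lintegral_relSqMean_le
  obtain ⟨D, hD, h2⟩ := exists_homSol_le
  obtain ⟨E, hE, h3⟩ := exists_rpow_le_risingRatio (a := 2 * β) (by linarith)
  refine ⟨A * D * E, by positivity, fun n => ?_⟩
  rcases Nat.eq_zero_or_pos n with rfl | hn
  · simp
  calc ∫⁻ s, meanCost n s ^ 2 ∂unif ≤ ∫⁻ s, ENNReal.ofReal ((n : ℝ) ^ β) * relSqMean n s ∂unif := by
        refine lintegral_mono_ae ?_
        filter_upwards [ae_unif_Ioo] with s hs using meanCost_sq_le hs n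
    _ = ENNReal.ofReal ((n : ℝ) ^ β) * ∫⁻ s, relSqMean n s ∂unif :=
        lintegral_const_mul _ (measurable_relSqMean n)
    _ ≤ ENNReal.ofReal ((n : ℝ) ^ β) * ENNReal.ofReal (A * homSol n) := by gcongr; exact h1 n
    _ ≤ _ := by
        rw [← ENNReal.ofReal_mul (by positivity)]
        refine ENNReal.ofReal_le_ofReal ?_
        calc (n : ℝ) ^ β * (A * homSol n) ≤ (n : ℝ) ^ β * (A * (D * (n : ℝ) ^ β)) := by
              gcongr; exact h2 n hn
          _ = A * D * (n : ℝ) ^ (2 * β) := by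
              rw [two_mul, Real.rpow_add (by exact_mod_cast hn)]; ring
          _ ≤ A * D * (E * risingRatio (2 * β) n) := by gcongr; exact h3 n
          _ = _ := by ring

theorem exists_homSol_le_risingRatio :
    ∃ C : ℝ, 0 < C ∧ ∀ n, homSol n ≤ C * risingRatio (2 * β) n := by
  have hb := β_pos
  obtain ⟨D, hD, h2⟩ := exists_homSol_le
  obtain ⟨E, hE, h3⟩ := exists_rpow_le_risingRatio (a := 2 * β) (by linarith)
  refine ⟨1 + D * E, by positivity, fun n => ?_⟩
  have hr := risingRatio_pos (a := 2 * β) (by linarith) n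
  rcases Nat.eq_zero_or_pos n with rfl | hn
  · simp only [homSol_zero, risingRatio_zero]
    nlinarith [mul_pos hD hE]
  have hn' : (1 : ℝ) ≤ n := by exact_mod_cast hn
  calc homSol n ≤ D * (n : ℝ) ^ β := h2 n hn
    _ ≤ D * (n : ℝ) ^ (2 * β) := by
      gcongr
      linarith
    _ ≤ D * (E * risingRatio (2 * β) n) := by gcongr; exact h3 n
    _ ≤ _ := by nlinarith

/-- The second moment of the cost, averaged over the query, is of order `n ^ (2 β)`. -/
theorem exists_lintegral_sqCost_le :
    ∃ C : ℝ, 0 < C ∧ ∀ n, 0 < n → ∫⁻ s, sqCost n s ∂unif ≤ ENNReal.ofReal (C * (n : ℝ) ^ (2 * β)) := by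
  have hb := β_pos
  have hb' := half_lt_β
  obtain ⟨W, hW, h1⟩ := exists_lintegral_meanCost_sq_le
  obtain ⟨D, hD, h2⟩ := exists_homSol_le_risingRatio
  obtain ⟨E, hE, h3⟩ := exists_risingRatio_le (a := 2 * β) (by linarith)
  have hr : ∀ n, 0 < risingRatio (2 * β) n := fun n => risingRatio_pos (by linarith) n
  have hr1 : ∀ n, 1 ≤ risingRatio (2 * β) n := fun n =>
    (risingRatio_zero (2 * β)).symm.le.trans (risingRatio_mono (by linarith) (Nat.zero_le n))
  set ρ : ℝ := 2 / (2 * β + 1) with hρ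
  have hρ1 : ρ < 1 := by rw [hρ, div_lt_one (by linarith)]; linarith
  have hρ0 : 0 < ρ := by positivity
  have h1ρ : 0 < 1 - ρ := by linarith
  -- The recursion acts on `risingRatio (2 β)` by a factor at most `ρ < 1`.
  set K : ℝ := (1 + 2 * D + W) / (1 - ρ) with hK
  have hKpos : 0 < K := by positivity
  have hKeq : K * (1 - ρ) = 1 + 2 * D + W := div_mul_cancel₀ _ h1ρ.ne'
  have hop : ∀ (c : ℝ) (n : ℕ), 0 < c →
      scalarOp (fun k => ENNReal.ofReal (c * risingRatio (2 * β) k)) n ≤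
        ENNReal.ofReal (ρ * c * risingRatio (2 * β) (n + 1)) := by
    intro c n hc
    have e : ∀ k, ENNReal.ofReal (c * risingRatio (2 * β) k) =
        ENNReal.ofReal c * ENNReal.ofReal (risingRatio (2 * β) k) := fun k =>
      ENNReal.ofReal_mul hc.le
    simp only [e]
    rw [scalarOp_const_mul, scalarOp_risingRatio (by linarith), ← ENNReal.ofReal_mul hc.le]
    refine ENNReal.ofReal_le_ofReal ?_
    have h4 : ((n : ℝ) + 2 * β + 2) / (n + 2) ≤ β + 1 := by
      rw [div_le_iff₀ (by positivity)]
      nlinarith [n.cast_nonneg (α := ℝ)]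
    have h5 : 4 / ((2 * β + 1) * (2 * β + 2)) * (β + 1) = ρ := by rw [hρ]; field_simp; ring
    calc c * (4 / ((2 * β + 1) * (2 * β + 2)) * (((n : ℝ) + 2 * β + 2) / (n + 2)) *
        risingRatio (2 * β) (n + 1)) ≤ c * (4 / ((2 * β + 1) * (2 * β + 2)) * (β + 1) *
        risingRatio (2 * β) (n + 1)) := by
          have := hr (n + 1)
          gcongr
      _ = _ := by rw [h5]; ring
  have key : ∀ n, ∫⁻ s, sqCost n s ∂unif ≤ ENNReal.ofReal (K * risingRatio (2 * β) n) := by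
    intro n
    induction n using Nat.strong_induction_on with
    | _ n ih =>
      cases n with
      | zero => simp
      | succ n =>
        set P : ℕ → ℝ≥0∞ := fun k => ∫⁻ s, meanCost k s ∂unif with hP
        have hPn : scalarOp P n ≤ ENNReal.ofReal (homSol (n + 1)) := by
          rw [← scalarOp_homSol]
          refine scalarOp_mono fun k _ => ?_
          rw [← lintegral_meanCost]
          exact le_add_self
        have hmeas : ∀ k, Measurable fun s => 2 * meanCost k s + sqCost k s + meanCost k s ^ 2 :=
          fun k => (((measurable_meanCost k).const_mul 2).add (measurable_sqCost k)).add
            ((measurable_meanCost k).pow_const 2)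
        calc ∫⁻ s, sqCost (n + 1) s ∂unif
            ≤ ∫⁻ s, (1 + branchBin (fun k s => 2 * meanCost k s + sqCost k s + meanCost k s ^ 2)
                n s) ∂unif := lintegral_mono fun s => sqCost_succ_le n s
          _ = 1 + scalarOp (fun k => 2 * P k + ∫⁻ s, sqCost k s ∂unif +
                ∫⁻ s, meanCost k s ^ 2 ∂unif) n := by
              rw [lintegral_add_left measurable_const]
              simp only [branchBin]
              rw [lintegral_branchOp_bin hmeas]
              congr 2
              · simp
              · funext k
                have m1 : Measurable fun s => 2 * meanCost k s := (measurable_meanCost k).const_mul 2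
                have m2 : Measurable fun s => 2 * meanCost k s + sqCost k s :=
                  m1.add (measurable_sqCost k)
                rw [lintegral_add_left m2, lintegral_add_left m1,
                  lintegral_const_mul _ (measurable_meanCost k)]
          _ = 1 + (2 * scalarOp P n + scalarOp (fun k => ∫⁻ s, sqCost k s ∂unif) n +
                scalarOp (fun k => ∫⁻ s, meanCost k s ^ 2 ∂unif) n) := by
              rw [scalarOp_add, scalarOp_add, scalarOp_const_mul]
          _ ≤ ENNReal.ofReal (risingRatio (2 * β) (n + 1)) +
              (ENNReal.ofReal (2 * (D * risingRatio (2 * β) (n + 1))) +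
                ENNReal.ofReal (ρ * K * risingRatio (2 * β) (n + 1)) +
                ENNReal.ofReal (ρ * W * risingRatio (2 * β) (n + 1))) := by
              gcongr
              · rw [← ENNReal.ofReal_one]
                exact ENNReal.ofReal_le_ofReal (hr1 _)
              · rw [ENNReal.ofReal_mul (by norm_num), ENNReal.ofReal_ofNat]
                gcongr
                exact hPn.trans (ENNReal.ofReal_le_ofReal (h2 _))
              · exact (scalarOp_mono fun k hk => ih k (by omega)).trans (hop K n hKpos)
              · exact (scalarOp_mono fun k _ => h1 k).trans (hop W n hW)
          _ ≤ _ := by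
              have h6 := hr (n + 1)
              rw [← ENNReal.ofReal_add (by positivity) (by positivity),
                ← ENNReal.ofReal_add (by positivity) (by positivity),
                ← ENNReal.ofReal_add (by positivity) (by positivity)]
              refine ENNReal.ofReal_le_ofReal ?_
              have h7 : 1 + 2 * D + ρ * K + ρ * W ≤ K := by nlinarith
              nlinarith
  refine ⟨K * E, by positivity, fun n hn => (key n).trans (ENNReal.ofReal_le_ofReal ?_)⟩
  calc K * risingRatio (2 * β) n ≤ K * (E * (n : ℝ) ^ (2 * β)) := by gcongr; exact h3 n hn
    _ = _ := by ring

/-! ### Concentration of binomial averages -/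

theorem bin_sq_sub {a : ℝ} (ha : a ∈ Icc (0 : ℝ) 1) (n : ℕ) (c : ℝ) :
    bin (ENNReal.ofReal a) (ENNReal.ofReal (1 - a)) n (fun i => ENNReal.ofReal (((i : ℝ) - c) ^ 2)) =
      ENNReal.ofReal (n * (a * (1 - a)) + (n * a - c) ^ 2) := by
  have h1 : 0 ≤ 1 - a := by linarith [ha.2]
  have h2 : 0 ≤ a * (1 - a) := mul_nonneg ha.1 h1
  induction n generalizing c with
  | zero => simp [bin]
  | succ n ih =>
    have e : (fun i : ℕ => ENNReal.ofReal ((((i + 1 : ℕ) : ℝ) - c) ^ 2)) =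
        fun i : ℕ => ENNReal.ofReal (((i : ℝ) - (c - 1)) ^ 2) := by
      funext i; congr 2; push_cast; ring
    rw [bin, e, ih, ih, ← ENNReal.ofReal_mul ha.1, ← ENNReal.ofReal_mul h1,
      ← ENNReal.ofReal_add (by have := ha.1; positivity) (by positivity)]
    congr 1
    push_cast
    ring

/-- The frequency of success of `n` trials is within `1 / √(n+1)` of `a` on average. -/
theorem bin_abs_sub_le {a : ℝ} (ha : a ∈ Icc (0 : ℝ) 1) (n : ℕ) :
    bin (ENNReal.ofReal a) (ENNReal.ofReal (1 - a)) n
      (fun i => ENNReal.ofReal |(i : ℝ) / (n + 1) - a|) ≤ ENNReal.ofReal (1 / √((n : ℝ) + 1)) := by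
  have h1 : 0 ≤ 1 - a := by linarith [ha.2]
  have hN : (0 : ℝ) < (n : ℝ) + 1 := by positivity
  set r := √((n : ℝ) + 1) with hr
  have hr0 : 0 < r := Real.sqrt_pos.2 hN
  have hr2 : r ^ 2 = (n : ℝ) + 1 := Real.sq_sqrt hN.le
  have key : ∀ i : ℕ, ENNReal.ofReal |(i : ℝ) / (n + 1) - a| ≤
      ENNReal.ofReal (1 / (2 * r)) + ENNReal.ofReal (1 / (2 * r ^ 3)) *
        ENNReal.ofReal (((i : ℝ) - (n + 1) * a) ^ 2) := by
    intro i
    rw [← ENNReal.ofReal_mul (by positivity), ← ENNReal.ofReal_add (by positivity) (by positivity)]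
    refine ENNReal.ofReal_le_ofReal ?_
    have e : (i : ℝ) - (n + 1) * a = r ^ 2 * ((i : ℝ) / (n + 1) - a) := by
      rw [hr2]; field_simp
    rw [e, ← sq_abs, abs_mul, abs_of_pos (by positivity : 0 < r ^ 2)]
    set d := |(i : ℝ) / (n + 1) - a|
    have e2 : 1 / (2 * r) + 1 / (2 * r ^ 3) * (r ^ 2 * d) ^ 2 - d = (r * d - 1) ^ 2 / (2 * r) := by
      field_simp; ring
    have : 0 ≤ (r * d - 1) ^ 2 / (2 * r) := by positivity
    linarith
  refine (bin_mono _ _ _ key).trans ?_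
  have hac := ofReal_add_one_sub ha
  have h2 : 0 ≤ a * (1 - a) := mul_nonneg ha.1 h1
  rw [bin_add, bin_const hac, bin_const_mul, bin_sq_sub ha, ← ENNReal.ofReal_mul (by positivity),
    ← ENNReal.ofReal_add (by positivity) (by positivity)]
  refine ENNReal.ofReal_le_ofReal ?_
  have h3 : (n : ℝ) * (a * (1 - a)) + (n * a - (n + 1) * a) ^ 2 ≤ r ^ 2 := by
    rw [hr2]
    nlinarith [ha.1, ha.2, n.cast_nonneg (α := ℝ), mul_nonneg (n.cast_nonneg (α := ℝ)) h1,
      mul_nonneg (n.cast_nonneg (α := ℝ)) (mul_nonneg h1 h1), sq_nonneg a]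
  calc 1 / (2 * r) + 1 / (2 * r ^ 3) * ((n : ℝ) * (a * (1 - a)) + (n * a - (n + 1) * a) ^ 2)
      ≤ 1 / (2 * r) + 1 / (2 * r ^ 3) * r ^ 2 := by gcongr
    _ = 1 / r := by field_simp; norm_num

/-! ### The Laplace transforms of the rescaled cost and their limits -/

/-- The Laplace transform at `t` of the cost `Cₙ(s) / (K₁ n ^ β)`. -/
noncomputable def lapCost (n : ℕ) (s t : ℝ) : ℝ≥0∞ :=
  costExp (fun k => ENNReal.ofReal (Real.exp (-(t * (k / (K₁ * (n : ℝ) ^ β)))))) n s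

theorem lapCost_eq_genCost (n : ℕ) (s t : ℝ) :
    lapCost n s t = genCost (ENNReal.ofReal (Real.exp (-(t / (K₁ * (n : ℝ) ^ β))))) n s := by
  unfold lapCost genCost
  congr 1
  funext k
  rw [← ENNReal.ofReal_pow (Real.exp_pos _).le, ← Real.exp_nat_mul]
  congr 2
  ring

theorem lapCost_le_one {t : ℝ} (ht : 0 ≤ t) (n : ℕ) (s : ℝ) : lapCost n s t ≤ 1 := by
  have hK := K₁_pos
  rw [← costExp_const 1 n s]
  refine costExp_mono (fun k => ?_) n s
  rw [← ENNReal.ofReal_one]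
  refine ENNReal.ofReal_le_ofReal (Real.exp_le_one_iff.2 ?_)
  have : 0 ≤ t * (k / (K₁ * (n : ℝ) ^ β)) := by positivity
  linarith

theorem lapCost_zero_right (n : ℕ) (s : ℝ) : lapCost n s 0 = 1 := by
  simp [lapCost, costExp_const]

theorem lapCost_anti (n : ℕ) (s : ℝ) {t t' : ℝ} (htt : t ≤ t') : lapCost n s t' ≤ lapCost n s t := by
  have hK := K₁_pos
  refine costExp_mono (fun k => ENNReal.ofReal_le_ofReal (Real.exp_le_exp.2 ?_)) n s
  have : 0 ≤ (k / (K₁ * (n : ℝ) ^ β)) := by positivity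
  nlinarith

/-- A consequence of convexity: `(1 - lapCost n s t) / t` decreases in `t`. -/
theorem lapCost_convex (n : ℕ) (s t : ℝ) {r : ℝ} (hr : r ∈ Icc (0 : ℝ) 1) :
    lapCost n s (r * t) ≤ ENNReal.ofReal (1 - r) + ENNReal.ofReal r * lapCost n s t := by
  rw [← costExp_const (ENNReal.ofReal (1 - r)) n s]
  unfold lapCost
  rw [← costExp_const_mul, ← costExp_add]
  refine costExp_mono (fun k => ?_) n s
  have h1 : 0 ≤ 1 - r := by linarith [hr.2]
  rw [← ENNReal.ofReal_mul hr.1, ← ENNReal.ofReal_add h1 (mul_nonneg hr.1 (Real.exp_pos _).le)]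
  refine ENNReal.ofReal_le_ofReal ?_
  set x := (k : ℝ) / (K₁ * (n : ℝ) ^ β)
  have := convexOn_exp.2 (mem_univ 0) (mem_univ (-(t * x))) h1 hr.1 (by ring)
  simp only [smul_eq_mul, mul_zero, zero_add, Real.exp_zero, mul_one] at this
  rwa [show -(r * t * x) = r * -(t * x) by ring]

theorem lapCost_rpow_le (n : ℕ) (s : ℝ) {t a b : ℝ} (ht : 0 ≤ t) (hb : 0 ≤ b) (ha : 0 < a)
    (hba : b ≤ a) :
    lapCost n s (b ^ β * t) ≤ lapCost n s (a ^ β * t) + ENNReal.ofReal (1 - b / a) := by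
  have hβ := β_pos
  have hβ1 := β_lt
  have h0 : 0 ≤ b / a := by positivity
  have h1 : b / a ≤ 1 := (div_le_one ha).2 hba
  have h2 : b / a ≤ (b / a) ^ β := by
    calc b / a = (b / a) ^ (1 : ℝ) := (Real.rpow_one _).symm
      _ ≤ _ := Real.rpow_le_rpow_of_exponent_ge' h0 h1 hβ.le (by linarith)
  have h3 : (b / a) * (a ^ β * t) ≤ b ^ β * t := by
    rw [Real.div_rpow hb ha.le, le_div_iff₀ (by positivity)] at h2
    nlinarith
  calc lapCost n s (b ^ β * t) ≤ lapCost n s ((b / a) * (a ^ β * t)) := lapCost_anti n s h3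
    _ ≤ ENNReal.ofReal (1 - b / a) + ENNReal.ofReal (b / a) * lapCost n s (a ^ β * t) :=
      lapCost_convex n s _ ⟨h0, h1⟩
    _ ≤ ENNReal.ofReal (1 - b / a) + 1 * lapCost n s (a ^ β * t) := by
      gcongr
      rw [← ENNReal.ofReal_one]
      exact ENNReal.ofReal_le_ofReal h1
    _ = _ := by rw [one_mul, add_comm]

/-- A modulus of continuity in the scale that does not depend on `n`. -/
theorem lapCost_rpow_modulus (n : ℕ) (s : ℝ) {t a b : ℝ} (ht : 0 ≤ t) (hb : 0 ≤ b) (ha : 0 < a) :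
    lapCost n s (b ^ β * t) ≤ lapCost n s (a ^ β * t) + ENNReal.ofReal (|b - a| / a) ∧
      lapCost n s (a ^ β * t) ≤ lapCost n s (b ^ β * t) + ENNReal.ofReal (|b - a| / a) := by
  have hβ := β_pos
  rcases le_total b a with hba | hba
  · have hmono : b ^ β * t ≤ a ^ β * t := by gcongr
    refine ⟨(lapCost_rpow_le n s ht hb ha hba).trans ?_,
      (lapCost_anti n s hmono).trans le_self_add⟩
    gcongr
    rw [abs_of_nonpos (by linarith)]
    field_simp
    linarith
  · have hmono : a ^ β * t ≤ b ^ β * t := by gcongr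
    refine ⟨(lapCost_anti n s hmono).trans le_self_add,
      (lapCost_rpow_le n s ht ha.le (ha.trans_le hba) hba).trans ?_⟩
    have hb0 := ha.trans_le hba
    gcongr
    rw [abs_of_nonneg (by linarith), le_div_iff₀ ha, sub_mul, one_mul]
    have : a / b * a = a - (b - a) * (a / b) := by field_simp; ring
    have h2 : a / b ≤ 1 := (div_le_one hb0).2 hba
    nlinarith

/-- The limit of the Laplace transforms of the rescaled costs, as a lower limit, so that it is defined
and measurable whether or not they converge. -/
noncomputable def limLap (s t : ℝ) : ℝ≥0∞ := liminf (fun n => lapCost n s t) atTop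

theorem measurable_lapCost (n : ℕ) : Measurable fun q : ℝ × ℝ => lapCost n q.1 q.2 := by
  have e : (fun q : ℝ × ℝ => lapCost n q.1 q.2) = fun q : ℝ × ℝ =>
      ∫⁻ v, ENNReal.ofReal (Real.exp (-(q.2 * ((listCost q.1 (List.ofFn v) : ℕ) /
        (K₁ * (n : ℝ) ^ β))))) ∂(Measure.pi fun _ : Fin n => unifSq) :=
    funext fun q => costExp_eq_lintegral _ n q.1
  rw [e]
  have h1 : Measurable fun x : (ℝ × ℝ) × (Fin n → ℝ × ℝ) =>
      ((listCost x.1.1 (List.ofFn x.2) : ℕ) : ℝ) :=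
    (measurable_of_countable (fun k : ℕ => (k : ℝ))).comp
      ((measurable_listCost n).comp (measurable_fst.fst.prodMk measurable_snd))
  exact Measurable.lintegral_prod_right' (f := fun x : (ℝ × ℝ) × (Fin n → ℝ × ℝ) =>
    ENNReal.ofReal (Real.exp (-(x.1.2 * ((listCost x.1.1 (List.ofFn x.2) : ℕ) /
        (K₁ * (n : ℝ) ^ β)))))) (by fun_prop)

theorem measurable_limLap : Measurable fun q : ℝ × ℝ => limLap q.1 q.2 :=
  Measurable.liminf measurable_lapCost

/-- The Laplace transforms of the rescaled costs converge. -/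
def LapConverges : Prop :=
  ∀ s ∈ Icc (0 : ℝ) 1, ∀ t : ℝ, 0 ≤ t → Tendsto (fun n => lapCost n s t) atTop (𝓝 (limLap s t))

theorem ennreal_mul_le_mul_add {u v u' v' e e' : ℝ≥0∞} (h1 : u ≤ v + e) (h2 : u' ≤ v' + e')
    (hu : u' ≤ 1) (hv : v ≤ 1) : u * u' ≤ v * v' + (e + e') := by
  calc u * u' ≤ (v + e) * u' := by gcongr
    _ = v * u' + e * u' := by ring
    _ ≤ v * (v' + e') + e * 1 := by gcongr
    _ = v * v' + (e + v * e') := by ring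
    _ ≤ v * v' + (e + 1 * e') := by gcongr
    _ = _ := by rw [one_mul]

theorem genCost_eq_lapCost (i n : ℕ) (s t : ℝ) :
    genCost (ENNReal.ofReal (Real.exp (-(t / (K₁ * ((n + 1 : ℕ) : ℝ) ^ β))))) i s =
      lapCost i s (((i : ℝ) / (n + 1)) ^ β * t) := by
  rcases Nat.eq_zero_or_pos i with rfl | hi
  · simp [genCost, lapCost]
  · rw [lapCost_eq_genCost]
    have hi' : (0 : ℝ) < (i : ℝ) ^ β := Real.rpow_pos_of_pos (by exact_mod_cast hi) _
    have hn : (0 : ℝ) < ((n : ℝ) + 1) ^ β := by positivity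
    have hK := K₁_pos
    congr 4
    rw [Real.div_rpow (by positivity) (by positivity)]
    push_cast
    field_simp

namespace LapConverges

/-- On the scale `n`, the transform at size `i` is close to the limit at the proportion `a`, up to an
error that is linear in the distance from `i / (n + 1)` to `a`, uniformly in `i`. -/
theorem exists_modulus (hc : LapConverges) {s t a : ℝ} (hs : s ∈ Icc (0 : ℝ) 1) (ht : 0 ≤ t)
    (ha : 0 < a) {ε : ℝ≥0∞}
    (hε : 0 < ε) :
    ∃ N : ℕ, ∀ n ≥ N, ∀ i : ℕ,
      lapCost i s (((i : ℝ) / (n + 1)) ^ β * t) ≤ limLap s (a ^ β * t) +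
        (ε + ENNReal.ofReal (3 / a) * ENNReal.ofReal |(i : ℝ) / (n + 1) - a|) ∧
      limLap s (a ^ β * t) ≤ lapCost i s (((i : ℝ) / (n + 1)) ^ β * t) +
        (ε + ENNReal.ofReal (3 / a) * ENNReal.ofReal |(i : ℝ) / (n + 1) - a|) := by
  have htau : 0 ≤ a ^ β * t := by positivity
  have hx1 : limLap s (a ^ β * t) ≤ 1 :=
    le_of_tendsto' (hc s hs _ htau) fun n => lapCost_le_one htau n s
  have hlim := (ENNReal.tendsto_nhds (hx1.trans_lt ENNReal.one_lt_top).ne).1 (hc s hs _ htau) ε hε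
  obtain ⟨N₀, hN₀⟩ := eventually_atTop.1 hlim
  obtain ⟨N, hN⟩ := exists_nat_gt (2 * N₀ / a)
  refine ⟨N, fun n hn i => ?_⟩
  set d := |(i : ℝ) / (n + 1) - a| with hd
  have hi0 : (0 : ℝ) ≤ (i : ℝ) / (n + 1) := by positivity
  rw [← ENNReal.ofReal_mul (by positivity)]
  rcases le_or_gt N₀ i with hi | hi
  · obtain ⟨m1, m2⟩ := lapCost_rpow_modulus i s ht hi0 ha
    obtain ⟨l1, l2⟩ := hN₀ i hi
    have hle : ENNReal.ofReal (|(i : ℝ) / (n + 1) - a| / a) ≤ ENNReal.ofReal (3 / a * d) := by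
      refine ENNReal.ofReal_le_ofReal ?_
      rw [← hd, div_mul_eq_mul_div]
      gcongr
      linarith [abs_nonneg ((i : ℝ) / (n + 1) - a)]
    constructor
    · calc _ ≤ _ := m1
        _ ≤ (limLap s (a ^ β * t) + ε) + ENNReal.ofReal (3 / a * d) := by gcongr
        _ = _ := by rw [add_assoc]
    · calc limLap s (a ^ β * t) ≤ lapCost i s (a ^ β * t) + ε := tsub_le_iff_right.1 l1
        _ ≤ lapCost i s (((i : ℝ) / (n + 1)) ^ β * t) + ENNReal.ofReal (3 / a * d) + ε := by
          gcongr; exact m2.trans (by gcongr)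
        _ = _ := by ring
  · -- For the finitely many small `i`, the distance from `i / (n + 1)` to `a` is at least `a / 2`.
    have h1 : (i : ℝ) / (n + 1) ≤ a / 2 := by
      rw [div_lt_iff₀ ha] at hN
      rw [div_le_iff₀ (by positivity)]
      have h2 : (i : ℝ) < N₀ := by exact_mod_cast hi
      have h3 : (N : ℝ) ≤ n := by exact_mod_cast hn
      nlinarith
    have h2 : 1 ≤ 3 / a * d := by
      rw [div_mul_eq_mul_div, le_div_iff₀ ha, hd, abs_of_nonpos (by linarith)]
      linarith
    have h3 : (1 : ℝ≥0∞) ≤ ENNReal.ofReal (3 / a * d) := by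
      rw [← ENNReal.ofReal_one]; exact ENNReal.ofReal_le_ofReal h2
    constructor
    · exact (lapCost_le_one (by positivity) i s).trans (h3.trans (le_add_self.trans le_add_self))
    · exact hx1.trans (h3.trans (le_add_self.trans le_add_self))

theorem limLap_le_one (hc : LapConverges) {s t : ℝ} (hs : s ∈ Icc (0 : ℝ) 1) (ht : 0 ≤ t) :
    limLap s t ≤ 1 :=
  le_of_tendsto' (hc s hs t ht) fun n => lapCost_le_one ht n s

/-- The sizes of the two visited subtrees are close to `n a` and `n b`, by the law of large numbers. -/
theorem tendsto_tri (hc : LapConverges) {s t : ℝ} {a b c : ℝ} (hs : s ∈ Icc (0 : ℝ) 1) (ht : 0 ≤ t)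
    (ha : 0 < a) (hb : 0 < b) (hc0 : 0 ≤ c) (habc : a + b + c = 1) :
    Tendsto (fun n : ℕ => tri (ENNReal.ofReal a) (ENNReal.ofReal b) (ENNReal.ofReal c) n fun i j =>
        lapCost i s (((i : ℝ) / (n + 1)) ^ β * t) * lapCost j s (((j : ℝ) / (n + 1)) ^ β * t)) atTop
      (𝓝 (limLap s (a ^ β * t) * limLap s (b ^ β * t))) := by
  set x := limLap s (a ^ β * t) with hx
  set y := limLap s (b ^ β * t) with hy
  have hx1 : x ≤ 1 := hc.limLap_le_one hs (by positivity)
  have hy1 : y ≤ 1 := hc.limLap_le_one hs (by positivity)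
  have hxy : x * y ≠ ⊤ := ((mul_le_one' hx1 hy1).trans_lt ENNReal.one_lt_top).ne
  have e1 : ENNReal.ofReal a + ENNReal.ofReal b + ENNReal.ofReal c = 1 := by
    rw [← ENNReal.ofReal_add ha.le hb.le, ← ENNReal.ofReal_add (by linarith) hc0, habc,
      ENNReal.ofReal_one]
  have e2 : ENNReal.ofReal b + ENNReal.ofReal c = ENNReal.ofReal (1 - a) := by
    rw [← ENNReal.ofReal_add hb.le hc0]; congr 1; linarith
  have e3 : ENNReal.ofReal a + ENNReal.ofReal c = ENNReal.ofReal (1 - b) := by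
    rw [← ENNReal.ofReal_add ha.le hc0]; congr 1; linarith
  have hamem : a ∈ Icc (0 : ℝ) 1 := ⟨ha.le, by linarith⟩
  have hbmem : b ∈ Icc (0 : ℝ) 1 := ⟨hb.le, by linarith⟩
  rw [ENNReal.tendsto_nhds hxy]
  intro ε hε
  have hε4 : 0 < ε / 4 := ENNReal.div_pos hε.ne' (by norm_num)
  obtain ⟨N₁, hN₁⟩ := hc.exists_modulus hs ht ha hε4
  obtain ⟨N₂, hN₂⟩ := hc.exists_modulus hs ht hb hε4
  have hsmall : ∀ κ : ℝ, ∀ᶠ n : ℕ in atTop,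
      ENNReal.ofReal κ * ENNReal.ofReal (1 / √((n : ℝ) + 1)) ≤ ε / 4 := by
    intro κ
    have h1 : Tendsto (fun n : ℕ => 1 / √((n : ℝ) + 1)) atTop (𝓝 0) := by
      simp only [one_div]
      exact (Real.tendsto_sqrt_atTop.comp
        (tendsto_atTop_add_const_right _ 1 tendsto_natCast_atTop_atTop)).inv_tendsto_atTop
    have h2 := ENNReal.Tendsto.const_mul (a := ENNReal.ofReal κ) (ENNReal.tendsto_ofReal h1)
      (Or.inr ENNReal.ofReal_ne_top)
    rw [ENNReal.ofReal_zero, mul_zero] at h2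
    exact (h2.eventually_lt_const hε4).mono fun n hn => hn.le
  filter_upwards [eventually_ge_atTop N₁, eventually_ge_atTop N₂, hsmall (3 / a), hsmall (3 / b)]
    with n hn1 hn2 hs1 hs2
  set e : ℕ → ℝ≥0∞ := fun i =>
    ε / 4 + ENNReal.ofReal (3 / a) * ENNReal.ofReal |(i : ℝ) / (n + 1) - a| with he
  set e' : ℕ → ℝ≥0∞ := fun i =>
    ε / 4 + ENNReal.ofReal (3 / b) * ENNReal.ofReal |(i : ℝ) / (n + 1) - b| with he'
  have herr : tri (ENNReal.ofReal a) (ENNReal.ofReal b) (ENNReal.ofReal c) n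
      (fun i j => e i + e' j) ≤ ε := by
    rw [tri_add, tri_fst _ _ _ _ e, tri_snd _ _ _ _ e', e2, e3, he, he', bin_add,
      bin_const (ofReal_add_one_sub hamem), bin_const_mul, bin_add,
      bin_const (ofReal_add_one_sub hbmem), bin_const_mul]
    calc _ ≤ ε / 4 + ENNReal.ofReal (3 / a) * ENNReal.ofReal (1 / √((n : ℝ) + 1)) +
          (ε / 4 + ENNReal.ofReal (3 / b) * ENNReal.ofReal (1 / √((n : ℝ) + 1))) := by
          gcongr
          · exact bin_abs_sub_le hamem n
          · exact bin_abs_sub_le hbmem n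
      _ ≤ ε / 4 + ε / 4 + (ε / 4 + ε / 4) := by gcongr
      _ = 4 * (ε / 4) := by ring
      _ = ε := ENNReal.mul_div_cancel (by norm_num) (by norm_num)
  have hg1 : ∀ i : ℕ, lapCost i s (((i : ℝ) / (n + 1)) ^ β * t) ≤ 1 := fun i =>
    lapCost_le_one (by positivity) i s
  constructor
  · rw [tsub_le_iff_right]
    calc x * y = tri (ENNReal.ofReal a) (ENNReal.ofReal b) (ENNReal.ofReal c) n
          (fun _ _ => x * y) := (tri_const e1 n _).symm
      _ ≤ tri (ENNReal.ofReal a) (ENNReal.ofReal b) (ENNReal.ofReal c) n (fun i j =>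
          lapCost i s (((i : ℝ) / (n + 1)) ^ β * t) * lapCost j s (((j : ℝ) / (n + 1)) ^ β * t) +
          (e i + e' j)) := tri_mono _ _ _ _ fun i j =>
            ennreal_mul_le_mul_add (hN₁ n hn1 i).2 (hN₂ n hn2 j).2 hy1 (hg1 i)
      _ ≤ _ := by rw [tri_add]; gcongr
  · calc _ ≤ tri (ENNReal.ofReal a) (ENNReal.ofReal b) (ENNReal.ofReal c) n (fun i j =>
          x * y + (e i + e' j)) := tri_mono _ _ _ _ fun i j =>
            ennreal_mul_le_mul_add (hN₁ n hn1 i).1 (hN₂ n hn2 j).1 (hg1 j) hx1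
      _ ≤ _ := by rw [tri_add, tri_const e1]; gcongr

/-- The functional equation of the limit: given the first point, the two visited subtrees are
independent, and in each of them the cost is a scaled copy of the limit. -/
theorem limLap_fixed (hc : LapConverges) {s t : ℝ} (hs : s ∈ Icc (0 : ℝ) 1) (ht : 0 ≤ t) :
    limLap s t = ∫⁻ p, limLap (sidePos s p.1) ((sideWidth s p.1 * p.2) ^ β * t) *
      limLap (sidePos s p.1) ((sideWidth s p.1 * (1 - p.2)) ^ β * t) ∂unifSq := by
  have hβ := β_pos
  have hK := K₁_pos
  set F : ℕ → ℝ × ℝ → ℝ≥0∞ := fun n p => tri (ENNReal.ofReal (sideWidth s p.1 * p.2))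
      (ENNReal.ofReal (sideWidth s p.1 * (1 - p.2))) (ENNReal.ofReal (1 - sideWidth s p.1)) n
      (fun i j => lapCost i (sidePos s p.1) (((i : ℝ) / (n + 1)) ^ β * t) *
        lapCost j (sidePos s p.1) (((j : ℝ) / (n + 1)) ^ β * t)) with hF
  have hrec : ∀ n, lapCost (n + 1) s t =
      ENNReal.ofReal (Real.exp (-(t / (K₁ * ((n + 1 : ℕ) : ℝ) ^ β)))) * ∫⁻ p, F n p ∂unifSq := by
    intro n
    rw [lapCost_eq_genCost, genCost_succ]
    simp only [genCost_eq_lapCost, hF]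
  have hw : Measurable fun p : ℝ × ℝ => sideWidth s p.1 :=
    Measurable.sideWidth_comp measurable_const measurable_fst
  have hp : Measurable fun p : ℝ × ℝ => sidePos s p.1 :=
    Measurable.sidePos_comp measurable_const measurable_fst
  have hFm : ∀ n, Measurable (F n) := fun n =>
    measurable_tri (by fun_prop) (by fun_prop) (by fun_prop) n fun i j =>
      ((measurable_lapCost i).comp (hp.prodMk measurable_const)).mul
        ((measurable_lapCost j).comp (hp.prodMk measurable_const))
  have hF1 : ∀ n, F n ≤ᵐ[unifSq] fun _ => 1 := by
    intro n
    filter_upwards [ae_unifSq_Ioo] with p hp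
    rw [← tri_const (part_weights (s := s) hp.1 hp.2).2.2 n 1]
    exact tri_mono _ _ _ _ fun i j => mul_le_one' (lapCost_le_one (by positivity) _ _)
      (lapCost_le_one (by positivity) _ _)
  have hlim := tendsto_lintegral_of_dominated_convergence (μ := unifSq) (fun _ => (1 : ℝ≥0∞)) hFm hF1
    (by simp) (f := fun p => limLap (sidePos s p.1) ((sideWidth s p.1 * p.2) ^ β * t) *
      limLap (sidePos s p.1) ((sideWidth s p.1 * (1 - p.2)) ^ β * t)) (by
      filter_upwards [ae_unifSq_Ioo] with p hp
      have hw := sideWidth_mem (s := s) hp.1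
      exact hc.tendsto_tri (sidePos_mem hs hp.1) ht (mul_pos hw.1 hp.2.1)
        (mul_pos hw.1 (by linarith [hp.2.2])) (by linarith [hw.2]) (by ring))
  have hθ : Tendsto (fun n : ℕ => ENNReal.ofReal (Real.exp (-(t / (K₁ * ((n + 1 : ℕ) : ℝ) ^ β)))))
      atTop (𝓝 1) := by
    have h1 : Tendsto (fun n : ℕ => K₁ * ((n + 1 : ℕ) : ℝ) ^ β) atTop atTop :=
      ((tendsto_rpow_atTop hβ).comp
        (tendsto_natCast_atTop_atTop.comp (tendsto_add_atTop_nat 1))).const_mul_atTop hK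
    have h2 := (Real.continuous_exp.tendsto _).comp (h1.const_div_atTop t).neg
    rw [neg_zero, Real.exp_zero] at h2
    rw [← ENNReal.ofReal_one]
    exact ENNReal.tendsto_ofReal h2
  have h3 := ENNReal.Tendsto.mul hθ (Or.inl one_ne_zero) hlim (Or.inr ENNReal.one_ne_top)
  rw [one_mul] at h3
  refine tendsto_nhds_unique ((hc s hs t ht).comp (tendsto_add_atTop_nat 1)) (h3.congr fun n => ?_)
  exact (hrec n).symm

end LapConverges

/-! ### The mean operator and its harmonic functions -/

/-- The operator that sends the mean of a process to the mean of the right-hand side of the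
distributional recursion. -/
noncomputable def meanOp (g : ℝ → ℝ≥0∞) : ℝ → ℝ≥0∞ :=
  branchOp fun z t => ENNReal.ofReal (z ^ β) * g t

theorem measurable_meanOp_integrand {g : ℝ → ℝ≥0∞} (hg : Measurable g) :
    Measurable fun x : ℝ × ℝ => ENNReal.ofReal (x.1 ^ β) * g x.2 := by fun_prop

theorem measurable_meanOp {g : ℝ → ℝ≥0∞} (hg : Measurable g) : Measurable (meanOp g) :=
  measurable_branchOp (measurable_meanOp_integrand hg)

theorem lintegral_one_sub_mul_rpow {a : ℝ} (ha : 0 < a) :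
    ∫⁻ z, ENNReal.ofReal (1 - z) * ENNReal.ofReal (z ^ a) ∂unif =
      ENNReal.ofReal (1 / ((a + 1) * (a + 2))) := by
  have h1 := lintegral_unif_beta (a := a + 1) (b := 2) (by linarith) (by norm_num)
  have h2 : ProbabilityTheory.beta (a + 1) 2 = 1 / ((a + 1) * (a + 2)) := by
    have := Real.Gamma_pos_of_pos (s := a + 1) (by linarith)
    rw [ProbabilityTheory.beta, Real.Gamma_two, show a + 1 + 2 = a + 1 + 1 + 1 by ring,
      Real.Gamma_add_one (s := a + 1 + 1) (by linarith), Real.Gamma_add_one (s := a + 1) (by linarith)]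
    field_simp
    ring
  rw [← h2, ← h1]
  refine lintegral_congr_ae ?_
  filter_upwards [ae_unif_mem] with z hz
  have : 0 ≤ 1 - z := by linarith [hz.2]
  rw [← ENNReal.ofReal_mul this, add_sub_cancel_right, show (2 : ℝ) - 1 = 1 by norm_num,
    Real.rpow_one, mul_comm]

theorem lintegral_meanOp {g : ℝ → ℝ≥0∞} (hg : Measurable g) :
    ∫⁻ s, meanOp g s ∂unif = ∫⁻ s, g s ∂unif := by
  have hb := β_pos
  have h1 : ∀ z, ∫⁻ s, ENNReal.ofReal (z ^ β) * g s ∂unif =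
      ENNReal.ofReal (z ^ β) * ∫⁻ s, g s ∂unif := fun z => lintegral_const_mul _ hg
  unfold meanOp
  rw [lintegral_branchOp (measurable_meanOp_integrand hg)]
  simp only [h1, ← mul_assoc]
  rw [lintegral_mul_const _ (by fun_prop), lintegral_one_sub_mul_rpow hb, β_add_one_mul, ← mul_assoc,
    ← ENNReal.ofReal_ofNat, ← ENNReal.ofReal_mul (by norm_num)]
  norm_num

theorem meanOp_h {s : ℝ} (hs : s ∈ Ioo (0 : ℝ) 1) :
    meanOp (fun t => ENNReal.ofReal (h t)) s = ENNReal.ofReal (h s) := branchOp_rpow_mul_h hs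

theorem meanOp_eq {g : ℝ → ℝ≥0∞} (hg : Measurable g) (s : ℝ) :
    meanOp g s = 2 * (ENNReal.ofReal (1 / (β + 1)) *
      ∫⁻ x, ENNReal.ofReal (sideWidth s x ^ β) * g (sidePos s x) ∂unif) := by
  have hb := β_pos
  rw [meanOp, branchOp_eq (measurable_meanOp_integrand hg), ← lintegral_const_mul' _ _
    ENNReal.ofReal_ne_top]
  congr 1
  refine lintegral_congr_ae ?_
  filter_upwards [ae_unif_Ioo] with x hx
  have hw := (sideWidth_mem (s := s) hx).1
  rw [lintegral_mul_const _ (by fun_prop), ← lintegral_unif_rpow hb, ← mul_assoc,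
    ← lintegral_mul_const' _ _ ENNReal.ofReal_ne_top]
  congr 1
  refine lintegral_congr_ae ?_
  filter_upwards [ae_unif_Ioo] with y hy
  rw [Real.mul_rpow hw.le hy.1.le, ENNReal.ofReal_mul (by positivity), mul_comm]

theorem meanOp_add {f : ℝ → ℝ≥0∞} (hf : Measurable f) {g : ℝ → ℝ≥0∞} (hg : Measurable g) (s : ℝ) :
    meanOp (fun t => f t + g t) s = meanOp f s + meanOp g s := by
  have hm : Measurable fun x => ENNReal.ofReal (sideWidth s x ^ β) * f (sidePos s x) := by
    have hw : Measurable fun x => sideWidth s x :=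
      Measurable.sideWidth_comp measurable_const measurable_id
    have hp : Measurable fun x => sidePos s x :=
      Measurable.sidePos_comp measurable_const measurable_id
    fun_prop
  have hfg : Measurable fun t => f t + g t := hf.add hg
  rw [meanOp_eq hfg, meanOp_eq hf, meanOp_eq hg, ← mul_add, ← mul_add]
  simp only [mul_add]
  rw [lintegral_add_left hm, mul_add, mul_add]

theorem meanOp_mono {f g : ℝ → ℝ≥0∞} (hfg : ∀ t, f t ≤ g t) (s : ℝ) : meanOp f s ≤ meanOp g s := by
  refine lintegral_mono fun p => ?_
  dsimp only
  gcongr <;> exact hfg _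

/-- A function dominated by its image is harmonic almost everywhere, since `meanOp` preserves
integrals. -/
theorem meanOp_ae_eq_of_le {g : ℝ → ℝ≥0∞} (hg : Measurable g) (hfin : ∫⁻ s, g s ∂unif ≠ ⊤)
    (hle : ∀ᵐ s ∂unif, g s ≤ meanOp g s) : g =ᵐ[unif] meanOp g :=
  ae_eq_of_ae_le_of_lintegral_le hle hfin (measurable_meanOp hg).aemeasurable (lintegral_meanOp hg).le

theorem meanOp_ae_eq_of_ge {g : ℝ → ℝ≥0∞} (hg : Measurable g) (hfin : ∫⁻ s, g s ∂unif ≠ ⊤)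
    (hle : ∀ᵐ s ∂unif, meanOp g s ≤ g s) : meanOp g =ᵐ[unif] g :=
  ae_eq_of_ae_le_of_lintegral_le hle ((lintegral_meanOp hg).trans_ne hfin) hg.aemeasurable
    (lintegral_meanOp hg).ge

/-- A nonzero harmonic function is positive almost everywhere: its zero set `A` satisfies
`x r ∉ A` and `x + (1 - x) r ∉ A` for almost every `x`, for some (indeed almost every) `r` outside
of `A`. -/
theorem ae_pos_of_harmonic {g : ℝ → ℝ≥0∞} (hg : Measurable g) (hharm : meanOp g =ᵐ[unif] g)
    (hne : ∫⁻ s, g s ∂unif ≠ 0) : ∀ᵐ s ∂unif, g s ≠ 0 := by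
  have hb := β_pos
  set A : Set ℝ := {s | g s = 0} with hA
  have hAm : MeasurableSet A := hg (measurableSet_singleton 0)
  set K : ℝ → ℝ → ℝ≥0∞ := fun s x =>
    A.indicator (fun _ => 1) s * (ENNReal.ofReal (sideWidth s x ^ β) * g (sidePos s x)) with hK
  have hind : Measurable (A.indicator fun _ => (1 : ℝ≥0∞)) := measurable_const.indicator hAm
  have hKm : Measurable fun q : ℝ × ℝ => K q.1 q.2 := by
    have hw : Measurable fun q : ℝ × ℝ => sideWidth q.1 q.2 := measurable_sideWidth
    have hp : Measurable fun q : ℝ × ℝ => sidePos q.1 q.2 := measurable_sidePos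
    fun_prop
  have h1 : ∫⁻ s, ∫⁻ x, K s x ∂unif ∂unif = 0 := by
    rw [lintegral_eq_zero_iff hKm.lintegral_prod_right']
    filter_upwards [hharm] with s hs
    by_cases hsA : s ∈ A
    · have h0 : g s = 0 := hsA
      rw [h0, meanOp_eq hg] at hs
      have hc : ENNReal.ofReal (1 / (β + 1)) ≠ 0 := (ENNReal.ofReal_pos.2 (by positivity)).ne'
      have h2 : ∫⁻ x, ENNReal.ofReal (sideWidth s x ^ β) * g (sidePos s x) ∂unif = 0 := by
        simpa only [mul_eq_zero, hc, OfNat.ofNat_ne_zero, false_or] using hs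
      simpa [hK, hsA] using h2
    · simp [hK, hsA]
  rw [lintegral_lintegral_swap hKm.aemeasurable, lintegral_eq_zero_iff hKm.lintegral_prod_left'] at h1
  have h2 : ∀ᵐ x ∂unif, ∀ᵐ r ∂unif, (x * r ∉ A ∧ x + (1 - x) * r ∉ A) ∨ g r = 0 := by
    filter_upwards [h1, ae_unif_Ioo] with x hx hx01
    have hx0 := hx01.1
    have hx1 : 0 < 1 - x := by linarith [hx01.2]
    have hx' : ∫⁻ s, K s x ∂unif = 0 := hx
    have hsplit := lintegral_add_compl (μ := unif) (fun s => K s x) (measurableSet_Iio (a := x))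
    rw [compl_Iio, setLIntegral_unif_Iio hx01, setLIntegral_unif_Ici hx01, hx', add_eq_zero,
      mul_eq_zero, mul_eq_zero] at hsplit
    have hKx : Measurable fun s => K s x := hKm.comp (measurable_id.prodMk measurable_const)
    have e1 : ∫⁻ r, K (x * r) x ∂unif = 0 :=
      hsplit.1.resolve_left (ENNReal.ofReal_pos.2 hx0).ne'
    have e2 : ∫⁻ r, K (x + (1 - x) * r) x ∂unif = 0 :=
      hsplit.2.resolve_left (ENNReal.ofReal_pos.2 hx1).ne'
    have m1 : Measurable fun r => K (x * r) x := hKx.comp (by fun_prop)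
    have m2 : Measurable fun r => K (x + (1 - x) * r) x := hKx.comp (by fun_prop)
    rw [lintegral_eq_zero_iff m1] at e1
    rw [lintegral_eq_zero_iff m2] at e2
    filter_upwards [e1, e2, ae_unif_Ioo] with r h1 h2 hr
    by_cases hgr : g r = 0
    · exact Or.inr hgr
    · left
      constructor
      · intro hmem
        have hlt : x * r < x := by nlinarith [hr.2]
        have hpos : x * r / x = r := by field_simp
        have := ENNReal.ofReal_pos.2 (Real.rpow_pos_of_pos hx0 β)
        simp only [hK, Pi.zero_apply, hmem, indicator_of_mem, one_mul, sideWidth, sidePos, if_pos hlt,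
          hpos, mul_eq_zero, hgr, or_false] at h1
        exact this.ne' h1
      · intro hmem
        have hlt : ¬ x + (1 - x) * r < x := by nlinarith [hr.1]
        have hpos : (x + (1 - x) * r - x) / (1 - x) = r := by field_simp; ring
        have := ENNReal.ofReal_pos.2 (Real.rpow_pos_of_pos hx1 β)
        simp only [hK, Pi.zero_apply, hmem, indicator_of_mem, one_mul, sideWidth, sidePos, if_neg hlt,
          hpos, mul_eq_zero, hgr, or_false] at h2
        exact this.ne' h2
  have hset : MeasurableSet {q : ℝ × ℝ | (q.1 * q.2 ∉ A ∧ q.1 + (1 - q.1) * q.2 ∉ A) ∨ g q.2 = 0} := by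
    have m1 : MeasurableSet {q : ℝ × ℝ | q.1 * q.2 ∈ A} :=
      (show Measurable fun q : ℝ × ℝ => q.1 * q.2 by fun_prop) hAm
    have m2 : MeasurableSet {q : ℝ × ℝ | q.1 + (1 - q.1) * q.2 ∈ A} :=
      (show Measurable fun q : ℝ × ℝ => q.1 + (1 - q.1) * q.2 by fun_prop) hAm
    have m3 : MeasurableSet {q : ℝ × ℝ | q.2 ∈ A} := measurable_snd hAm
    exact (m1.compl.inter m2.compl).union m3
  have h3 : ∀ᵐ r ∂unif, ∀ᵐ x ∂unif, (x * r ∉ A ∧ x + (1 - x) * r ∉ A) ∨ g r = 0 :=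
    (Measure.ae_ae_comm hset).1 h2
  -- Choose `r` in the open interval with `g r ≠ 0`.
  obtain ⟨r, hr, hgr, hr01⟩ : ∃ r, (∀ᵐ x ∂unif, (x * r ∉ A ∧ x + (1 - x) * r ∉ A) ∨ g r = 0) ∧
      g r ≠ 0 ∧ r ∈ Ioo (0 : ℝ) 1 := by
    by_contra hcon
    push Not at hcon
    refine hne ((lintegral_eq_zero_iff hg).2 ?_)
    filter_upwards [h3, ae_unif_Ioo] with r h4 h5
    by_contra h6
    exact hcon r h4 h6 h5
  have hr' : ∀ᵐ x ∂unif, x * r ∉ A ∧ x + (1 - x) * r ∉ A := by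
    filter_upwards [hr] with x hx using hx.resolve_right hgr
  have hA0 : ∫⁻ s, A.indicator (fun _ => 1) s ∂unif = 0 := by
    rw [← lintegral_add_compl _ (measurableSet_Iio (a := r)), compl_Iio, setLIntegral_unif_Iio hr01,
      setLIntegral_unif_Ici hr01]
    have m1 : Measurable fun x => A.indicator (fun _ => (1 : ℝ≥0∞)) (r * x) :=
      hind.comp (by fun_prop)
    have m2 : Measurable fun x => A.indicator (fun _ => (1 : ℝ≥0∞)) (r + (1 - r) * x) :=
      hind.comp (by fun_prop)
    have e1 : ∫⁻ x, A.indicator (fun _ => (1 : ℝ≥0∞)) (r * x) ∂unif = 0 := by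
      rw [lintegral_eq_zero_iff m1]
      filter_upwards [hr'] with x hx
      have : r * x ∉ A := by rw [mul_comm]; exact hx.1
      simp [this]
    have e2 : ∫⁻ x, A.indicator (fun _ => (1 : ℝ≥0∞)) (r + (1 - r) * x) ∂unif = 0 := by
      rw [lintegral_eq_zero_iff m2]
      filter_upwards [hr'] with x hx
      have : r + (1 - r) * x ∉ A := by
        rw [show r + (1 - r) * x = x + (1 - x) * r by ring]; exact hx.2
      simp [this]
    rw [e1, e2]; simp
  rw [lintegral_eq_zero_iff hind] at hA0
  filter_upwards [hA0] with s hs hgs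
  have : s ∈ A := hgs
  simp [this] at hs

/-- Up to a factor, `h` is the only harmonic function. -/
theorem ae_eq_h_of_harmonic {m : ℝ → ℝ≥0∞} (hm : Measurable m) (hharm : meanOp m =ᵐ[unif] m)
    (hint : ∫⁻ s, m s ∂unif = ∫⁻ s, ENNReal.ofReal (h s) ∂unif) :
    m =ᵐ[unif] fun s => ENNReal.ofReal (h s) := by
  set g : ℝ → ℝ≥0∞ := fun s => ENNReal.ofReal (h s) with hg
  have hgm : Measurable g := by fun_prop
  have hgfin : ∫⁻ s, g s ∂unif ≠ ⊤ := by rw [hg, lintegral_h]; exact ENNReal.ofReal_ne_top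
  have hmfin : ∫⁻ s, m s ∂unif ≠ ⊤ := hint ▸ hgfin
  have hgharm : meanOp g =ᵐ[unif] g := by
    filter_upwards [ae_unif_Ioo] with s hs using meanOp_h hs
  -- The minimum of two harmonic functions is harmonic, hence so are the two excesses over it.
  set v : ℝ → ℝ≥0∞ := fun s => min (m s) (g s) with hv
  have hvm : Measurable v := hm.min hgm
  have hvfin : ∫⁻ s, v s ∂unif ≠ ⊤ :=
    ((lintegral_mono fun s => min_le_right _ _).trans_lt hgfin.lt_top).ne
  have hvharm : meanOp v =ᵐ[unif] v := by
    refine meanOp_ae_eq_of_ge hvm hvfin ?_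
    filter_upwards [hharm, hgharm] with s h1 h2
    exact le_min (h1 ▸ meanOp_mono (fun t => min_le_left _ _) s)
      (h2 ▸ meanOp_mono (fun t => min_le_right _ _) s)
  have hexc : ∀ f : ℝ → ℝ≥0∞, Measurable f → meanOp f =ᵐ[unif] f → (∀ s, v s ≤ f s) →
      meanOp (fun s => f s - v s) =ᵐ[unif] fun s => f s - v s := by
    intro f hf hfh hvf
    have hu : Measurable fun s => f s - v s := hf.sub hvm
    have hsum : (fun s => v s + (f s - v s)) = f := funext fun s => add_tsub_cancel_of_le (hvf s)
    filter_upwards [hfh, hvharm, ae_lt_top hvm hvfin] with s h1 h2 h3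
    have h4 := meanOp_add hvm hu s
    rw [hsum, h1, h2] at h4
    rw [h4]
    exact (ENNReal.add_sub_cancel_left h3.ne).symm
  have h1 := hexc m hm hharm fun s => min_le_left _ _
  have h2 := hexc g hgm hgharm fun s => min_le_right _ _
  by_cases h0 : ∫⁻ s, (m s - v s) ∂unif = 0
  · have hle : m ≤ᵐ[unif] g := by
      filter_upwards [(lintegral_eq_zero_iff (hm.sub hvm)).1 h0] with s hs
      exact (tsub_eq_zero_iff_le.1 hs).trans (min_le_right _ _)
    exact ae_eq_of_ae_le_of_lintegral_le hle hmfin hgm.aemeasurable hint.ge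
  · have hle : g ≤ᵐ[unif] m := by
      filter_upwards [ae_pos_of_harmonic (hm.sub hvm) h1 h0] with s hs
      have : v s < m s := by
        by_contra hcon
        exact hs (tsub_eq_zero_of_le (not_lt.1 hcon))
      rcases min_lt_iff.1 this with h3 | h3
      · exact absurd h3 (lt_irrefl _)
      · exact h3.le
    exact (ae_eq_of_ae_le_of_lintegral_le hle hgfin hm.aemeasurable hint.le).symm

/-! ### The mean of the limit -/

theorem one_le_lapCost_add {t : ℝ} (ht : 0 ≤ t) (n : ℕ) (s : ℝ) :
    1 ≤ lapCost n s t + ENNReal.ofReal (t / (K₁ * (n : ℝ) ^ β)) * meanCost n s := by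
  have hK := K₁_pos
  rw [← costExp_const 1 n s]
  unfold lapCost meanCost
  rw [← costExp_const_mul, ← costExp_add]
  refine costExp_mono (fun k => ?_) n s
  rw [← ENNReal.ofReal_natCast, ← ENNReal.ofReal_mul (by positivity),
    ← ENNReal.ofReal_add (Real.exp_pos _).le (by positivity), ← ENNReal.ofReal_one]
  refine ENNReal.ofReal_le_ofReal ?_
  have h1 := Real.add_one_le_exp (-(t * (k / (K₁ * (n : ℝ) ^ β))))
  have h2 : t / (K₁ * (n : ℝ) ^ β) * k = t * (k / (K₁ * (n : ℝ) ^ β)) := by ring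
  linarith

theorem exp_neg_le_quadratic {x : ℝ} (hx : 0 ≤ x) : Real.exp (-x) ≤ 1 - x + x ^ 2 / 2 := by
  have h1 := Real.quadratic_le_exp_of_nonneg hx
  rw [Real.exp_neg]
  refine (inv_anti₀ (by positivity) h1).trans ?_
  rw [inv_le_iff_one_le_mul₀ (by positivity)]
  nlinarith [pow_nonneg hx 4]

theorem lapCost_add_le {t : ℝ} (ht : 0 ≤ t) (n : ℕ) (s : ℝ) :
    lapCost n s t + ENNReal.ofReal (t / (K₁ * (n : ℝ) ^ β)) * meanCost n s ≤
      1 + ENNReal.ofReal ((t / (K₁ * (n : ℝ) ^ β)) ^ 2 / 2) * sqCost n s := by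
  have hK := K₁_pos
  rw [← costExp_const 1 n s]
  unfold lapCost meanCost sqCost
  rw [← costExp_const_mul, ← costExp_const_mul, ← costExp_add, ← costExp_add]
  refine costExp_mono (fun k => ?_) n s
  rw [← ENNReal.ofReal_natCast, ← ENNReal.ofReal_mul (by positivity),
    ← ENNReal.ofReal_add (Real.exp_pos _).le (by positivity), ← ENNReal.ofReal_one,
    ← ENNReal.ofReal_pow (by positivity), ← ENNReal.ofReal_mul (by positivity),
    ← ENNReal.ofReal_add (by positivity) (by positivity)]
  refine ENNReal.ofReal_le_ofReal ?_
  have h1 := exp_neg_le_quadratic (x := t * (k / (K₁ * (n : ℝ) ^ β))) (by positivity)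
  have h2 : t / (K₁ * (n : ℝ) ^ β) * k = t * (k / (K₁ * (n : ℝ) ^ β)) := by ring
  have h3 : (t / (K₁ * (n : ℝ) ^ β)) ^ 2 / 2 * (k : ℝ) ^ 2 =
    (t * (k / (K₁ * (n : ℝ) ^ β))) ^ 2 / 2 := by ring
  linarith

theorem lintegral_meanCost_eq (n : ℕ) :
    ∫⁻ s, meanCost n s ∂unif = ENNReal.ofReal (homSol n - 1) := by
  have h1 := lintegral_meanCost n
  have h2 : 1 ≤ homSol n := by
    rw [← ENNReal.ofReal_le_ofReal_iff (homSol_pos n).le, ← h1, ENNReal.ofReal_one]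
    exact le_self_add
  rw [ENNReal.ofReal_sub _ zero_le_one, ← h1, ENNReal.ofReal_one,
    ENNReal.add_sub_cancel_left ENNReal.one_ne_top]

theorem tendsto_lintegral_meanCost {t : ℝ} (ht : 0 ≤ t) :
    Tendsto (fun n : ℕ => ENNReal.ofReal (t / (K₁ * (n : ℝ) ^ β)) * ∫⁻ s, meanCost n s ∂unif) atTop
      (𝓝 (ENNReal.ofReal (t * (meanConst / K₁)))) := by
  have hK := K₁_pos
  have h0 : Tendsto (fun n : ℕ => 1 / (n : ℝ) ^ β) atTop (𝓝 0) :=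
    ((tendsto_rpow_atTop β_pos).comp tendsto_natCast_atTop_atTop).const_div_atTop 1
  have h1 : Tendsto (fun n : ℕ => t / K₁ * (homSol n / (n : ℝ) ^ β - 1 / (n : ℝ) ^ β)) atTop
      (𝓝 (t / K₁ * (meanConst - 0))) := (tendsto_homSol.sub h0).const_mul _
  have e : t / K₁ * (meanConst - 0) = t * (meanConst / K₁) := by ring
  rw [e] at h1
  refine (ENNReal.tendsto_ofReal h1).congr fun n => ?_
  rw [lintegral_meanCost_eq, ← ENNReal.ofReal_mul (by positivity)]
  congr 1
  rw [← sub_div, div_mul_div_comm, div_mul_eq_mul_div]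

namespace LapConverges

theorem limLap_zero {s : ℝ} : limLap s 0 = 1 := by
  simp [limLap, lapCost_zero_right]

theorem limLap_convex (hc : LapConverges) {s t r : ℝ} (hs : s ∈ Icc (0 : ℝ) 1) (ht : 0 ≤ t)
    (hr : r ∈ Icc (0 : ℝ) 1) :
    limLap s (r * t) ≤ ENNReal.ofReal (1 - r) + ENNReal.ofReal r * limLap s t :=
  le_of_tendsto_of_tendsto' (hc s hs _ (mul_nonneg hr.1 ht))
    (tendsto_const_nhds.add
      (ENNReal.Tendsto.const_mul (hc s hs t ht) (Or.inr ENNReal.ofReal_ne_top)))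
    fun n => lapCost_convex n s t hr

theorem mul_one_sub_limLap_le (hc : LapConverges) {s t r : ℝ} (hs : s ∈ Icc (0 : ℝ) 1) (ht : 0 ≤ t)
    (hr : r ∈ Icc (0 : ℝ) 1) :
    ENNReal.ofReal r * (1 - limLap s t) ≤ 1 - limLap s (r * t) := by
  have h1 := hc.limLap_le_one hs (mul_nonneg hr.1 ht)
  refine ENNReal.le_sub_of_add_le_left (h1.trans_lt ENNReal.one_lt_top).ne ?_
  calc limLap s (r * t) + ENNReal.ofReal r * (1 - limLap s t)
      ≤ ENNReal.ofReal (1 - r) + ENNReal.ofReal r * limLap s t +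
        ENNReal.ofReal r * (1 - limLap s t) := by gcongr; exact hc.limLap_convex hs ht hr
    _ = ENNReal.ofReal (1 - r) + ENNReal.ofReal r * (limLap s t + (1 - limLap s t)) := by ring
    _ = 1 := by
      rw [add_tsub_cancel_of_le (hc.limLap_le_one hs ht), mul_one, add_comm, ofReal_add_one_sub hr]

theorem measurable_limLap_comp {α : Type*} [MeasurableSpace α] {f g : α → ℝ} (hf : Measurable f)
    (hg : Measurable g) : Measurable fun a => limLap (f a) (g a) := by
  have hfg : Measurable fun a => (f a, g a) := hf.prodMk hg
  have hcomp := measurable_limLap.comp hfg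
  exact hcomp

theorem measurable_limLap_left (t : ℝ) : Measurable fun s => limLap s t :=
  measurable_limLap_comp measurable_id measurable_const

theorem tendsto_lintegral_lapCost (hc : LapConverges) {t : ℝ} (ht : 0 ≤ t) :
    Tendsto (fun n => ∫⁻ s, lapCost n s t ∂unif) atTop (𝓝 (∫⁻ s, limLap s t ∂unif)) := by
  refine tendsto_lintegral_of_dominated_convergence (fun _ => 1)
    (fun n => (measurable_lapCost n).comp (measurable_id.prodMk measurable_const))
    (fun n => Eventually.of_forall fun s => lapCost_le_one ht n s) (by simp) ?_
  filter_upwards [ae_unif_mem] with s hs using hc s hs t ht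

theorem one_le_lintegral_limLap_add (hc : LapConverges) {t : ℝ} (ht : 0 ≤ t) :
    1 ≤ ∫⁻ s, limLap s t ∂unif + ENNReal.ofReal (t * (meanConst / K₁)) := by
  refine ge_of_tendsto' ((hc.tendsto_lintegral_lapCost ht).add (tendsto_lintegral_meanCost ht))
    fun n => ?_
  rw [← lintegral_const_mul _ (measurable_meanCost n), ← lintegral_add_right _
    ((measurable_meanCost n).const_mul _)]
  calc (1 : ℝ≥0∞) = ∫⁻ _s, 1 ∂unif := by simp
    _ ≤ _ := lintegral_mono fun s => one_le_lapCost_add ht n s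

theorem exists_lintegral_limLap_add_le (hc : LapConverges) :
    ∃ C : ℝ, 0 ≤ C ∧ ∀ t : ℝ, 0 ≤ t → ∫⁻ s, limLap s t ∂unif + ENNReal.ofReal (t * (meanConst / K₁)) ≤
      1 + ENNReal.ofReal (C * t ^ 2) := by
  have hK := K₁_pos
  obtain ⟨C, hC, h1⟩ := exists_lintegral_sqCost_le
  refine ⟨C / (2 * K₁ ^ 2), by positivity, fun t ht => ?_⟩
  refine le_of_tendsto ((hc.tendsto_lintegral_lapCost ht).add (tendsto_lintegral_meanCost ht)) ?_
  filter_upwards [eventually_gt_atTop 0] with n hn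
  rw [← lintegral_const_mul _ (measurable_meanCost n), ← lintegral_add_right _
    ((measurable_meanCost n).const_mul _)]
  refine (lintegral_mono fun s => lapCost_add_le ht n s).trans ?_
  rw [lintegral_add_left measurable_const, lintegral_const_mul _ (measurable_sqCost n)]
  have hn' : (0 : ℝ) < n := by exact_mod_cast hn
  have hnβ : 0 < (n : ℝ) ^ β := by positivity
  calc _ ≤ ∫⁻ _s, 1 ∂unif + ENNReal.ofReal ((t / (K₁ * (n : ℝ) ^ β)) ^ 2 / 2) *
        ENNReal.ofReal (C * (n : ℝ) ^ (2 * β)) := by gcongr; exact h1 n hn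
    _ = _ := by
      rw [← ENNReal.ofReal_mul (by positivity), two_mul β, Real.rpow_add hn']
      simp only [lintegral_const, measure_univ, mul_one]
      congr 2
      field_simp

/-- The mean of the limit, as the derivative at `0` of the Laplace transform. -/
noncomputable def limMean (s : ℝ) : ℝ≥0∞ :=
  ⨆ k : ℕ, ENNReal.ofReal ((k : ℝ) + 1) * (1 - limLap s (1 / ((k : ℝ) + 1)))

theorem measurable_limMean : Measurable limMean :=
  Measurable.iSup fun _ => ((measurable_limLap_left _).const_sub _).const_mul _

theorem one_sub_limLap_le (hc : LapConverges) {s t : ℝ} (hs : s ∈ Icc (0 : ℝ) 1) (ht : 0 ≤ t) :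
    1 - limLap s t ≤ ENNReal.ofReal t * limMean s := by
  rcases ht.eq_or_lt with rfl | ht0
  · simp [limLap_zero]
  obtain ⟨k, hk⟩ := exists_nat_one_div_lt ht0
  have hk0 : (0 : ℝ) < (k : ℝ) + 1 := by positivity
  have hr : 1 / ((k : ℝ) + 1) / t ∈ Icc (0 : ℝ) 1 := ⟨by positivity, (div_le_one ht0).2 hk.le⟩
  have h1 := hc.mul_one_sub_limLap_le hs ht hr
  rw [div_mul_cancel₀ _ ht0.ne'] at h1
  calc 1 - limLap s t = ENNReal.ofReal t * (ENNReal.ofReal ((k : ℝ) + 1) *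
        (ENNReal.ofReal (1 / ((k : ℝ) + 1) / t) * (1 - limLap s t))) := by
        rw [← mul_assoc, ← mul_assoc, ← ENNReal.ofReal_mul ht, ← ENNReal.ofReal_mul (by positivity)]
        have : t * ((k : ℝ) + 1) * (1 / ((k : ℝ) + 1) / t) = 1 := by field_simp
        rw [this, ENNReal.ofReal_one, one_mul]
    _ ≤ ENNReal.ofReal t * (ENNReal.ofReal ((k : ℝ) + 1) * (1 - limLap s (1 / ((k : ℝ) + 1)))) := by
        gcongr
    _ ≤ _ := by
        gcongr
        exact le_iSup (fun k : ℕ => ENNReal.ofReal ((k : ℝ) + 1) *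
          (1 - limLap s (1 / ((k : ℝ) + 1)))) k

theorem limMean_seq_mono (hc : LapConverges) {s : ℝ} (hs : s ∈ Icc (0 : ℝ) 1) :
    Monotone fun k : ℕ => ENNReal.ofReal ((k : ℝ) + 1) * (1 - limLap s (1 / ((k : ℝ) + 1))) := by
  intro k l hkl
  have hkl' : (k : ℝ) ≤ l := by exact_mod_cast hkl
  have hk0 : (0 : ℝ) < (k : ℝ) + 1 := by positivity
  have hl0 : (0 : ℝ) < (l : ℝ) + 1 := by positivity
  have hr : ((k : ℝ) + 1) / ((l : ℝ) + 1) ∈ Icc (0 : ℝ) 1 :=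
    ⟨by positivity, (div_le_one hl0).2 (by linarith)⟩
  have h1 := hc.mul_one_sub_limLap_le hs (t := 1 / ((k : ℝ) + 1)) (by positivity) hr
  have e : ((k : ℝ) + 1) / ((l : ℝ) + 1) * (1 / ((k : ℝ) + 1)) = 1 / ((l : ℝ) + 1) := by field_simp
  rw [e] at h1
  calc ENNReal.ofReal ((k : ℝ) + 1) * (1 - limLap s (1 / ((k : ℝ) + 1)))
      = ENNReal.ofReal ((l : ℝ) + 1) * (ENNReal.ofReal (((k : ℝ) + 1) / ((l : ℝ) + 1)) *
        (1 - limLap s (1 / ((k : ℝ) + 1)))) := by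
        rw [← mul_assoc, ← ENNReal.ofReal_mul hl0.le, mul_div_cancel₀ _ hl0.ne']
    _ ≤ _ := mul_le_mul_right h1 _

theorem one_sub_mul_le {u v : ℝ≥0∞} (hu : u ≤ 1) (hv : v ≤ 1) : 1 - u * v ≤ (1 - u) + (1 - v) := by
  rw [tsub_le_iff_left]
  refine (one_mul (1 : ℝ≥0∞)).ge.trans
    (ennreal_mul_le_mul_add (e := 1 - u) (e' := 1 - v) ?_ ?_ le_rfl hu)
  · exact (add_tsub_cancel_of_le hu).ge
  · exact (add_tsub_cancel_of_le hv).ge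

/-- The derivative at `0` of the functional equation, as an inequality: `1 - u v ≤ (1 - u) + (1 - v)`. -/
theorem limMean_le_meanOp (hc : LapConverges) {s : ℝ} (hs : s ∈ Ioo (0 : ℝ) 1) :
    limMean s ≤ meanOp limMean s := by
  have hβ := β_pos
  refine iSup_le fun k => ?_
  have hk0 : (0 : ℝ) < (k : ℝ) + 1 := by positivity
  set t : ℝ := 1 / ((k : ℝ) + 1) with ht
  have ht0 : 0 < t := by positivity
  have hw : Measurable fun p : ℝ × ℝ => sideWidth s p.1 :=
    Measurable.sideWidth_comp measurable_const measurable_fst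
  have hp : Measurable fun p : ℝ × ℝ => sidePos s p.1 :=
    Measurable.sidePos_comp measurable_const measurable_fst
  set G : ℝ × ℝ → ℝ≥0∞ := fun p => limLap (sidePos s p.1) ((sideWidth s p.1 * p.2) ^ β * t) *
      limLap (sidePos s p.1) ((sideWidth s p.1 * (1 - p.2)) ^ β * t) with hG
  have hGm : Measurable G :=
    (measurable_limLap_comp hp (by fun_prop)).mul (measurable_limLap_comp hp (by fun_prop))
  have h1 : 1 - limLap s t ≤ ∫⁻ p, (1 - G p) ∂unifSq := by
    rw [tsub_le_iff_left, hc.limLap_fixed (Ioo_subset_Icc_self hs) ht0.le, ← lintegral_add_left hGm]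
    calc (1 : ℝ≥0∞) = ∫⁻ _p, 1 ∂unifSq := by simp
      _ ≤ _ := lintegral_mono fun p => le_add_tsub
  calc ENNReal.ofReal ((k : ℝ) + 1) * (1 - limLap s t)
      ≤ ENNReal.ofReal ((k : ℝ) + 1) * ∫⁻ p, (1 - G p) ∂unifSq := by gcongr
    _ = ∫⁻ p, ENNReal.ofReal ((k : ℝ) + 1) * (1 - G p) ∂unifSq :=
        (lintegral_const_mul' _ _ ENNReal.ofReal_ne_top).symm
    _ ≤ meanOp limMean s := by
        refine lintegral_mono_ae ?_
        filter_upwards [ae_unifSq_Ioo] with p hp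
        have hw := sideWidth_mem (s := s) hp.1
        have hpos := sidePos_mem (Ioo_subset_Icc_self hs) hp.1
        have hy : 0 < 1 - p.2 := by linarith [hp.2.2]
        have ha : 0 < sideWidth s p.1 * p.2 := mul_pos hw.1 hp.2.1
        have hb : 0 < sideWidth s p.1 * (1 - p.2) := mul_pos hw.1 hy
        have key : ∀ a : ℝ, 0 < a → ENNReal.ofReal ((k : ℝ) + 1) *
            (1 - limLap (sidePos s p.1) (a ^ β * t)) ≤
            ENNReal.ofReal (a ^ β) * limMean (sidePos s p.1) := by
          intro a ha
          refine (mul_le_mul_right (hc.one_sub_limLap_le hpos (by positivity)) _).trans_eq ?_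
          rw [← mul_assoc, ← ENNReal.ofReal_mul hk0.le]
          congr 2
          rw [ht]; field_simp
        calc ENNReal.ofReal ((k : ℝ) + 1) * (1 - G p) ≤ ENNReal.ofReal ((k : ℝ) + 1) *
            ((1 - limLap (sidePos s p.1) ((sideWidth s p.1 * p.2) ^ β * t)) +
              (1 - limLap (sidePos s p.1) ((sideWidth s p.1 * (1 - p.2)) ^ β * t))) := by
              gcongr
              exact one_sub_mul_le (hc.limLap_le_one hpos (by positivity))
                (hc.limLap_le_one hpos (by positivity))
          _ ≤ _ := by
              rw [mul_add]
              exact add_le_add (key _ ha) (key _ hb)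

theorem lintegral_one_sub_limLap (hc : LapConverges) {t : ℝ} (ht : 0 ≤ t) :
    ∫⁻ s, (1 - limLap s t) ∂unif + ∫⁻ s, limLap s t ∂unif = 1 := by
  rw [← lintegral_add_right _ (measurable_limLap_left t)]
  calc ∫⁻ s, (1 - limLap s t + limLap s t) ∂unif = ∫⁻ _s, 1 ∂unif := by
        refine lintegral_congr_ae ?_
        filter_upwards [ae_unif_mem] with s hs
        exact tsub_add_cancel_of_le (hc.limLap_le_one hs ht)
    _ = 1 := by simp

theorem lintegral_limLap_ne_top (hc : LapConverges) {t : ℝ} (ht : 0 ≤ t) :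
    ∫⁻ s, limLap s t ∂unif ≠ ⊤ := by
  intro h
  have := hc.lintegral_one_sub_limLap ht
  rw [h, add_top] at this
  exact ENNReal.top_ne_one this

/-- The bound of order `t ^ 2` for the remainder shows that no mass of the mean is lost in the limit. -/
theorem lintegral_limMean (hc : LapConverges) :
    ∫⁻ s, limMean s ∂unif = ENNReal.ofReal (meanConst / K₁) := by
  refine le_antisymm ?_ ?_
  · have h1 : ∫⁻ s, limMean s ∂unif = ⨆ k : ℕ, ∫⁻ s, ENNReal.ofReal ((k : ℝ) + 1) *
        (1 - limLap s (1 / ((k : ℝ) + 1))) ∂unif := by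
      refine lintegral_iSup' (fun k =>
        (((measurable_limLap_left _).const_sub _).const_mul _).aemeasurable) ?_
      filter_upwards [ae_unif_mem] with s hs using hc.limMean_seq_mono hs
    rw [h1]
    refine iSup_le fun k => ?_
    have hk0 : (0 : ℝ) < (k : ℝ) + 1 := by positivity
    set t : ℝ := 1 / ((k : ℝ) + 1) with ht
    have ht0 : 0 ≤ t := by positivity
    rw [lintegral_const_mul' _ _ ENNReal.ofReal_ne_top]
    have h2 : ∫⁻ s, (1 - limLap s t) ∂unif ≤ ENNReal.ofReal (t * (meanConst / K₁)) := by
      have h3 := hc.one_le_lintegral_limLap_add ht0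
      rw [← hc.lintegral_one_sub_limLap ht0, add_comm] at h3
      exact (ENNReal.add_le_add_iff_left (hc.lintegral_limLap_ne_top ht0)).1 h3
    calc _ ≤ ENNReal.ofReal ((k : ℝ) + 1) * ENNReal.ofReal (t * (meanConst / K₁)) := by gcongr
      _ = _ := by
        rw [← ENNReal.ofReal_mul hk0.le, ← mul_assoc, ht, mul_one_div_cancel hk0.ne', one_mul]
  · obtain ⟨C, hC, h1⟩ := hc.exists_lintegral_limLap_add_le
    have h2 : ∀ k : ℕ, ENNReal.ofReal (meanConst / K₁) ≤
        ∫⁻ s, limMean s ∂unif + ENNReal.ofReal (C * (1 / ((k : ℝ) + 1))) := by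
      intro k
      have hk0 : (0 : ℝ) < (k : ℝ) + 1 := by positivity
      set t : ℝ := 1 / ((k : ℝ) + 1) with ht
      have ht0 : 0 < t := by positivity
      have h3 := h1 t ht0.le
      rw [← hc.lintegral_one_sub_limLap ht0.le, add_comm (∫⁻ s, (1 - limLap s t) ∂unif), add_assoc] at h3
      have h4 := (ENNReal.add_le_add_iff_left (hc.lintegral_limLap_ne_top ht0.le)).1 h3
      have h5 : ∫⁻ s, (1 - limLap s t) ∂unif ≤ ENNReal.ofReal t * ∫⁻ s, limMean s ∂unif := by
        rw [← lintegral_const_mul' _ _ ENNReal.ofReal_ne_top]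
        refine lintegral_mono_ae ?_
        filter_upwards [ae_unif_mem] with s hs using hc.one_sub_limLap_le hs ht0.le
      have h6 : ENNReal.ofReal t * ENNReal.ofReal (meanConst / K₁) ≤
          ENNReal.ofReal t * (∫⁻ s, limMean s ∂unif + ENNReal.ofReal (C * t)) := by
        rw [← ENNReal.ofReal_mul ht0.le, mul_add, ← ENNReal.ofReal_mul ht0.le]
        refine h4.trans (add_le_add h5 (le_of_eq ?_))
        congr 1; ring
      exact (ENNReal.mul_le_mul_iff_right (ENNReal.ofReal_pos.2 ht0).ne' ENNReal.ofReal_ne_top).1 h6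
    have h3 : Tendsto (fun k : ℕ => ∫⁻ s, limMean s ∂unif + ENNReal.ofReal (C * (1 / ((k : ℝ) + 1))))
        atTop (𝓝 (∫⁻ s, limMean s ∂unif + ENNReal.ofReal (C * 0))) :=
      tendsto_const_nhds.add
        (ENNReal.tendsto_ofReal (tendsto_one_div_add_atTop_nhds_zero_nat.const_mul C))
    rw [mul_zero, ENNReal.ofReal_zero, add_zero] at h3
    exact ge_of_tendsto' h3 h2

theorem limMean_ae_eq (hc : LapConverges) : limMean =ᵐ[unif] fun s => ENNReal.ofReal (h s) := by
  have hfin : ∫⁻ s, limMean s ∂unif ≠ ⊤ := by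
    rw [hc.lintegral_limMean]; exact ENNReal.ofReal_ne_top
  refine ae_eq_h_of_harmonic measurable_limMean (meanOp_ae_eq_of_le measurable_limMean hfin ?_).symm
    (by rw [hc.lintegral_limMean, lintegral_h])
  filter_upwards [ae_unif_Ioo] with s hs using hc.limMean_le_meanOp hs

theorem one_le_limLap_add (hc : LapConverges) {t : ℝ} (ht : 0 ≤ t) :
    ∀ᵐ s ∂unif, 1 ≤ limLap s t + ENNReal.ofReal (t * h s) := by
  filter_upwards [hc.limMean_ae_eq, ae_unif_mem] with s h1 hs
  have h2 := hc.one_sub_limLap_le hs ht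
  rw [h1, ← ENNReal.ofReal_mul ht] at h2
  exact tsub_le_iff_left.1 h2

end LapConverges

/-! ### Uniqueness of the solution of the functional equation -/

/-- The properties that determine the family of the Laplace transforms `A s` of the limits: the
functional equation, and a first order expansion at `0` with the mean `h`. -/
structure IsLaplaceSolution (A : ℝ → ℝ → ℝ≥0∞) : Prop where
  measurable : Measurable fun q : ℝ × ℝ => A q.1 q.2
  le_one : ∀ s ∈ Icc (0 : ℝ) 1, ∀ t, 0 ≤ t → A s t ≤ 1
  fixed : ∀ s ∈ Ioo (0 : ℝ) 1, ∀ t, 0 ≤ t → A s t =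
    ∫⁻ p, A (sidePos s p.1) ((sideWidth s p.1 * p.2) ^ β * t) *
      A (sidePos s p.1) ((sideWidth s p.1 * (1 - p.2)) ^ β * t) ∂unifSq
  one_le : ∀ t, 0 ≤ t → ∀ᵐ s ∂unif, 1 ≤ A s t + ENNReal.ofReal (t * h s)
  exists_le : ∃ C : ℝ, 0 ≤ C ∧ ∀ t, 0 ≤ t →
    ∫⁻ s, A s t ∂unif + ENNReal.ofReal (t * (meanConst / K₁)) ≤ 1 + ENNReal.ofReal (C * t ^ 2)

theorem LapConverges.isLaplaceSolution (hc : LapConverges) : IsLaplaceSolution limLap where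
  measurable := measurable_limLap
  le_one _ hs _ ht := hc.limLap_le_one hs ht
  fixed _ hs _ ht := hc.limLap_fixed (Ioo_subset_Icc_self hs) ht
  one_le _ ht := hc.one_le_limLap_add ht
  exists_le := hc.exists_lintegral_limLap_add_le

namespace IsLaplaceSolution

variable {A B : ℝ → ℝ → ℝ≥0∞}

theorem measurable_left (hA : IsLaplaceSolution A) (t : ℝ) : Measurable fun s => A s t :=
  hA.measurable.comp (measurable_id.prodMk measurable_const)

theorem exists_lintegral_sub_le (hA : IsLaplaceSolution A) (hB : IsLaplaceSolution B) :
    ∃ C : ℝ, 0 ≤ C ∧ ∀ t, 0 ≤ t → ∫⁻ s, (A s t - B s t) ∂unif ≤ ENNReal.ofReal (C * t ^ 2) := by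
  obtain ⟨C, hC, h1⟩ := hA.exists_le
  refine ⟨C, hC, fun t ht => ?_⟩
  have hh : Measurable fun s => ENNReal.ofReal (t * h s) := by fun_prop
  have h2 : ∫⁻ s, (A s t - B s t) ∂unif ≤
      ∫⁻ s, (A s t + ENNReal.ofReal (t * h s) - 1) ∂unif := by
    refine lintegral_mono_ae ?_
    filter_upwards [hA.one_le t ht, hB.one_le t ht] with s hs1 hs2
    rw [tsub_le_iff_right]
    refine (ENNReal.add_le_add_iff_right (ENNReal.ofReal_ne_top (r := t * h s))).1 ?_
    calc A s t + ENNReal.ofReal (t * h s) = (A s t + ENNReal.ofReal (t * h s) - 1) + 1 :=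
          (tsub_add_cancel_of_le hs1).symm
      _ ≤ (A s t + ENNReal.ofReal (t * h s) - 1) + (B s t + ENNReal.ofReal (t * h s)) := by gcongr
      _ = _ := by rw [add_assoc]
  refine h2.trans ((ENNReal.add_le_add_iff_right ENNReal.one_ne_top).1 ?_)
  calc ∫⁻ s, (A s t + ENNReal.ofReal (t * h s) - 1) ∂unif + 1
      = ∫⁻ s, (A s t + ENNReal.ofReal (t * h s) - 1 + 1) ∂unif := by
        rw [lintegral_add_right _ measurable_const]; simp
    _ = ∫⁻ s, (A s t + ENNReal.ofReal (t * h s)) ∂unif := by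
        refine lintegral_congr_ae ?_
        filter_upwards [hA.one_le t ht] with s hs using tsub_add_cancel_of_le hs
    _ = ∫⁻ s, A s t ∂unif + ENNReal.ofReal (t * (meanConst / K₁)) := by
        rw [lintegral_add_right _ hh, ENNReal.ofReal_mul ht, ← lintegral_h,
          ← lintegral_const_mul' _ _ ENNReal.ofReal_ne_top]
        simp only [ENNReal.ofReal_mul ht]
    _ ≤ _ := (h1 t ht).trans_eq (add_comm _ _)

theorem lintegral_sub_le (hA : IsLaplaceSolution A) (hB : IsLaplaceSolution B) {t : ℝ} (ht : 0 ≤ t) :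
    ∫⁻ s, (A s t - B s t) ∂unif ≤
      4 * ∫⁻ z, ENNReal.ofReal (1 - z) * ∫⁻ s, (A s (z ^ β * t) - B s (z ^ β * t)) ∂unif ∂unif := by
  have hm : Measurable fun x : ℝ × ℝ => A x.2 (x.1 ^ β * t) - B x.2 (x.1 ^ β * t) := by
    have h1 : Measurable fun x : ℝ × ℝ => x.1 ^ β * t := by fun_prop
    exact (hA.measurable.comp (measurable_snd.prodMk h1)).sub
      (hB.measurable.comp (measurable_snd.prodMk h1))
  rw [← lintegral_branchOp (F := fun z s => A s (z ^ β * t) - B s (z ^ β * t)) hm]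
  refine lintegral_mono_ae ?_
  filter_upwards [ae_unif_Ioo] with s hs
  have hw : Measurable fun p : ℝ × ℝ => sideWidth s p.1 :=
    Measurable.sideWidth_comp measurable_const measurable_fst
  have hp : Measurable fun p : ℝ × ℝ => sidePos s p.1 :=
    Measurable.sidePos_comp measurable_const measurable_fst
  have hBm : Measurable fun p : ℝ × ℝ => B (sidePos s p.1) ((sideWidth s p.1 * p.2) ^ β * t) *
      B (sidePos s p.1) ((sideWidth s p.1 * (1 - p.2)) ^ β * t) :=
    (hB.measurable.comp (hp.prodMk (by fun_prop))).mul
      (hB.measurable.comp (hp.prodMk (by fun_prop)))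
  rw [tsub_le_iff_left, hA.fixed s hs t ht, hB.fixed s hs t ht, branchOp, ← lintegral_add_left hBm]
  refine lintegral_mono_ae ?_
  filter_upwards [ae_unifSq_Ioo] with p hp
  have hpos := sidePos_mem (Ioo_subset_Icc_self hs) hp.1
  have hw := sideWidth_mem (s := s) hp.1
  have h1 : 0 ≤ sideWidth s p.1 * p.2 := mul_nonneg hw.1.le hp.2.1.le
  have h2 : 0 ≤ sideWidth s p.1 * (1 - p.2) := mul_nonneg hw.1.le (by linarith [hp.2.2])
  exact ennreal_mul_le_mul_add le_add_tsub le_add_tsub (hA.le_one _ hpos _ (by positivity))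
    (hB.le_one _ hpos _ (by positivity))

/-- On differences of order `t ^ 2`, averaged over `s`, the functional equation is a contraction with
factor `4 / ((2 β + 1) (2 β + 2)) < 1`. -/
theorem ae_le (hA : IsLaplaceSolution A) (hB : IsLaplaceSolution B) {t : ℝ} (ht : 0 ≤ t) :
    ∀ᵐ s ∂unif, A s t ≤ B s t := by
  have hβ := half_lt_β
  obtain ⟨C, hC, h1⟩ := exists_lintegral_sub_le hA hB
  set ρ : ℝ := 4 / ((2 * β + 1) * (2 * β + 2)) with hρ
  have hρ0 : 0 ≤ ρ := by positivity
  have hρ1 : ρ < 1 := by rw [hρ, div_lt_one (by positivity)]; nlinarith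
  have key : ∀ (k : ℕ) (t : ℝ), 0 ≤ t →
      ∫⁻ s, (A s t - B s t) ∂unif ≤ ENNReal.ofReal (ρ ^ k * (C * t ^ 2)) := by
    intro k
    induction k with
    | zero => intro t ht; simpa using h1 t ht
    | succ k ih =>
      intro t ht
      refine (lintegral_sub_le hA hB ht).trans ?_
      have hle : ∫⁻ z, ENNReal.ofReal (1 - z) *
          ∫⁻ s, (A s (z ^ β * t) - B s (z ^ β * t)) ∂unif ∂unif ≤
          ∫⁻ z, ENNReal.ofReal (ρ ^ k * (C * t ^ 2)) *
            (ENNReal.ofReal (1 - z) * ENNReal.ofReal (z ^ (2 * β))) ∂unif := by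
        refine lintegral_mono_ae ?_
        filter_upwards [ae_unif_mem] with z hz
        have hz0 := hz.1
        have h2 : (z ^ β * t) ^ 2 = z ^ (2 * β) * t ^ 2 := by
          rw [mul_pow, two_mul, Real.rpow_add_of_nonneg hz0 (by linarith) (by linarith)]; ring
        calc _ ≤ ENNReal.ofReal (1 - z) * ENNReal.ofReal (ρ ^ k * (C * (z ^ β * t) ^ 2)) := by
              gcongr
              exact ih _ (by positivity)
          _ = _ := by
              rw [h2, show ρ ^ k * (C * (z ^ (2 * β) * t ^ 2)) =
                ρ ^ k * (C * t ^ 2) * z ^ (2 * β) by ring, ENNReal.ofReal_mul (by positivity)]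
              ring
      calc _ ≤ 4 * ∫⁻ z, ENNReal.ofReal (ρ ^ k * (C * t ^ 2)) *
            (ENNReal.ofReal (1 - z) * ENNReal.ofReal (z ^ (2 * β))) ∂unif := by gcongr
        _ = _ := by
            rw [lintegral_const_mul' _ _ ENNReal.ofReal_ne_top,
              lintegral_one_sub_mul_rpow (by linarith), ← ENNReal.ofReal_mul (by positivity),
              ← ENNReal.ofReal_ofNat, ← ENNReal.ofReal_mul (by norm_num)]
            congr 1
            rw [hρ]; ring
  have h2 : Tendsto (fun k : ℕ => ENNReal.ofReal (ρ ^ k * (C * t ^ 2))) atTop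
      (𝓝 (ENNReal.ofReal (0 * (C * t ^ 2)))) :=
    ENNReal.tendsto_ofReal ((tendsto_pow_atTop_nhds_zero_of_lt_one hρ0 hρ1).mul_const _)
  rw [zero_mul, ENNReal.ofReal_zero] at h2
  have h3 : ∫⁻ s, (A s t - B s t) ∂unif = 0 :=
    le_antisymm (ge_of_tendsto' h2 fun k => key k t ht) bot_le
  have hm : Measurable fun s => A s t - B s t := (hA.measurable_left t).sub (hB.measurable_left t)
  rw [lintegral_eq_zero_iff hm] at h3
  filter_upwards [h3] with s hs using tsub_eq_zero_iff_le.1 hs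

theorem ae_eq (hA : IsLaplaceSolution A) (hB : IsLaplaceSolution B) {t : ℝ} (ht : 0 ≤ t) :
    ∀ᵐ s ∂unif, A s t = B s t := by
  filter_upwards [hA.ae_le hB ht, hB.ae_le hA ht] with s h1 h2 using le_antisymm h1 h2

end IsLaplaceSolution

/-! ### Laplace transforms of laws on the half-line -/

/-- The Laplace transform of a law on the half-line. -/
noncomputable def lapLaw (ψ : Measure ℝ) (τ : ℝ) : ℝ≥0∞ := ∫⁻ x, ENNReal.ofReal (Real.exp (-(τ * x))) ∂ψ

theorem measurable_lapLaw (ψ : Measure ℝ) [IsProbabilityMeasure ψ] : Measurable (lapLaw ψ) :=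
  Measurable.lintegral_prod_right' (f := fun q : ℝ × ℝ => ENNReal.ofReal (Real.exp (-(q.1 * q.2))))
    (by fun_prop)

theorem lapLaw_le_one {ψ : Measure ℝ} [IsProbabilityMeasure ψ] (hψ : ∀ᵐ x ∂ψ, 0 ≤ x) {τ : ℝ}
    (hτ : 0 ≤ τ) : lapLaw ψ τ ≤ 1 := by
  calc lapLaw ψ τ ≤ ∫⁻ _x, 1 ∂ψ := by
        refine lintegral_mono_ae ?_
        filter_upwards [hψ] with x hx
        rw [← ENNReal.ofReal_one]
        refine ENNReal.ofReal_le_ofReal (Real.exp_le_one_iff.2 ?_)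
        have := mul_nonneg hτ hx
        linarith
    _ = 1 := by simp

/-- A law on the half-line is determined by its Laplace transform: the image of the law under
`x ↦ exp (-x)` is carried by `[0,1]`, where it is determined by its moments. -/
theorem ext_of_lapLaw {μ ν : Measure ℝ} [IsProbabilityMeasure μ] [IsProbabilityMeasure ν]
    (hμ : ∀ᵐ x ∂μ, 0 ≤ x) (hν : ∀ᵐ x ∂ν, 0 ≤ x) (hl : ∀ n : ℕ, lapLaw μ n = lapLaw ν n) : μ = ν := by
  have hem : Measurable fun x : ℝ => Real.exp (-x) := by fun_prop
  have hemb : MeasurableEmbedding fun x : ℝ => Real.exp (-x) :=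
    (Continuous.measurableEmbedding (by fun_prop)
      (fun x y hxy => neg_injective (Real.exp_injective hxy)))
  set e : ℝ → ℝ := fun x => Real.exp (-x) with he
  have : IsProbabilityMeasure (μ.map e) := Measure.isProbabilityMeasure_map hem.aemeasurable
  have : IsProbabilityMeasure (ν.map e) := Measure.isProbabilityMeasure_map hem.aemeasurable
  have hbound : ∀ κ : Measure ℝ, (∀ᵐ x ∂κ, 0 ≤ x) → ∀ᵐ y ∂(κ.map e), y ∈ Icc (0 : ℝ) 1 := by
    intro κ hκ
    refine (ae_map_iff hem.aemeasurable (p := (· ∈ Icc (0 : ℝ) 1)) measurableSet_Icc).2 ?_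
    filter_upwards [hκ] with x hx
    exact ⟨(Real.exp_pos _).le, Real.exp_le_one_iff.2 (by linarith)⟩
  have hpow : ∀ n : ℕ, ∫ y, y ^ n ∂(μ.map e) = ∫ y, y ^ n ∂(ν.map e) := by
    have key : ∀ (κ : Measure ℝ) (n : ℕ), ∫ y, y ^ n ∂(κ.map e) = (lapLaw κ n).toReal := by
      intro κ n
      rw [hemb.integral_map, integral_eq_lintegral_of_nonneg_ae
        (Eventually.of_forall fun x => by positivity) (by fun_prop), lapLaw]
      congr 2
      funext x
      rw [he, ← Real.exp_nat_mul]
      congr 2; ring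
    intro n
    rw [key, key, hl]
  have hint : ∀ (κ : Measure ℝ) [IsProbabilityMeasure κ], (∀ᵐ y ∂κ, y ∈ Icc (0 : ℝ) 1) →
      ∀ f : ℝ → ℝ, Continuous f → Integrable f κ := by
    intro κ _ hκ f hf
    obtain ⟨C, hC⟩ := isCompact_Icc.exists_bound_of_continuousOn (s := Icc (0 : ℝ) 1) hf.continuousOn
    refine Integrable.of_bound hf.aestronglyMeasurable C ?_
    filter_upwards [hκ] with y hy using hC y hy
  have hpoly : ∀ p : Polynomial ℝ, ∫ y, p.eval y ∂(μ.map e) = ∫ y, p.eval y ∂(ν.map e) := by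
    intro p
    simp only [Polynomial.eval_eq_sum_range]
    rw [integral_finsetSum _ fun i _ => (hint _ (hbound μ hμ) _ (by fun_prop)),
      integral_finsetSum _ fun i _ => (hint _ (hbound ν hν) _ (by fun_prop))]
    refine Finset.sum_congr rfl fun i _ => ?_
    rw [integral_const_mul, integral_const_mul, hpow]
  have hmap : μ.map e = ν.map e := by
    refine ext_of_forall_integral_eq_of_IsFiniteMeasure fun f => ?_
    refine eq_of_abs_sub_le_all fun ε hε => ?_
    obtain ⟨p, hp⟩ := exists_polynomial_near_of_continuousOn 0 1 f f.continuous.continuousOn (ε / 2)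
      (by positivity)
    have hclose : ∀ (κ : Measure ℝ) [IsProbabilityMeasure κ], (∀ᵐ y ∂κ, y ∈ Icc (0 : ℝ) 1) →
        |∫ y, p.eval y ∂κ - ∫ y, f y ∂κ| ≤ ε / 2 := by
      intro κ _ hκ
      rw [← integral_sub (hint κ hκ _ (by fun_prop)) (hint κ hκ _ f.continuous)]
      have := norm_integral_le_of_norm_le_const (μ := κ) (f := fun y => p.eval y - f y) (C := ε / 2) (by
        filter_upwards [hκ] with y hy using (hp y hy).le)
      simpa using this
    have h1 := hclose _ (hbound μ hμ)
    have h2 := hclose _ (hbound ν hν)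
    rw [hpoly p] at h1
    rw [abs_le] at *
    constructor <;> linarith [h1.1, h1.2, h2.1, h2.2]
  have h3 := congrArg (Measure.comap e) hmap
  rwa [hemb.comap_map, hemb.comap_map] at h3

/-! ### The solution given by the one-dimensional fixed-point equation -/

theorem lapLaw_fixedPointMap (ψ : Measure ℝ) [IsProbabilityMeasure ψ] (τ : ℝ) :
    lapLaw (fixedPointMap ψ) τ =
      ∫⁻ u, ∫⁻ v, lapLaw ψ (τ * u ^ (β / 2) * v ^ β) * lapLaw ψ (τ * u ^ (β / 2) * (1 - v) ^ β)
        ∂unif ∂unif := by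
  have hml := measurable_lapLaw ψ
  have e : ∀ x : ℝ × ℝ, ∫⁻ y : ℝ × ℝ,
      ENNReal.ofReal (Real.exp (-(τ * (coefL x * y.1 + coefR x * y.2)))) ∂(ψ.prod ψ) =
      lapLaw ψ (τ * coefL x) * lapLaw ψ (τ * coefR x) := by
    intro x
    rw [lapLaw, lapLaw, ← lintegral_prod_mul (by fun_prop) (by fun_prop)]
    refine lintegral_congr fun y => ?_
    rw [← ENNReal.ofReal_mul (Real.exp_pos _).le, ← Real.exp_add]
    congr 2; ring
  rw [lapLaw, fixedPointMap_eq, lintegral_map (by fun_prop) measurable_fixedPoint_integrand,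
    lintegral_prod _ (by fun_prop)]
  simp only [e]
  rw [lintegral_prod _ (by fun_prop)]
  simp only [coefL, coefR, mul_assoc]

theorem IsSolution.lintegral_id {ψ : Measure ℝ} (hψ : IsSolution ψ) (h0 : ∀ᵐ x ∂ψ, 0 ≤ x) :
    ∫⁻ x, ENNReal.ofReal x ∂ψ = 1 := by
  have := hψ.isProbabilityMeasure
  rw [← ofReal_integral_eq_lintegral_ofReal (hψ.memLp_two.integrable (by norm_num)) h0,
    hψ.mean_eq_one, ENNReal.ofReal_one]

theorem IsSolution.lintegral_sq {ψ : Measure ℝ} (hψ : IsSolution ψ) :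
    ∫⁻ x, ENNReal.ofReal (x ^ 2) ∂ψ = ENNReal.ofReal (∫ x, x ^ 2 ∂ψ) := by
  rw [← ofReal_integral_eq_lintegral_ofReal hψ.memLp_two.integrable_sq
    (Eventually.of_forall fun x => sq_nonneg x)]

/-- The laws of `h(s) Ψ`, for `Ψ` with law `ψ`, satisfy the functional equation of the limits. -/
theorem IsSolution.isLaplaceSolution {ψ : Measure ℝ} (hψ : IsSolution ψ) (h0 : ∀ᵐ x ∂ψ, 0 ≤ x) :
    IsLaplaceSolution fun s t => lapLaw ψ (h s * t) where
  measurable := by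
    have := hψ.isProbabilityMeasure
    exact (measurable_lapLaw ψ).comp (by fun_prop)
  le_one s hs t ht := by
    have := hψ.isProbabilityMeasure
    exact lapLaw_le_one h0 (mul_nonneg (h_nonneg hs) ht)
  fixed s hs t ht := by
    have := hψ.isProbabilityMeasure
    have hml := measurable_lapLaw ψ
    have hw : Measurable fun p : ℝ × ℝ => sideWidth s p.1 :=
      Measurable.sideWidth_comp measurable_const measurable_fst
    have hp : Measurable fun p : ℝ × ℝ => sidePos s p.1 :=
      Measurable.sidePos_comp measurable_const measurable_fst
    have e := lintegral_sideWidth_rpow_mul_h hs fun r => ∫⁻ y, lapLaw ψ (r * t * y ^ β) *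
      lapLaw ψ (r * t * (1 - y) ^ β) ∂unif
    rw [unifSq, lintegral_prod _ (by fun_prop), ← hψ.fixed, lapLaw_fixedPointMap, hψ.fixed]
    simp only [mul_right_comm (h s) t, ← e]
    refine lintegral_congr_ae ?_
    filter_upwards [ae_unif_Ioo] with x hx
    have hw0 := (sideWidth_mem (s := s) hx).1.le
    refine lintegral_congr_ae ?_
    filter_upwards [ae_unif_Ioo] with y hy
    have hy1 : 0 ≤ 1 - y := by linarith [hy.2]
    rw [Real.mul_rpow hw0 hy.1.le, Real.mul_rpow hw0 hy1]
    congr 2 <;> ring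
  one_le t ht := by
    have := hψ.isProbabilityMeasure
    filter_upwards [ae_unif_mem] with s hs
    have hτ : 0 ≤ t * h s := mul_nonneg ht (h_nonneg hs)
    have e : ENNReal.ofReal (t * h s) = ∫⁻ x, ENNReal.ofReal (t * h s) * ENNReal.ofReal x ∂ψ := by
      rw [lintegral_const_mul' _ _ ENNReal.ofReal_ne_top, hψ.lintegral_id h0, mul_one]
    rw [e, lapLaw, ← lintegral_add_left (by fun_prop)]
    calc (1 : ℝ≥0∞) = ∫⁻ _x, 1 ∂ψ := by simp
      _ ≤ _ := by
        refine lintegral_mono_ae ?_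
        filter_upwards [h0] with x hx
        rw [← ENNReal.ofReal_mul hτ, ← ENNReal.ofReal_add (Real.exp_pos _).le (mul_nonneg hτ hx),
          ← ENNReal.ofReal_one]
        refine ENNReal.ofReal_le_ofReal ?_
        have h1 := Real.add_one_le_exp (-(h s * t * x))
        nlinarith
  exists_le := by
    have := hψ.isProbabilityMeasure
    have hml := measurable_lapLaw ψ
    set m₂ := ∫ x, x ^ 2 ∂ψ with hm₂
    have hm₂0 : 0 ≤ m₂ := integral_nonneg fun x => sq_nonneg x
    refine ⟨m₂ / 2, by positivity, fun t ht => ?_⟩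
    have hth : ENNReal.ofReal (t * (meanConst / K₁)) = ∫⁻ s, ENNReal.ofReal (t * h s) ∂unif := by
      rw [ENNReal.ofReal_mul ht, ← lintegral_h, ← lintegral_const_mul' _ _ ENNReal.ofReal_ne_top]
      simp only [ENNReal.ofReal_mul ht]
    rw [hth, ← lintegral_add_left (by fun_prop)]
    calc ∫⁻ s, (lapLaw ψ (h s * t) + ENNReal.ofReal (t * h s)) ∂unif
        ≤ ∫⁻ _s, (1 + ENNReal.ofReal (m₂ / 2 * t ^ 2)) ∂unif := by
          refine lintegral_mono_ae ?_
          filter_upwards [ae_unif_mem] with s hs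
          have hτ : 0 ≤ t * h s := mul_nonneg ht (h_nonneg hs)
          have hτt : t * h s ≤ t := mul_le_of_le_one_right ht (h_le_one hs)
          have e : ENNReal.ofReal (t * h s) =
              ∫⁻ x, ENNReal.ofReal (t * h s) * ENNReal.ofReal x ∂ψ := by
            rw [lintegral_const_mul' _ _ ENNReal.ofReal_ne_top, hψ.lintegral_id h0, mul_one]
          have e2 : 1 + ENNReal.ofReal (m₂ / 2 * t ^ 2) =
              ∫⁻ x, (1 + ENNReal.ofReal (t ^ 2 / 2) * ENNReal.ofReal (x ^ 2)) ∂ψ := by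
            rw [lintegral_add_left measurable_const, lintegral_const_mul' _ _ ENNReal.ofReal_ne_top,
              hψ.lintegral_sq, ← hm₂, ← ENNReal.ofReal_mul (by positivity)]
            simp only [lintegral_const, measure_univ, mul_one]
            congr 2; ring
          rw [e, e2, lapLaw, ← lintegral_add_left (by fun_prop)]
          refine lintegral_mono_ae ?_
          filter_upwards [h0] with x hx
          rw [← ENNReal.ofReal_mul hτ, ← ENNReal.ofReal_add (Real.exp_pos _).le (mul_nonneg hτ hx),
            ← ENNReal.ofReal_one, ← ENNReal.ofReal_mul (by positivity),
            ← ENNReal.ofReal_add zero_le_one (by positivity)]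
          refine ENNReal.ofReal_le_ofReal ?_
          have h1 := exp_neg_le_quadratic (mul_nonneg hτ hx)
          have h2 : (t * h s * x) ^ 2 ≤ (t * x) ^ 2 := by gcongr
          rw [mul_comm (h s) t]
          nlinarith
      _ = _ := by simp

/-! ### One-dimensional marginals and the Skorokhod topology -/

namespace SkorokhodClose

variable {f g k : SkorokhodSpace} {ε δ : ℝ}

theorem refl (f : SkorokhodSpace) (hε : 0 < ε) : SkorokhodClose ε f f :=
  ⟨OrderIso.refl _, fun t => by simpa using hε⟩

theorem symm (hfg : SkorokhodClose ε f g) : SkorokhodClose ε g f := by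
  obtain ⟨lam, hlam⟩ := hfg
  refine ⟨lam.symm, fun t => ?_⟩
  have h1 := hlam (lam.symm t)
  rw [OrderIso.apply_symm_apply] at h1
  exact ⟨by rw [abs_sub_comm]; exact h1.1, by rw [abs_sub_comm]; exact h1.2⟩

theorem trans (hfg : SkorokhodClose ε f g) (hgk : SkorokhodClose δ g k) :
    SkorokhodClose (ε + δ) f k := by
  obtain ⟨l₁, h₁⟩ := hfg
  obtain ⟨l₂, h₂⟩ := hgk
  refine ⟨l₁.trans l₂, fun t => ?_⟩
  have a := h₁ t
  have b := h₂ (l₁ t)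
  rw [OrderIso.trans_apply]
  constructor
  · calc |(l₂ (l₁ t) : ℝ) - t| ≤ |(l₂ (l₁ t) : ℝ) - l₁ t| + |(l₁ t : ℝ) - t| := abs_sub_le _ _ _
      _ < ε + δ := by linarith [a.1, b.1]
  · calc |k (l₂ (l₁ t)) - f t| ≤ |k (l₂ (l₁ t)) - g (l₁ t)| + |g (l₁ t) - f t| := abs_sub_le _ _ _
      _ < ε + δ := by linarith [a.2, b.2]

theorem mono (hfg : SkorokhodClose ε f g) (hεδ : ε ≤ δ) : SkorokhodClose δ f g := by
  obtain ⟨lam, hlam⟩ := hfg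
  exact ⟨lam, fun t => ⟨(hlam t).1.trans_le hεδ, (hlam t).2.trans_le hεδ⟩⟩

end SkorokhodClose

/-- The largest minorant of `φ` that is Lipschitz with constant `k` for the Skorokhod distance. -/
noncomputable def lowerEnvelope (φ : SkorokhodSpace → ℝ) (k : ℝ) (f : SkorokhodSpace) : ℝ :=
  ⨅ x : {x : SkorokhodSpace × ℝ // 0 < x.2 ∧ SkorokhodClose x.2 f x.1}, (φ x.1.1 + k * x.1.2)

section lowerEnvelope

variable {φ : SkorokhodSpace → ℝ} {k : ℝ}

instance (f : SkorokhodSpace) :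
    Nonempty {x : SkorokhodSpace × ℝ // 0 < x.2 ∧ SkorokhodClose x.2 f x.1} :=
  ⟨⟨(f, 1), one_pos, SkorokhodClose.refl f one_pos⟩⟩

theorem lowerEnvelope_nonneg (hφ : ∀ f, 0 ≤ φ f) (hk : 0 ≤ k) (f : SkorokhodSpace) :
    0 ≤ lowerEnvelope φ k f :=
  le_ciInf fun x => add_nonneg (hφ _) (mul_nonneg hk x.2.1.le)

theorem lowerEnvelope_le_of_close (hφ : ∀ f, 0 ≤ φ f) (hk : 0 ≤ k) {f g : SkorokhodSpace} {ε : ℝ}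
    (hε : 0 < ε) (hfg : SkorokhodClose ε f g) : lowerEnvelope φ k f ≤ φ g + k * ε :=
  ciInf_le (f := fun x : {x : SkorokhodSpace × ℝ // 0 < x.2 ∧ SkorokhodClose x.2 f x.1} =>
    φ x.1.1 + k * x.1.2)
    ⟨0, by rintro _ ⟨x, rfl⟩; exact add_nonneg (hφ _) (mul_nonneg hk x.2.1.le)⟩ ⟨(g, ε), hε, hfg⟩

theorem lowerEnvelope_le (hφ : ∀ f, 0 ≤ φ f) (hk : 0 ≤ k) (f : SkorokhodSpace) :
    lowerEnvelope φ k f ≤ φ f := by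
  refine le_of_forall_pos_le_add fun ε hε => ?_
  have hδ : 0 < ε / (k + 1) := by positivity
  refine (lowerEnvelope_le_of_close hφ hk hδ (SkorokhodClose.refl f hδ)).trans ?_
  gcongr
  rw [mul_div_assoc', div_le_iff₀ (by positivity)]
  nlinarith

theorem lowerEnvelope_le_add (hφ : ∀ f, 0 ≤ φ f) (hk : 0 ≤ k) {f g : SkorokhodSpace} {δ : ℝ}
    (hδ : 0 < δ) (hfg : SkorokhodClose δ f g) :
    lowerEnvelope φ k g ≤ lowerEnvelope φ k f + k * δ := by
  rw [← sub_le_iff_le_add]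
  refine le_ciInf fun x => ?_
  have h1 := lowerEnvelope_le_of_close hφ hk (add_pos hδ x.2.1) (hfg.symm.trans x.2.2)
  linarith

theorem continuous_lowerEnvelope (hφ : ∀ f, 0 ≤ φ f) (hk : 0 ≤ k) :
    Continuous (lowerEnvelope φ k) := by
  refine continuous_def.2 fun U hU => ?_
  intro f hf
  obtain ⟨r, hr, hball⟩ := Metric.isOpen_iff.1 hU _ hf
  have hδ : 0 < r / (k + 1) := by positivity
  refine ⟨r / (k + 1), hδ, fun g hfg => hball ?_⟩
  have h1 := lowerEnvelope_le_add hφ hk hδ hfg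
  have h2 := lowerEnvelope_le_add hφ hk hδ hfg.symm
  have h3 : k * (r / (k + 1)) < r := by
    rw [mul_div_assoc', div_lt_iff₀ (by positivity)]
    nlinarith
  rw [Metric.mem_ball, Real.dist_eq, abs_lt]
  constructor <;> linarith

/-- If `φ` takes values in `[0,1]` and is lower semicontinuous at `f`, then the minorants converge
to `φ` at `f`. -/
theorem tendsto_lowerEnvelope (hφ : ∀ f, 0 ≤ φ f) (hφ1 : ∀ f, φ f ≤ 1) {f : SkorokhodSpace}
    (hf : ∀ η > 0, ∃ δ > 0, ∀ g, SkorokhodClose δ f g → φ f - η ≤ φ g) :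
    Tendsto (fun n : ℕ => lowerEnvelope φ n f) atTop (𝓝 (φ f)) := by
  rw [Metric.tendsto_atTop]
  intro η hη
  obtain ⟨δ, hδ, hlsc⟩ := hf (η / 2) (by positivity)
  obtain ⟨N, hN⟩ := exists_nat_gt (1 / δ)
  refine ⟨N, fun n hn => ?_⟩
  have hn' : (N : ℝ) ≤ n := by exact_mod_cast hn
  have h1 := lowerEnvelope_le hφ n.cast_nonneg f
  have h2 : φ f - η / 2 ≤ lowerEnvelope φ n f := by
    refine le_ciInf fun x => ?_
    rcases le_total x.1.2 δ with hx | hx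
    · have h3 := hlsc x.1.1 (x.2.2.mono hx)
      have h4 : 0 ≤ (n : ℝ) * x.1.2 := mul_nonneg n.cast_nonneg x.2.1.le
      linarith
    · have h3 : 1 ≤ (n : ℝ) * x.1.2 := by
        rw [div_lt_iff₀ hδ] at hN
        have := mul_le_mul hn' hx hδ.le n.cast_nonneg
        linarith
      linarith [hφ x.1.1, hφ1 f]
  rw [Real.dist_eq, abs_lt]
  constructor <;> linarith

end lowerEnvelope

theorem eval_lsc {η : ℝ → ℝ} (hη : Continuous η) {f : SkorokhodSpace} (hf : Continuous f)
    (s : unitInterval) {r : ℝ} (hr : 0 < r) :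
    ∃ δ > 0, ∀ g, SkorokhodClose δ f g → η (f s) - r ≤ η (g s) := by
  obtain ⟨ρ, hρ, h1⟩ := Metric.continuous_iff.1 hη (f s) r hr
  obtain ⟨ρ', hρ', h2⟩ := Metric.continuous_iff.1 hf s (ρ / 2) (by positivity)
  refine ⟨min (ρ / 2) ρ', by positivity, fun g hfg => ?_⟩
  obtain ⟨lam, hlam⟩ := hfg
  have h3 := hlam (lam.symm s)
  rw [OrderIso.apply_symm_apply] at h3
  have h4 : dist (f (lam.symm s)) (f s) < ρ / 2 := by
    refine h2 _ ?_
    rw [Subtype.dist_eq, dist_comm, Real.dist_eq]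
    exact h3.1.trans_le (min_le_right _ _)
  have h5 : dist (g s) (f s) < ρ := by
    calc dist (g s) (f s) ≤ dist (g s) (f (lam.symm s)) + dist (f (lam.symm s)) (f s) :=
          dist_triangle _ _ _
      _ < ρ / 2 + ρ / 2 := by
          gcongr
          rw [Real.dist_eq]
          exact h3.2.trans_le (min_le_left _ _)
      _ = ρ := by ring
  have h6 := h1 _ h5
  rw [Real.dist_eq, abs_lt] at h6
  linarith

theorem aemeasurable_eval {Ω' : Type*} [MeasurableSpace Ω'] {P' : Measure Ω'}
    {Z : Ω' → SkorokhodSpace} (hZ : AEMeasurable Z P') (hcont : ∀ᵐ ω ∂P', Continuous (Z ω)) (s : unitInterval) :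
    AEMeasurable (fun ω => Z ω s) P' := by
  set η : ℝ → ℝ := fun x => Real.arctan x / Real.pi + 1 / 2 with hη
  have hpi := Real.pi_pos
  have hηc : Continuous η := by fun_prop
  have h0 : ∀ x, 0 ≤ η x := fun x => by
    have : -(Real.pi / 2) / Real.pi ≤ Real.arctan x / Real.pi := by
      gcongr; exact (Real.neg_pi_div_two_lt_arctan x).le
    have e : -(Real.pi / 2) / Real.pi = -(1 / 2) := by field_simp
    rw [e] at this
    simp only [hη]; linarith
  have h1 : ∀ x, η x ≤ 1 := fun x => by
    have : Real.arctan x / Real.pi ≤ (Real.pi / 2) / Real.pi := by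
      gcongr; exact (Real.arctan_lt_pi_div_two x).le
    have e : (Real.pi / 2) / Real.pi = 1 / 2 := by field_simp
    rw [e] at this
    simp only [hη]; linarith
  have hm : AEMeasurable (fun ω => η (Z ω s)) P' := by
    refine aemeasurable_of_tendsto_metrizable_ae' (f := fun (k : ℕ) ω =>
      lowerEnvelope (fun f => η (f s)) (k : ℝ) (Z ω)) (fun k =>
      (continuous_lowerEnvelope (fun f => h0 _) k.cast_nonneg).measurable.comp_aemeasurable hZ) ?_
    filter_upwards [hcont] with ω hω
    exact tendsto_lowerEnvelope (fun f => h0 _) (fun f => h1 _) fun r hr => eval_lsc hηc hω s hr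
  have htan : Measurable fun y => Real.tan (Real.pi * (y - 1 / 2)) := by
    simp only [Real.tan_eq_sin_div_cos]; fun_prop
  refine (htan.comp_aemeasurable hm).congr (Eventually.of_forall fun ω => ?_)
  have : Real.pi * (Real.arctan (Z ω s) / Real.pi + 1 / 2 - 1 / 2) = Real.arctan (Z ω s) := by
    field_simp; ring
  simp only [Function.comp_apply, hη, this, Real.tan_arctan]

theorem integrable_comp_of_mem_Icc {α : Type*} [MeasurableSpace α] {Q : Measure α}
    [IsProbabilityMeasure Q] {η : ℝ → ℝ} (hη : Continuous η) (h0 : ∀ x, 0 ≤ η x) (h1 : ∀ x, η x ≤ 1)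
    {W : α → ℝ} (hW : AEMeasurable W Q) : Integrable (fun ω => η (W ω)) Q := by
  refine Integrable.of_bound (hη.measurable.comp_aemeasurable hW).aestronglyMeasurable 1
    (Eventually.of_forall fun ω => ?_)
  rw [Real.norm_of_nonneg (h0 _)]
  exact h1 _

theorem integral_one_sub_comp {α : Type*} [MeasurableSpace α] {Q : Measure α}
    [IsProbabilityMeasure Q] {η : ℝ → ℝ} (hη : Continuous η) (h0 : ∀ x, 0 ≤ η x) (h1 : ∀ x, η x ≤ 1)
    {W : α → ℝ} (hW : AEMeasurable W Q) : ∫ ω, (1 - η (W ω)) ∂Q = 1 - ∫ ω, η (W ω) ∂Q := by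
  rw [integral_sub (integrable_const _) (integrable_comp_of_mem_Icc hη h0 h1 hW)]
  simp

section Marginal

variable {Ω : Type*} [MeasurableSpace Ω] {P : Measure Ω} [IsProbabilityMeasure P]
  {Ω' : Type*} [MeasurableSpace Ω'] {P' : Measure Ω'} [IsProbabilityMeasure P']
  {Y : ℕ → Ω → SkorokhodSpace} {Z : Ω' → SkorokhodSpace}

theorem tendsto_integral_lowerEnvelope {η : ℝ → ℝ} (hη : Continuous η) (h0 : ∀ x, 0 ≤ η x)
    (h1 : ∀ x, η x ≤ 1) (hZ : AEMeasurable Z P') (hcont : ∀ᵐ ω ∂P', Continuous (Z ω))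
    (s : unitInterval) :
    Tendsto (fun k : ℕ => ∫ ω, lowerEnvelope (fun f => η (f s)) k (Z ω) ∂P') atTop
      (𝓝 (∫ ω, η (Z ω s) ∂P')) := by
  have hm : ∀ k : ℕ, AEStronglyMeasurable
      (fun ω => lowerEnvelope (fun f => η (f s)) (k : ℝ) (Z ω)) P' := fun k =>
    ((continuous_lowerEnvelope (fun f => h0 _) k.cast_nonneg).measurable.comp_aemeasurable
      hZ).aestronglyMeasurable
  refine tendsto_integral_of_dominated_convergence (fun _ => 1) hm (integrable_const _) ?_ ?_
  · intro k
    refine Eventually.of_forall fun ω => ?_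
    rw [Real.norm_of_nonneg (lowerEnvelope_nonneg (fun f => h0 _) k.cast_nonneg _)]
    exact (lowerEnvelope_le (fun f => h0 _) k.cast_nonneg _).trans (h1 _)
  · filter_upwards [hcont] with ω hω
    exact tendsto_lowerEnvelope (fun f => h0 _) (fun f => h1 _) fun r hr => eval_lsc hη hω s hr

theorem eventually_lt_integral_eval {η : ℝ → ℝ} (hη : Continuous η) (h0 : ∀ x, 0 ≤ η x)
    (h1 : ∀ x, η x ≤ 1) (hYZ : TendstoInDistribution Y atTop Z (fun _ => P) P')
    (hcont : ∀ᵐ ω ∂P', Continuous (Z ω)) (s : unitInterval)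
    (hY : ∀ n, AEMeasurable (fun ω => Y n ω s) P) {a : ℝ} (ha : a < ∫ ω, η (Z ω s) ∂P') :
    ∀ᶠ n in atTop, a < ∫ ω, η (Y n ω s) ∂P := by
  have hZ := hYZ.aemeasurable_limit
  obtain ⟨k, hk⟩ := ((tendsto_integral_lowerEnvelope hη h0 h1 hZ hcont s).eventually_const_lt ha).exists
  have hφ0 : ∀ f : SkorokhodSpace, 0 ≤ η (f s) := fun f => h0 _
  have hc := continuous_lowerEnvelope hφ0 k.cast_nonneg
  have hnonneg := lowerEnvelope_nonneg hφ0 k.cast_nonneg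
  have hle := lowerEnvelope_le hφ0 k.cast_nonneg
  have hbd : ∀ f, ‖lowerEnvelope (fun f => η (f s)) k f‖ ≤ 1 := fun f => by
    rw [Real.norm_of_nonneg (hnonneg f)]
    exact (hle f).trans (h1 _)
  have h2 := ProbabilityMeasure.tendsto_iff_forall_integral_tendsto.1 hYZ.tendsto
    (BoundedContinuousFunction.ofNormedAddCommGroup _ hc 1 hbd)
  simp only [ProbabilityMeasure.coe_mk, BoundedContinuousFunction.coe_ofNormedAddCommGroup] at h2
  rw [integral_map hZ hc.aestronglyMeasurable] at h2
  filter_upwards [h2.eventually_const_lt hk] with n hn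
  rw [integral_map (hYZ.forall_aemeasurable n) hc.aestronglyMeasurable] at hn
  refine hn.trans_le (integral_mono ?_ ?_ fun ω => hle _)
  · exact Integrable.of_bound (hc.measurable.comp_aemeasurable
      (hYZ.forall_aemeasurable n)).aestronglyMeasurable 1 (Eventually.of_forall fun ω => hbd _)
  · exact integrable_comp_of_mem_Icc hη h0 h1 (hY n)

/-- Convergence in distribution for the Skorokhod topology towards a continuous process entails the
convergence of the one-dimensional marginals: evaluation at `s` is not continuous on `D[0,1]`, but it
is so at every continuous function. -/
theorem tendsto_integral_eval {η : ℝ → ℝ} (hη : Continuous η) (h0 : ∀ x, 0 ≤ η x)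
    (h1 : ∀ x, η x ≤ 1) (hYZ : TendstoInDistribution Y atTop Z (fun _ => P) P')
    (hcont : ∀ᵐ ω ∂P', Continuous (Z ω)) (s : unitInterval)
    (hY : ∀ n, AEMeasurable (fun ω => Y n ω s) P) :
    Tendsto (fun n => ∫ ω, η (Y n ω s) ∂P) atTop (𝓝 (∫ ω, η (Z ω s) ∂P')) := by
  have hZs := aemeasurable_eval hYZ.aemeasurable_limit hcont s
  refine tendsto_order.2 ⟨fun a ha => eventually_lt_integral_eval hη h0 h1 hYZ hcont s hY ha,
    fun a ha => ?_⟩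
  have h2 := eventually_lt_integral_eval (η := fun x => 1 - η x) (a := 1 - a) (by fun_prop)
    (fun x => by linarith [h1 x]) (fun x => by linarith [h0 x]) hYZ hcont s hY
    (by rw [integral_one_sub_comp hη h0 h1 hZs]; linarith)
  filter_upwards [h2] with n hn
  rw [integral_one_sub_comp hη h0 h1 (hY n)] at hn
  linarith

end Marginal

/-! ### Identification of the limit process -/

theorem cost_quadtree_eq_listCost (p : ℕ → ℝ × ℝ) (n : ℕ) (s : ℝ) :
    (quadtree p n).cost s = listCost s (List.ofFn fun i : Fin n => p i) := by
  rw [quadtree_eq_foldl, listCost]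

theorem continuous_h : Continuous h := by
  have := β_pos
  exact Continuous.rpow_const (by fun_prop) fun _ => Or.inr (by positivity)

section Identification

variable {Ω : Type*} [MeasurableSpace Ω] {P : Measure Ω} {X : ℕ → Ω → ℝ × ℝ}

theorem aemeasurable_points
    (hlaw : ∀ i, HasLaw (X i) (volume.restrict (Icc (0 : ℝ) 1 ×ˢ Icc (0 : ℝ) 1)) P) (n : ℕ) :
    AEMeasurable (fun ω (i : Fin n) => X i ω) P :=
  aemeasurable_pi_lambda _ fun i => (hlaw i).aemeasurable

theorem aemeasurable_rescaledCost_eval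
    (hlaw : ∀ i, HasLaw (X i) (volume.restrict (Icc (0 : ℝ) 1 ×ˢ Icc (0 : ℝ) 1)) P)
    (s : unitInterval) (n : ℕ) :
    AEMeasurable (fun ω => rescaledCost (fun i => X i ω) n s) P := by
  have hm : Measurable fun v : Fin n → ℝ × ℝ =>
      ((listCost s (List.ofFn v) : ℕ) : ℝ) / (K₁ * (n : ℝ) ^ β) :=
    ((measurable_of_countable (fun k : ℕ => (k : ℝ))).comp
      ((measurable_listCost n).comp (measurable_const.prodMk measurable_id))).div_const _
  refine (hm.comp_aemeasurable (aemeasurable_points hlaw n)).congr (Eventually.of_forall fun ω => ?_)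
  simp only [Function.comp_apply, rescaledCost, cost_quadtree_eq_listCost]

variable [IsProbabilityMeasure P]

theorem map_points_eq_pi (hX : iIndepFun X P)
    (hlaw : ∀ i, HasLaw (X i) (volume.restrict (Icc (0 : ℝ) 1 ×ˢ Icc (0 : ℝ) 1)) P) (n : ℕ) :
    P.map (fun ω (i : Fin n) => X i ω) = Measure.pi fun _ : Fin n => unifSq := by
  have h1 : iIndepFun (fun i : Fin n => X i) P := hX.precomp Fin.val_injective
  rw [(iIndepFun_iff_map_fun_eq_pi_map fun i : Fin n => (hlaw i).aemeasurable).1 h1]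
  congr 1
  funext i
  rw [(hlaw i).map_eq, unifSq_eq]

/-- The truncation at `0` makes `x ↦ exp (-t x)` a bounded function on the line. -/
theorem lapCost_eq_integral (hX : iIndepFun X P)
    (hlaw : ∀ i, HasLaw (X i) (volume.restrict (Icc (0 : ℝ) 1 ×ˢ Icc (0 : ℝ) 1)) P)
    (s : unitInterval) (n : ℕ) {t : ℝ} (ht : 0 ≤ t) :
    lapCost n s t = ENNReal.ofReal
      (∫ ω, Real.exp (-(t * max (rescaledCost (fun i => X i ω) n s) 0)) ∂P) := by
  have hK := K₁_pos
  have hint : ∫ ω, Real.exp (-(t * max (rescaledCost (fun i => X i ω) n s) 0)) ∂P =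
      (∫⁻ ω, ENNReal.ofReal (Real.exp (-(t * max (rescaledCost (fun i => X i ω) n s) 0))) ∂P).toReal :=
    integral_eq_lintegral_of_nonneg_ae (Eventually.of_forall fun ω => (Real.exp_pos _).le)
      (((by fun_prop : Measurable fun x : ℝ => Real.exp (-(t * max x 0))).comp_aemeasurable
        (aemeasurable_rescaledCost_eval hlaw s n)).aestronglyMeasurable)
  have hlap : lapCost n s t =
      ∫⁻ ω, ENNReal.ofReal (Real.exp (-(t * max (rescaledCost (fun i => X i ω) n s) 0))) ∂P := by
    rw [lapCost, costExp_eq_lintegral, ← map_points_eq_pi hX hlaw, lintegral_map'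
      (measurable_listCost_ofFn (fun k => ENNReal.ofReal
        (Real.exp (-(t * (k / (K₁ * (n : ℝ) ^ β)))))) n s).aemeasurable (aemeasurable_points hlaw n)]
    refine lintegral_congr fun ω => ?_
    simp only [rescaledCost, cost_quadtree_eq_listCost]
    rw [max_eq_left (by positivity)]
  have hfin : lapCost n s t ≠ ⊤ := ((lapCost_le_one ht n s).trans_lt ENNReal.one_lt_top).ne
  rw [hint, ← hlap, ENNReal.ofReal_toReal hfin]

variable {Ω' : Type*} [MeasurableSpace Ω'] {P' : Measure Ω'} [IsProbabilityMeasure P']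
  {Z : Ω' → SkorokhodSpace}

theorem tendsto_lapCost (hX : iIndepFun X P)
    (hlaw : ∀ i, HasLaw (X i) (volume.restrict (Icc (0 : ℝ) 1 ×ˢ Icc (0 : ℝ) 1)) P)
    (hcont : ∀ᵐ ω ∂P', Continuous (Z ω))
    (hZ : TendstoInDistribution (fun n ω => rescaledCost (fun i => X i ω) n) atTop Z
      (fun _ => P) P') (s : unitInterval) {t : ℝ} (ht : 0 ≤ t) :
    Tendsto (fun n => lapCost n s t) atTop
      (𝓝 (ENNReal.ofReal (∫ ω, Real.exp (-(t * max (Z ω s) 0)) ∂P'))) := by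
  simp only [lapCost_eq_integral hX hlaw s _ ht]
  refine ENNReal.tendsto_ofReal (tendsto_integral_eval (η := fun x => Real.exp (-(t * max x 0)))
    (by fun_prop) (fun x => (Real.exp_pos _).le) (fun x => Real.exp_le_one_iff.2 ?_) hZ hcont s
    (aemeasurable_rescaledCost_eval hlaw s))
  have : 0 ≤ t * max x 0 := by positivity
  linarith

theorem ae_nonneg_limit
    (hlaw : ∀ i, HasLaw (X i) (volume.restrict (Icc (0 : ℝ) 1 ×ˢ Icc (0 : ℝ) 1)) P)
    (hcont : ∀ᵐ ω ∂P', Continuous (Z ω))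
    (hZ : TendstoInDistribution (fun n ω => rescaledCost (fun i => X i ω) n) atTop Z
      (fun _ => P) P') (s : unitInterval) : ∀ᵐ ω ∂P', 0 ≤ Z ω s := by
  have hK := K₁_pos
  have hηc : Continuous fun x : ℝ => min 1 (max (-x) 0) := by fun_prop
  have h0 : ∀ x : ℝ, 0 ≤ min 1 (max (-x) 0) := fun x => by positivity
  have h1 : ∀ x : ℝ, min 1 (max (-x) 0) ≤ 1 := fun x => min_le_left _ _
  have hlim := tendsto_integral_eval hηc h0 h1 hZ hcont s (aemeasurable_rescaledCost_eval hlaw s)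
  have hzero : ∀ n, ∫ ω, min 1 (max (-(rescaledCost (fun i => X i ω) n s)) 0) ∂P = 0 := by
    intro n
    refine (integral_congr_ae (Eventually.of_forall fun ω => ?_)).trans (integral_zero _ _)
    have : 0 ≤ rescaledCost (fun i => X i ω) n s := by
      simp only [rescaledCost]; positivity
    rw [max_eq_right (by linarith)]
    simp
  simp only [hzero] at hlim
  have hint := tendsto_nhds_unique hlim tendsto_const_nhds
  rw [integral_eq_zero_iff_of_nonneg_ae (Eventually.of_forall fun ω => h0 _)
    (integrable_comp_of_mem_Icc hηc h0 h1 (aemeasurable_eval hZ.aemeasurable_limit hcont s))] at hint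
  filter_upwards [hint] with ω hω
  by_contra hneg
  have : 0 < min 1 (max (-(Z ω s)) 0) := by
    refine lt_min one_pos (lt_max_of_lt_left ?_)
    linarith
  exact this.ne' hω

theorem lapLaw_eq_ofReal_integral {ψ : Measure ℝ} [IsProbabilityMeasure ψ] (hψ : ∀ᵐ x ∂ψ, 0 ≤ x)
    {τ : ℝ} (hτ : 0 ≤ τ) : lapLaw ψ τ = ENNReal.ofReal (∫ x, Real.exp (-(τ * max x 0)) ∂ψ) := by
  rw [ofReal_integral_eq_lintegral_ofReal, lapLaw]
  · refine lintegral_congr_ae ?_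
    filter_upwards [hψ] with x hx
    rw [max_eq_left hx]
  · refine Integrable.of_bound (by fun_prop) 1 (Eventually.of_forall fun x => ?_)
    rw [Real.norm_of_nonneg (Real.exp_pos _).le]
    refine Real.exp_le_one_iff.2 ?_
    have : 0 ≤ τ * max x 0 := mul_nonneg hτ (le_max_right _ _)
    linarith
  · exact Eventually.of_forall fun x => (Real.exp_pos _).le

/-- The Laplace transforms of the marginals of the limit, first for almost every `s`, then for all of
them by continuity. -/
theorem integral_exp_limit_eq {ψ : Measure ℝ} (hψ : IsSolution ψ) (hψ0 : ∀ᵐ x ∂ψ, 0 ≤ x)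
    (hX : iIndepFun X P)
    (hlaw : ∀ i, HasLaw (X i) (volume.restrict (Icc (0 : ℝ) 1 ×ˢ Icc (0 : ℝ) 1)) P)
    (hcont : ∀ᵐ ω ∂P', Continuous (Z ω))
    (hZ : TendstoInDistribution (fun n ω => rescaledCost (fun i => X i ω) n) atTop Z
      (fun _ => P) P') (s : unitInterval) {t : ℝ} (ht : 0 ≤ t) :
    ∫ ω, Real.exp (-(t * max (Z ω s) 0)) ∂P' = ∫ x, Real.exp (-(h s * t * max x 0)) ∂ψ := by
  have := hψ.isProbabilityMeasure
  have hlap : ∀ (s : unitInterval) (t : ℝ), 0 ≤ t →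
      limLap s t = ENNReal.ofReal (∫ ω, Real.exp (-(t * max (Z ω s) 0)) ∂P') := fun s t ht =>
    (tendsto_lapCost hX hlaw hcont hZ s ht).liminf_eq
  have hconv : LapConverges := by
    intro s hs t ht
    rw [hlap ⟨s, hs⟩ t ht]
    exact tendsto_lapCost hX hlaw hcont hZ ⟨s, hs⟩ ht
  have hae := hconv.isLaplaceSolution.ae_eq (hψ.isLaplaceSolution hψ0) ht
  have hbound : ∀ τ y : ℝ, 0 ≤ τ → ‖Real.exp (-(τ * max y 0))‖ ≤ 1 := by
    intro τ y hτ
    rw [Real.norm_of_nonneg (Real.exp_pos _).le]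
    refine Real.exp_le_one_iff.2 ?_
    have : 0 ≤ τ * max y 0 := mul_nonneg hτ (le_max_right _ _)
    linarith
  have hf : Continuous fun x : ℝ =>
      ∫ ω, Real.exp (-(t * max (Z ω (projIcc 0 1 zero_le_one x)) 0)) ∂P' := by
    refine continuous_of_dominated (bound := fun _ => 1) (fun x => ?_)
      (fun x => Eventually.of_forall fun ω => hbound _ _ ht) (integrable_const _) ?_
    · exact ((by fun_prop : Measurable fun y : ℝ => Real.exp (-(t * max y 0))).comp_aemeasurable
        (aemeasurable_eval hZ.aemeasurable_limit hcont _)).aestronglyMeasurable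
    · filter_upwards [hcont] with ω hω
      have : Continuous fun x => Z ω (projIcc 0 1 zero_le_one x) := hω.comp continuous_projIcc
      fun_prop
  have hg : ContinuousOn (fun x : ℝ => ∫ y, Real.exp (-(h x * t * max y 0)) ∂ψ) (Icc 0 1) := by
    have hch := continuous_h
    refine continuousOn_of_dominated (bound := fun _ => 1) (fun x _ => by fun_prop)
      (fun x hx => Eventually.of_forall fun y => hbound _ _ (mul_nonneg (h_nonneg hx) ht))
      (integrable_const _) (Eventually.of_forall fun y => ?_)
    exact Continuous.continuousOn (by fun_prop)
  have heq := Measure.eqOn_Icc_of_ae_eq (μ := volume) (zero_ne_one (α := ℝ)) (f := fun x : ℝ =>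
    ∫ ω, Real.exp (-(t * max (Z ω (projIcc 0 1 zero_le_one x)) 0)) ∂P') (g := fun x : ℝ =>
    ∫ y, Real.exp (-(h x * t * max y 0)) ∂ψ) (by
      filter_upwards [hae, ae_unif_mem] with x hx hx01
      have h1 := hlap ⟨x, hx01⟩ t ht
      have h2 := lapLaw_eq_ofReal_integral hψ0 (mul_nonneg (h_nonneg hx01) ht)
      rw [hx, h2] at h1
      rw [projIcc_of_mem zero_le_one hx01]
      exact ((ENNReal.ofReal_eq_ofReal_iff (integral_nonneg fun _ => (Real.exp_pos _).le)
        (integral_nonneg fun _ => (Real.exp_pos _).le)).1 h1).symm) hf.continuousOn hg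
  have h1 := heq s.2
  dsimp only at h1
  rwa [projIcc_of_mem zero_le_one s.2] at h1

theorem identDistrib_limit {ψ : Measure ℝ} (hψ : IsSolution ψ) (hψ0 : ∀ᵐ x ∂ψ, 0 ≤ x)
    (hX : iIndepFun X P)
    (hlaw : ∀ i, HasLaw (X i) (volume.restrict (Icc (0 : ℝ) 1 ×ˢ Icc (0 : ℝ) 1)) P)
    (hcont : ∀ᵐ ω ∂P', Continuous (Z ω))
    (hZ : TendstoInDistribution (fun n ω => rescaledCost (fun i => X i ω) n) atTop Z
      (fun _ => P) P') (s : unitInterval) :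
    IdentDistrib (fun ω => Z ω s) (fun x : ℝ => h s * x) P' ψ := by
  have := hψ.isProbabilityMeasure
  have hm := aemeasurable_eval hZ.aemeasurable_limit hcont s
  have hm2 : Measurable fun x : ℝ => h s * x := by fun_prop
  have hnn := ae_nonneg_limit hlaw hcont hZ s
  have : IsProbabilityMeasure (P'.map fun ω => Z ω s) := Measure.isProbabilityMeasure_map hm
  have : IsProbabilityMeasure (ψ.map fun x => h s * x) :=
    Measure.isProbabilityMeasure_map hm2.aemeasurable
  refine ⟨hm, hm2.aemeasurable, ext_of_lapLaw ?_ ?_ fun n => ?_⟩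
  · exact (ae_map_iff hm measurableSet_Ici).2 hnn
  · refine (ae_map_iff hm2.aemeasurable measurableSet_Ici).2 ?_
    filter_upwards [hψ0] with x hx using mul_nonneg (h_nonneg s.2) hx
  · have h1 := integral_exp_limit_eq hψ hψ0 hX hlaw hcont hZ s n.cast_nonneg
    have h2 : lapLaw (P'.map fun ω => Z ω s) n =
        ENNReal.ofReal (∫ ω, Real.exp (-(n * max (Z ω s) 0)) ∂P') := by
      rw [lapLaw_eq_ofReal_integral ((ae_map_iff hm measurableSet_Ici).2 hnn) n.cast_nonneg,
        integral_map hm (by fun_prop)]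
    have h3 : lapLaw (ψ.map fun x => h s * x) n = lapLaw ψ (h s * n) := by
      rw [lapLaw, lintegral_map (by fun_prop) hm2, lapLaw]
      refine lintegral_congr fun x => ?_
      congr 3; ring
    rw [h2, h3, h1, lapLaw_eq_ofReal_integral hψ0 (mul_nonneg (h_nonneg s.2) n.cast_nonneg)]

end Identification

end PartialMatch

theorem theorem5 :
    ∃ ψ : Measure ℝ,
      (∀ᵐ x ∂ψ, 0 ≤ x) ∧
      PartialMatch.IsSolution ψ ∧
      (∀ φ : Measure ℝ, PartialMatch.IsSolution φ → φ = ψ) ∧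
      ∀ (Ω : Type*) [MeasurableSpace Ω] (P : Measure Ω) [IsProbabilityMeasure P]
        (Ω' : Type*) [MeasurableSpace Ω'] (P' : Measure Ω') [IsProbabilityMeasure P']
        (X : ℕ → Ω → ℝ × ℝ) (Z : Ω' → PartialMatch.SkorokhodSpace),
        iIndepFun X P →
        (∀ i, HasLaw (X i) (volume.restrict (Icc (0 : ℝ) 1 ×ˢ Icc (0 : ℝ) 1)) P) →
        (∀ᵐ ω ∂P', Continuous (Z ω)) →
        TendstoInDistribution
          (fun n ω => PartialMatch.rescaledCost (fun i => X i ω) n) atTop Z (fun _ => P) P' →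
        ∀ s : unitInterval,
          IdentDistrib (fun ω => Z ω s) (fun x : ℝ => PartialMatch.h s * x) P' ψ := by
  obtain ⟨ψ, hψ0, hψ⟩ := PartialMatch.exists_isSolution
  refine ⟨ψ, hψ0, hψ, fun φ hφ => hφ.unique hψ, ?_⟩
  intro Ω _ P _ Ω' _ P' _ X Z hX hlaw hcont hZ s
  exact PartialMatch.identDistrib_limit hψ hψ0 hX hlaw hcont hZ s
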